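/- \textbf{Setting.} For $n\ge 1$ and real functions $a_1,\dots,a_n$ on an open interval $I\subseteq\mathbb R$ put $P_a(t)(Z)=Z^n+\sum_{j=1}^n a_j(t)Z^{n-j}$. For $p\ge 1$, $C^{p-1,1}(I)$ is the set of $f\in C^{p-1}(I)$ whose derivative $f^{(p-1)}$ is locally Lipschitz; for $K\subseteq I$, $$\operatorname{Lip}_K(f)=\sup_{x\ne y\in K}\frac{|f(x)-f(y)|}{|x-y|},\qquad \|f\|_{C^{p-1,1}(K)}=\max_{0\le k\le p-1}\sup_K|f^{(k)}|+\operatorname{Lip}_K(f^{(p-1)}).$$ $P_a$ is a \emph{$C^{p-1,1}$-curve of hyperbolic polynomials of degree $n$} on $I$ if all $a_j\in C^{p-1,1}(I)$ and all complex roots of $P_a(t)$ are real for every $t\in I$. A \emph{continuous root} of $P_a$ is a continuous $\lambda:I\to\mathbb R$ with $P_a(t)(\lambda(t))=0$ for all $t\in I$. The \emph{Tschirnhausen form} of $P_a$ is $P_{\tilde a}(t)(Z)=P_a(t)\big(Z-\tfrac{a_1(t)}n\big)=Z^n+\sum_{j=2}^n\tilde a_j(t)Z^{n-j}$; its continuous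 roots are the functions $\lambda+\frac{a_1}{n}$ with $\lambda$ a continuous root of $P_a$. Below $I_0=(c_0,d_0)$, $I_1=(c_1,d_1)$ are bounded open intervals with $c_1<c_0<d_0<d_1$ and $\overline I_1=[c_1,d_1]\subset I$, and $\delta=\min(c_0-c_1,\,d_1-d_0)$. Expressions $C(\dots)$ and $\tilde C(\dots)$ are finite constants depending only on the listed data (in particular not on $I$, the polynomials or the roots); they may differ at each occurrence, but within one chain of inequalities the same factor denotes the same constant. \textbf{Theorem 1 (Bronshtein's theorem).} (i) Let $P_a$ be a $C^{p-1,1}$-curve of hyperbolic polynomials of degree $n$ on $I$ all of whose roots have multiplicity at most $p$ for every $t\in I$ (for instance, $p$ the maximal multiplicity of the roots). Then every continuous root of $P_a$ is locally Lipschitz on $I$. (ii) If $p=n\ge 1$, then for every continuous root $\lambda$ of $P_a$ $$\operatorname{Lip}_{I_0}(\lambda)\le C(n,I_0,I_1)\max_{1\le i\le n}\|a_i\|^{1/i}_{C^{n-1,1}(\overline I_1)}\le \tilde C(n,I_0,I_1)\Big(1+\max_{1\le i\le n}\|a_i\|_{C^{n-1,1}(\overline I_1)}\Big).$$ (iii)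 More precisely, if $p=n\ge 2$, then for every continuous root $\mu$ of the Tschirnhausen form $P_{\tilde a}$, with $M_i=\operatorname{Lip}_{I_1}(\tilde a_i^{(n-1)})$, $$\begin{aligned}\operatorname{Lip}_{I_0}(\mu)&\le C(n)\max\Big\{\delta^{-1}\|\tilde a_2\|_{L^\infty(I_1)}^{1/2},\ (\operatorname{Lip}_{I_1}(\tilde a_2'))^{1/2},\ \max_{2\le i\le n}\big(M_i\|\tilde a_2\|_{L^\infty(I_1)}^{(n-i)/2}\big)^{1/n}\Big\}\\&\le C(n,I_0,I_1)\max_{2\le i\le n}\|\tilde a_i\|^{1/i}_{C^{n-1,1}(\overline I_1)}\le \tilde C(n,I_0,I_1)\Big(1+\max_{2\le i\le n}\|\tilde a_i\|_{C^{n-1,1}(\overline I_1)}\Big).\end{aligned}$$ (iv) Let $2\le p<n$ and let all roots of $P_a(t)$ have multiplicity at most $p$ for every $t\in I$. Let $\lambda_1(t)\le\dots\le\lambda_n(t)$ be the increasingly ordered roots of $P_{\tilde a}(t)$ and put $$\alpha(t)=\frac{|\lambda_n(t)-\lambda_1(t)|}{\min_{1\le i\le n-p}|\lambda_{i+p}(t)-\lambda_i(t)|},\quad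 \alpha_{I_1}=\sup_{t\in I_1}\alpha(t),\quad m_2=\min_{t\in\overline I_0}|\tilde a_2(t)|,\quad M_i=\operatorname{Lip}_{I_1}(\tilde a_i^{(p-1)}).$$ Then for every continuous root $\mu$ of $P_{\tilde a}$ $$\begin{aligned}\operatorname{Lip}_{I_0}(\mu)&\le C(n)\,\alpha_{I_1}^{\frac{n-p}p}\max\Big\{\delta^{-1}\|\tilde a_2\|_{L^\infty(I_1)}^{1/2},\ (\operatorname{Lip}_{I_1}(\tilde a_2'))^{1/2},\ \max_{2\le i\le p}\big(M_i\|\tilde a_2\|_{L^\infty(I_1)}^{(p-i)/2}\big)^{1/p},\ \max_{p<i\le n}\big(M_i\,m_2^{(p-i)/2}\big)^{1/p}\Big\}\\&\le C(n,I_0,I_1)\,\alpha_{I_1}^{\frac{n-p}p}\Big(1+m_2^{\frac{p-n}{2p}}\Big)\Big(1+\max_{2\le i\le n}\|\tilde a_i\|_{C^{p-1,1}(\overline I_1)}\Big).\end{aligned}$$ -/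

import Mathlib

open Set Polynomial
open scoped NNReal ENNReal

namespace Bronshtein

noncomputable section

/-- The monic polynomial `Z ^ n + a₁(t) Z ^ (n - 1) + ⋯ + aₙ(t)`; only the values `a 1, …, a n` of
the family `a` are used. -/
def poly (n : ℕ) (a : ℕ → ℝ → ℝ) (t : ℝ) : ℝ[X] :=
  X ^ n + ∑ j ∈ Finset.Icc 1 n, C (a j t) * X ^ (n - j)

/-- All complex roots of the real polynomial `P` are real. -/
def Hyperbolic (P : ℝ[X]) : Prop :=
  ∀ z : ℂ, aeval z P = 0 → z.im = 0

/-- The class `C^{p-1,1}(I)` for an open set `I ⊆ ℝ` and `p ≥ 1`: functions of class `C^{p-1}` whose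
derivative of order `p - 1` is locally Lipschitz. -/
def IsCLip (p : ℕ) (f : ℝ → ℝ) (I : Set ℝ) : Prop :=
  ContDiffOn ℝ ((p - 1 : ℕ) : WithTop ℕ∞) f I ∧ LocallyLipschitzOn I (iteratedDeriv (p - 1) f)

/-- `P_a(t)`, `t ∈ I`, is a `C^{p-1,1}`-curve of hyperbolic polynomials of degree `n`. -/
structure IsHyperbolicCurve (p n : ℕ) (a : ℕ → ℝ → ℝ) (I : Set ℝ) : Prop where
  isCLip : ∀ j ∈ Finset.Icc 1 n, IsCLip p (a j) I
  hyperbolic : ∀ t ∈ I, Hyperbolic (poly n a t)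

/-- `r` is a continuous root of `P_a(t)`, `t ∈ I`. -/
structure IsContinuousRoot (n : ℕ) (a : ℕ → ℝ → ℝ) (I : Set ℝ) (r : ℝ → ℝ) : Prop where
  continuousOn : ContinuousOn r I
  isRoot : ∀ t ∈ I, (poly n a t).IsRoot (r t)

/-- `Lip_K(f)`, as a number in `[0, ∞]`. -/
def lipConst (f : ℝ → ℝ) (K : Set ℝ) : ℝ≥0∞ :=
  ⨆ (x ∈ K) (y ∈ K) (_ : x ≠ y), ENNReal.ofReal (|f x - f y| / |x - y|)

/-- `sup_K |f|`, as a number in `[0, ∞]`; for continuous `f` and open `K` it is the norm of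
`L^∞(K)`. -/
def supNorm (f : ℝ → ℝ) (K : Set ℝ) : ℝ≥0∞ :=
  ⨆ x ∈ K, ENNReal.ofReal |f x|

/-- The norm of `C^{p-1,1}(K)`, for `p ≥ 1` and `K` inside the open domain of `f`. -/
def cLipNorm (p : ℕ) (f : ℝ → ℝ) (K : Set ℝ) : ℝ≥0∞ :=
  (⨆ k ∈ Finset.range p, supNorm (iteratedDeriv k f) K) + lipConst (iteratedDeriv (p - 1) f) K

/-- The coefficients `ã_j` of the Tschirnhausen transform `P_ã(Z) = P_a(Z - a₁ / n)`. -/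
def tschirnhausen (n : ℕ) (a : ℕ → ℝ → ℝ) (j : ℕ) (t : ℝ) : ℝ :=
  ((poly n a t).comp (X - C (a 1 t / n))).coeff (n - j)

/-- The `j`-th root, `1 ≤ j ≤ n`, of `P` in increasing order, counted with multiplicity. -/
def sortedRoot (P : ℝ[X]) (j : ℕ) : ℝ :=
  (P.roots.sort (· ≤ ·)).getD (j - 1) 0

/-- `α(t) = |λₙ - λ₁| / min_{1 ≤ i ≤ n - p} |λ_{i+p} - λ_i|` for the increasingly ordered roots of
the polynomial `P` of degree `n`. -/
def gapRatio (n p : ℕ) (P : ℝ[X]) : ℝ≥0∞ :=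
  ENNReal.ofReal |sortedRoot P n - sortedRoot P 1| /
    ⨅ i ∈ Finset.Icc 1 (n - p), ENNReal.ofReal |sortedRoot P (i + p) - sortedRoot P i|

/-- `α_J = sup_{t ∈ J} α(t)`. -/
def gapRatioSup (n p : ℕ) (a : ℕ → ℝ → ℝ) (J : Set ℝ) : ℝ≥0∞ :=
  ⨆ t ∈ J, gapRatio n p (poly n a t)

/-- `m₂ = min_K |a₂|`. -/
def minSecond (a : ℕ → ℝ → ℝ) (K : Set ℝ) : ℝ≥0∞ :=
  ⨅ t ∈ K, ENNReal.ofReal |a 2 t|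

/-- The maximum of `δ⁻¹ ‖a₂‖^{1/2}` and `Lip(a₂')^{1/2}`, where `δ` is the distance between the
endpoints of `I₀ = (c₀, d₀)` and those of `I₁ = (c₁, d₁)`, and norms are taken over `I₁`. -/
def boundLow (a : ℕ → ℝ → ℝ) (c₁ c₀ d₀ d₁ : ℝ) : ℝ≥0∞ :=
  max ((ENNReal.ofReal (min (c₀ - c₁) (d₁ - d₀)))⁻¹ * supNorm (a 2) (Ioo c₁ d₁) ^ (1 / 2 : ℝ))
    (lipConst (deriv (a 2)) (Ioo c₁ d₁) ^ (1 / 2 : ℝ))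

/-- `max_{2 ≤ i ≤ p} (M_i ‖a₂‖^{(p - i) / 2})^{1/p}` with `M_i = Lip(a_i^{(p-1)})`, over `J`. -/
def boundMid (p : ℕ) (a : ℕ → ℝ → ℝ) (J : Set ℝ) : ℝ≥0∞ :=
  ⨆ i ∈ Finset.Icc 2 p,
    (lipConst (iteratedDeriv (p - 1) (a i)) J * supNorm (a 2) J ^ (((p : ℝ) - i) / 2)) ^
      (1 / (p : ℝ))

/-- `max_{p < i ≤ n} (M_i m₂^{(p - i) / 2})^{1/p}` with `M_i = Lip_J(a_i^{(p-1)})` and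
`m₂ = min_K |a₂|`. -/
def boundHigh (n p : ℕ) (a : ℕ → ℝ → ℝ) (J K : Set ℝ) : ℝ≥0∞ :=
  ⨆ i ∈ Finset.Ioc p n,
    (lipConst (iteratedDeriv (p - 1) (a i)) J * minSecond a K ^ (((p : ℝ) - i) / 2)) ^
      (1 / (p : ℝ))

end

end Bronshtein

/-! A function whose difference quotients at each point of an interval are eventually at most `L` is
`L`-Lipschitz there (`abs_sub_le_of_vel`), so everything reduces to bounding the speed of a root at
one time. `HasVelocityBound` states such a bound on `(-1, 1)`, uniformly over all curves with
controlled coefficients, and `hasVelocityBound` proves it by strong induction on the degree `n`.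

After the Tschirnhausen transform the roots sum to zero and their squares sum to `-2ã₂`; so `ã₂ ≤
0`, and `ã₂` controls all roots and hence all coefficients. If `ã₂` vanishes at the given time, it
has a maximum there, so it is quadratically small and the roots move at bounded speed
(`vel_of_coeff_eq_zero`). Otherwise `ã₂ = -h²` with `h > 0`. Divide the roots by `h` and use a time
unit `ρ` so short that the Lipschitz constants of the top derivatives become bounded. Now `-ã₂` is
nonnegative, equals `1` at the centre and has Lipschitz derivative, so it is bounded on `(-1, 1)`;
so are the other coefficients, and interpolation bounds their intermediate derivatives
(`velocity_of_cLip`).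

The roots of a normalized polynomial cannot all coincide. Multiplication of coprime monic
polynomials is a local diffeomorphism, and normalized root vectors form a compact set; hence on an
interval of uniform length the chosen root is carried by a factor of smaller degree with uniformly
bounded coefficients (`exists_factor_of_normalized`). The induction hypothesis applies to that
factor.

Write `p = k + 1`. For `n ≤ p` the choice `ρ ~ h` suffices. For `n > p` one needs `ρ ~ h^(n/p)`, and
scaling back costs `h^(-(n-p)/p)`. This is what `Spread` pays for: if no interval of radius `η`
contains more than `p` roots then `η ≲ h`, and rescaling turns `η` into about `η/h`, so a bound
proportional to `η^(-(n-p)/p)` reproduces itself exactly.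

For the precise estimates the rescaling is done once more with `ρ = h/M`, where `M` is the bound to
be proved (`exists_vel_scaled`); for `p < n` the gap ratio `α` supplies `η = 1/(4nα)`
(`spread_of_gaps`). For local Lipschitz continuity one splits off the factor belonging to a single
multiple root, whose degree is at most `p`, so that no spread condition is needed
(`locallyLipschitzOn_root`). -/

namespace Bronshtein

/-! ### Quantitative `C^{k,1}` classes: products, compositions, rescaling. -/

section Classes

variable {E F G : Type} [NormedAddCommGroup E] [NormedSpace ℝ E]
  [NormedAddCommGroup F] [NormedSpace ℝ F] [NormedAddCommGroup G] [NormedSpace ℝ G]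

/-- On `J`, the function `f` is `k` times differentiable and its `k`-th derivative is Lipschitz with
constant `L`. -/
def CLip : ℕ → ℝ → (ℝ → F) → Set ℝ → Prop
  | 0, L, f, J => ∀ x ∈ J, ∀ y ∈ J, ‖f x - f y‖ ≤ L * |x - y|
  | k + 1, L, f, J => (∀ x ∈ J, DifferentiableAt ℝ f x) ∧ CLip k L (deriv f) J

/-- As `CLip`, with in addition the derivatives of order at most `k` bounded by `B`. -/
def CBdd : ℕ → ℝ → (ℝ → F) → Set ℝ → Prop
  | 0, B, f, J => (∀ x ∈ J, ‖f x‖ ≤ B) ∧ ∀ x ∈ J, ∀ y ∈ J, ‖f x - f y‖ ≤ B * |x - y|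
  | k + 1, B, f, J =>
    (∀ x ∈ J, ‖f x‖ ≤ B) ∧ (∀ x ∈ J, DifferentiableAt ℝ f x) ∧ CBdd k B (deriv f) J

theorem CBdd.bound {k : ℕ} {B : ℝ} {f : ℝ → F} {J : Set ℝ} (h : CBdd k B f J) :
    ∀ x ∈ J, ‖f x‖ ≤ B := by
  cases k <;> exact h.1

theorem CLip.mono_const {k : ℕ} {B B' : ℝ} (hB : B ≤ B') {f : ℝ → F} {J : Set ℝ}
    (h : CLip k B f J) : CLip k B' f J := by
  induction k generalizing f with
  | zero => exact fun x hx y hy => (h x hx y hy).trans (by gcongr)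
  | succ k ih => exact ⟨h.1, ih h.2⟩

theorem CBdd.mono_const {k : ℕ} {B B' : ℝ} (hB : B ≤ B') {f : ℝ → F} {J : Set ℝ}
    (h : CBdd k B f J) : CBdd k B' f J := by
  induction k generalizing f with
  | zero =>
    exact ⟨fun x hx => (h.1 x hx).trans hB, fun x hx y hy => (h.2 x hx y hy).trans (by gcongr)⟩
  | succ k ih => exact ⟨fun x hx => (h.1 x hx).trans hB, h.2.1, ih h.2.2⟩

theorem CBdd.mono_set {k : ℕ} {B : ℝ} {f : ℝ → F} {J J' : Set ℝ} (hJ : J' ⊆ J)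
    (h : CBdd k B f J) : CBdd k B f J' := by
  induction k generalizing f with
  | zero => exact ⟨fun x hx => h.1 x (hJ hx), fun x hx y hy => h.2 x (hJ hx) y (hJ hy)⟩
  | succ k ih => exact ⟨fun x hx => h.1 x (hJ hx), fun x hx => h.2.1 x (hJ hx), ih h.2.2⟩

theorem CBdd.cLip {k : ℕ} {B : ℝ} {f : ℝ → F} {J : Set ℝ} (h : CBdd k B f J) :
    CLip k B f J := by
  induction k generalizing f with
  | zero => exact h.2
  | succ k ih => exact ⟨h.2.1, ih h.2.2⟩

theorem norm_sub_le_of_deriv_le {B : ℝ} {f : ℝ → F} {J : Set ℝ} (hJ : Convex ℝ J)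
    (hd : ∀ x ∈ J, DifferentiableAt ℝ f x) (hB : ∀ x ∈ J, ‖deriv f x‖ ≤ B) :
    ∀ x ∈ J, ∀ y ∈ J, ‖f x - f y‖ ≤ B * |x - y| := fun _ hx _ hy =>
  hJ.norm_image_sub_le_of_norm_deriv_le hd hB hy hx

theorem CBdd.lip {k : ℕ} {B : ℝ} {f : ℝ → F} {J : Set ℝ} (hJ : Convex ℝ J) (h : CBdd k B f J) :
    ∀ x ∈ J, ∀ y ∈ J, ‖f x - f y‖ ≤ B * |x - y| := by
  cases k with
  | zero => exact h.2
  | succ k => exact norm_sub_le_of_deriv_le hJ h.2.1 h.2.2.bound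

/-- On a convex set a bound for the derivative is also a Lipschitz constant, so the same `B` serves
at every lower order. -/
theorem CBdd.pred {k : ℕ} {B : ℝ} {f : ℝ → F} {J : Set ℝ} (hJ : Convex ℝ J)
    (h : CBdd (k + 1) B f J) : CBdd k B f J := by
  induction k generalizing f with
  | zero => exact ⟨h.bound, h.lip hJ⟩
  | succ k ih => exact ⟨h.1, h.2.1, ih h.2.2⟩

theorem CBdd.of_le {k l : ℕ} (hkl : l ≤ k) {B : ℝ} {f : ℝ → F} {J : Set ℝ} (hJ : Convex ℝ J)
    (h : CBdd k B f J) : CBdd l B f J := by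
  induction k, hkl using Nat.le_induction with
  | base => exact h
  | succ k _ ih => exact ih (h.pred hJ)

theorem continuousOn_of_norm_sub_le {B : ℝ} {f : ℝ → F} {J : Set ℝ}
    (h : ∀ x ∈ J, ∀ y ∈ J, ‖f x - f y‖ ≤ B * |x - y|) : ContinuousOn f J := by
  have : LipschitzOnWith B.toNNReal f J := by
    refine LipschitzOnWith.of_dist_le_mul fun x hx y hy => ?_
    rw [dist_eq_norm, Real.dist_eq]
    refine (h x hx y hy).trans ?_
    gcongr
    exact Real.le_coe_toNNReal B
  exact this.continuousOn

theorem CBdd.continuousOn {k : ℕ} {B : ℝ} {f : ℝ → F} {J : Set ℝ} (hJ : Convex ℝ J)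
    (h : CBdd k B f J) : ContinuousOn f J :=
  continuousOn_of_norm_sub_le (h.lip hJ)

theorem deriv_eqOn {f g : ℝ → F} {J : Set ℝ} (hJ : IsOpen J) (h : EqOn f g J) :
    EqOn (deriv f) (deriv g) J := fun _ hx =>
  (h.eventuallyEq_of_mem (hJ.mem_nhds hx)).deriv_eq

theorem CLip.congr {k : ℕ} {B : ℝ} {f g : ℝ → F} {J : Set ℝ} (hJ : IsOpen J) (h : CLip k B f J)
    (hfg : EqOn f g J) : CLip k B g J := by
  induction k generalizing f g with
  | zero => exact fun x hx y hy => by rw [← hfg hx, ← hfg hy]; exact h x hx y hy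
  | succ k ih =>
    exact ⟨fun x hx => (h.1 x hx).congr_of_eventuallyEq
      (hfg.eventuallyEq_of_mem (hJ.mem_nhds hx)).symm, ih h.2 (deriv_eqOn hJ hfg)⟩

theorem CBdd.congr {k : ℕ} {B : ℝ} {f g : ℝ → F} {J : Set ℝ} (hJ : IsOpen J) (h : CBdd k B f J)
    (hfg : EqOn f g J) : CBdd k B g J := by
  induction k generalizing f g with
  | zero =>
    exact ⟨fun x hx => hfg hx ▸ h.1 x hx,
      fun x hx y hy => by rw [← hfg hx, ← hfg hy]; exact h.2 x hx y hy⟩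
  | succ k ih =>
    exact ⟨fun x hx => hfg hx ▸ h.1 x hx, fun x hx => (h.2.1 x hx).congr_of_eventuallyEq
      (hfg.eventuallyEq_of_mem (hJ.mem_nhds hx)).symm, ih h.2.2 (deriv_eqOn hJ hfg)⟩

theorem CBdd.const {k : ℕ} {B : ℝ} {c : F} (hc : ‖c‖ ≤ B) {J : Set ℝ} :
    CBdd k B (fun _ : ℝ => c) J := by
  have hB : 0 ≤ B := (norm_nonneg _).trans hc
  have h0 : ∀ k, CBdd k B (fun _ : ℝ => (0 : F)) J := by
    intro k
    induction k with
    | zero => exact ⟨by simpa using fun _ _ => hB, fun x _ y _ => by simpa using by positivity⟩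
    | succ k ih =>
      refine ⟨by simpa using fun _ _ => hB, by simp, ?_⟩
      simpa using ih
  cases k with
  | zero => exact ⟨fun _ _ => hc, fun x _ y _ => by simpa using by positivity⟩
  | succ k => exact ⟨fun _ _ => hc, by simp, by simpa using h0 k⟩

theorem CBdd.add {k : ℕ} {A B : ℝ} {f g : ℝ → F} {J : Set ℝ} (hJ : IsOpen J)
    (hf : CBdd k A f J) (hg : CBdd k B g J) : CBdd k (A + B) (fun t => f t + g t) J := by
  induction k generalizing f g with
  | zero =>
    refine ⟨fun x hx => (norm_add_le _ _).trans (add_le_add (hf.1 x hx) (hg.1 x hx)),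
      fun x hx y hy => ?_⟩
    rw [add_sub_add_comm, add_mul]
    exact (norm_add_le _ _).trans (add_le_add (hf.2 x hx y hy) (hg.2 x hx y hy))
  | succ k ih =>
    refine ⟨fun x hx => (norm_add_le _ _).trans (add_le_add (hf.1 x hx) (hg.1 x hx)),
      fun x hx => (hf.2.1 x hx).add (hg.2.1 x hx), ?_⟩
    refine (ih hf.2.2 hg.2.2).congr hJ fun x hx => ?_
    exact (deriv_add (hf.2.1 x hx) (hg.2.1 x hx)).symm

theorem CBdd.clm {k : ℕ} {B : ℝ} {f : ℝ → E} {J : Set ℝ} (hJ : IsOpen J)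
    (hf : CBdd k B f J) (L : E →L[ℝ] F) : CBdd k (‖L‖ * B) (fun t => L (f t)) J := by
  induction k generalizing f with
  | zero =>
    refine ⟨fun x hx => (L.le_opNorm _).trans (by gcongr; exact hf.1 x hx), fun x hx y hy => ?_⟩
    rw [← map_sub, mul_assoc]
    exact (L.le_opNorm _).trans (by gcongr; exact hf.2 x hx y hy)
  | succ k ih =>
    refine ⟨fun x hx => (L.le_opNorm _).trans (by gcongr; exact hf.1 x hx),
      fun x hx => L.differentiableAt.comp x (hf.2.1 x hx), ?_⟩
    refine (ih hf.2.2).congr hJ fun x hx => ?_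
    exact ((L.hasFDerivAt.comp_hasDerivAt x (hf.2.1 x hx).hasDerivAt).deriv).symm

/-- Leibniz rule: each derivative turns one product into two, whence a factor `2` per order. -/
theorem CBdd.bilin {k : ℕ} {A B : ℝ} {f : ℝ → E} {g : ℝ → F} {J : Set ℝ} (hJ : IsOpen J)
    (hc : Convex ℝ J) (hA : 0 ≤ A) (hB : 0 ≤ B) (L : E →L[ℝ] F →L[ℝ] G) (hL : ‖L‖ ≤ 1)
    (hf : CBdd k A f J) (hg : CBdd k B g J) :
    CBdd k (2 ^ (k + 1) * A * B) (fun t => L (f t) (g t)) J := by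
  have hL' : ∀ u v, ‖L u v‖ ≤ ‖u‖ * ‖v‖ := fun u v =>
    (L.le_opNorm₂ u v).trans (by
      rw [mul_assoc]; exact mul_le_of_le_one_left (by positivity) hL)
  have hbd : ∀ k, CBdd k A f J → CBdd k B g J →
      ∀ x ∈ J, ‖L (f x) (g x)‖ ≤ 2 ^ (k + 1) * A * B := fun k hf hg x hx => by
    refine (hL' _ _).trans ((mul_le_mul (hf.bound x hx) (hg.bound x hx) (norm_nonneg _) hA).trans ?_)
    rw [mul_assoc]
    exact le_mul_of_one_le_left (by positivity) (one_le_pow₀ (by norm_num))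
  induction k generalizing f g with
  | zero =>
    refine ⟨hbd 0 hf hg, fun x hx y hy => ?_⟩
    have : L (f x) (g x) - L (f y) (g y) = L (f x) (g x - g y) + L (f x - f y) (g y) := by
      simp
    rw [this]
    refine (norm_add_le _ _).trans ?_
    have h1 := (hL' (f x) (g x - g y)).trans
      (mul_le_mul (hf.bound x hx) (hg.2 x hx y hy) (norm_nonneg _) hA)
    have h2 := (hL' (f x - f y) (g y)).trans
      (mul_le_mul (hf.2 x hx y hy) (hg.bound y hy) (norm_nonneg _) (by positivity))
    have e : 2 ^ (0 + 1) * A * B * |x - y| = A * (B * |x - y|) + A * |x - y| * B := by ring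
    rw [e]
    exact add_le_add h1 h2
  | succ k ih =>
    have hd : ∀ x ∈ J, HasDerivAt (fun t => L (f t) (g t))
        (L (f x) (deriv g x) + L (deriv f x) (g x)) x := fun x hx =>
      L.hasDerivAt_of_bilinear (fun _ => (hf.2.1 x hx).hasDerivAt) (fun _ => (hg.2.1 x hx).hasDerivAt)
    refine ⟨hbd _ hf hg, fun x hx => (hd x hx).differentiableAt, ?_⟩
    have h1 := ih (hf.pred hc) hg.2.2 (hbd := fun k hf hg x hx => by
      refine (hL' _ _).trans ((mul_le_mul (hf.bound x hx) (hg.bound x hx) (norm_nonneg _) hA).trans ?_)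
      rw [mul_assoc]
      exact le_mul_of_one_le_left (by positivity) (one_le_pow₀ (by norm_num)))
    have h2 := ih hf.2.2 (hg.pred hc) (hbd := fun k hf hg x hx => by
      refine (hL' _ _).trans ((mul_le_mul (hf.bound x hx) (hg.bound x hx) (norm_nonneg _) hA).trans ?_)
      rw [mul_assoc]
      exact le_mul_of_one_le_left (by positivity) (one_le_pow₀ (by norm_num)))
    refine ((h1.add hJ h2).congr hJ fun x hx => ((hd x hx).deriv).symm).mono_const (le_of_eq ?_)
    ring

/-- Chain rule by induction on `k`: the derivative pairs `fderiv ℝ Ψ ∘ f` with `f'`, so the target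
space varies in the induction. The point is that `B'` is chosen before `J` and `f`. Convexity of `K`
serves the mean value inequality for `Ψ` in the base case. -/
theorem CBdd.comp_smooth [ProperSpace E] {k : ℕ} {B : ℝ} (hB : 0 ≤ B) {Ψ : E → F} {V K : Set E}
    (hV : IsOpen V) (hΨ : ContDiffOn ℝ (k + 1 : ℕ) Ψ V) (hK : IsCompact K) (hKc : Convex ℝ K)
    (hKV : K ⊆ V) :
    ∃ B' : ℝ, 0 ≤ B' ∧ ∀ (J : Set ℝ) (f : ℝ → E), IsOpen J → Convex ℝ J → CBdd k B f J →
      MapsTo f J K → CBdd k B' (fun t => Ψ (f t)) J := by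
  induction k generalizing F with
  | zero =>
    obtain ⟨C, hC⟩ := (hK.image_of_continuousOn (hΨ.continuousOn.mono hKV)).isBounded.exists_norm_le
    have hcd : ContinuousOn (fderiv ℝ Ψ) K :=
      (hΨ.continuousOn_fderiv_of_isOpen hV (by norm_num)).mono hKV
    obtain ⟨D, hD⟩ := (hK.image_of_continuousOn hcd).isBounded.exists_norm_le
    refine ⟨max 0 C + max 0 D * B, by positivity, fun J f hJ hc hf hm => ⟨fun x hx => ?_,
      fun x hx y hy => ?_⟩⟩
    · have := hC _ (mem_image_of_mem Ψ (hm hx))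
      have h0 : 0 ≤ max 0 D * B := by positivity
      linarith [le_max_right 0 C]
    · have h1 := hKc.norm_image_sub_le_of_norm_fderiv_le (𝕜 := ℝ) (f := Ψ) (C := max 0 D)
        (fun z hz => (hΨ.contDiffAt (hV.mem_nhds (hKV hz))).differentiableAt (by norm_num))
        (fun z hz => (hD _ (mem_image_of_mem _ hz)).trans (le_max_right _ _)) (hm hy) (hm hx)
      refine h1.trans ?_
      calc max 0 D * ‖f x - f y‖ ≤ max 0 D * (B * |x - y|) := by gcongr; exact hf.2 x hx y hy
        _ ≤ (max 0 C + max 0 D * B) * |x - y| := by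
          rw [← mul_assoc, add_mul]
          have : 0 ≤ max 0 C * |x - y| := by positivity
          linarith
  | succ k ih =>
    obtain ⟨C, hC⟩ := (hK.image_of_continuousOn (hΨ.continuousOn.mono hKV)).isBounded.exists_norm_le
    have hfd : ContDiffOn ℝ (k + 1 : ℕ) (fderiv ℝ Ψ) V :=
      hΨ.fderiv_of_isOpen hV (by norm_cast)
    obtain ⟨D, hD0, hD⟩ := ih hfd
    refine ⟨max C (2 ^ (k + 1) * D * B), by positivity, fun J f hJ hc hf hm => ?_⟩
    have hd : ∀ x ∈ J, HasDerivAt (fun t => Ψ (f t)) (fderiv ℝ Ψ (f x) (deriv f x)) x :=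
      fun x hx => HasFDerivAt.comp_hasDerivAt (l := Ψ) x
        ((hΨ.contDiffAt (hV.mem_nhds (hKV (hm hx)))).differentiableAt (by norm_num)).hasFDerivAt
        (hf.2.1 x hx).hasDerivAt
    refine ⟨fun x hx => (hC _ (mem_image_of_mem Ψ (hm hx))).trans (le_max_left _ _),
      fun x hx => (hd x hx).differentiableAt, ?_⟩
    have h1 := (hD J f hJ hc (hf.pred hc) hm).bilin hJ hc hD0 hB (ContinuousLinearMap.id ℝ (E →L[ℝ] F))
      ContinuousLinearMap.norm_id_le hf.2.2
    exact (h1.congr hJ fun x hx => (hd x hx).deriv.symm).mono_const (le_max_right _ _)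

theorem CBdd.pi {ι : Type} [Fintype ι] {k : ℕ} {B : ℝ} (hB : 0 ≤ B) {f : ℝ → ι → ℝ} {J : Set ℝ}
    (hJ : IsOpen J) (h : ∀ i, CBdd k B (fun t => f t i) J) : CBdd k B f J := by
  induction k generalizing f with
  | zero =>
    refine ⟨fun x hx => (pi_norm_le_iff_of_nonneg hB).2 fun i => (h i).1 x hx,
      fun x hx y hy => (pi_norm_le_iff_of_nonneg (by positivity)).2 fun i => (h i).2 x hx y hy⟩
  | succ k ih =>
    have hd : ∀ x ∈ J, DifferentiableAt ℝ f x := fun x hx =>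
      differentiableAt_pi.2 fun i => (h i).2.1 x hx
    refine ⟨fun x hx => (pi_norm_le_iff_of_nonneg hB).2 fun i => (h i).1 x hx, hd, ih fun i => ?_⟩
    refine (h i).2.2.congr hJ fun x hx => ?_
    exact ((hasDerivAt_pi.1 (hd x hx).hasDerivAt) i).deriv

/-- The gain `|ρ| ^ (k + 1)` is what makes a short time unit tame the top derivative. -/
theorem CLip.affine {k : ℕ} {L : ℝ} {f : ℝ → ℝ} {J J' : Set ℝ} (c ρ t₀ : ℝ)
    (hJ : IsOpen J') (hm : MapsTo (fun s => t₀ + ρ * s) J' J) (h : CLip k L f J) :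
    CLip k (|c| * |ρ| ^ (k + 1) * L) (fun s => c * f (t₀ + ρ * s)) J' := by
  induction k generalizing f c with
  | zero =>
    intro x hx y hy
    have := h _ (hm hx) _ (hm hy)
    rw [← mul_sub, norm_mul, Real.norm_eq_abs c]
    have h2 : t₀ + ρ * x - (t₀ + ρ * y) = ρ * (x - y) := by ring
    simp only [h2, abs_mul] at this
    calc |c| * ‖f (t₀ + ρ * x) - f (t₀ + ρ * y)‖ ≤ |c| * (L * (|ρ| * |x - y|)) := by gcongr
      _ = _ := by ring
  | succ k ih =>
    have hd : ∀ x ∈ J', HasDerivAt (fun s => c * f (t₀ + ρ * s))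
        ((c * ρ) * deriv f (t₀ + ρ * x)) x := fun x hx => by
      have h1 : HasDerivAt (fun s => t₀ + ρ * s) ρ x := by
        simpa using ((hasDerivAt_id x).const_mul ρ).const_add t₀
      exact (((h.1 _ (hm hx)).hasDerivAt.comp x h1).const_mul c).congr_deriv (by ring)
    refine ⟨fun x hx => (hd x hx).differentiableAt, ?_⟩
    have := (ih (c * ρ) h.2).congr hJ fun x hx => (hd x hx).deriv.symm
    convert this using 1
    rw [abs_mul]
    ring

theorem CBdd.affine {k : ℕ} {B : ℝ} {f : ℝ → ℝ} {J J' : Set ℝ} (c ρ t₀ : ℝ) (hρ : |ρ| ≤ 1)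
    (hB : 0 ≤ B)
    (hJ : IsOpen J') (hm : MapsTo (fun s => t₀ + ρ * s) J' J) (h : CBdd k B f J) :
    CBdd k (|c| * B) (fun s => c * f (t₀ + ρ * s)) J' := by
  induction k generalizing f c with
  | zero =>
    refine ⟨fun x hx => ?_, fun x hx y hy => ?_⟩
    · rw [norm_mul, Real.norm_eq_abs c]
      gcongr
      exact h.1 _ (hm hx)
    have := h.2 _ (hm hx) _ (hm hy)
    rw [← mul_sub, norm_mul, Real.norm_eq_abs c]
    have h2 : t₀ + ρ * x - (t₀ + ρ * y) = ρ * (x - y) := by ring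
    simp only [h2, abs_mul] at this
    calc |c| * ‖f (t₀ + ρ * x) - f (t₀ + ρ * y)‖ ≤ |c| * (B * (|ρ| * |x - y|)) := by gcongr
      _ ≤ |c| * (B * (1 * |x - y|)) := by gcongr
      _ = _ := by ring
  | succ k ih =>
    have hd : ∀ x ∈ J', HasDerivAt (fun s => c * f (t₀ + ρ * s))
        ((c * ρ) * deriv f (t₀ + ρ * x)) x := fun x hx => by
      have h1 : HasDerivAt (fun s => t₀ + ρ * s) ρ x := by
        simpa using ((hasDerivAt_id x).const_mul ρ).const_add t₀
      exact (((h.2.1 _ (hm hx)).hasDerivAt.comp x h1).const_mul c).congr_deriv (by ring)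
    refine ⟨fun x hx => ?_, fun x hx => (hd x hx).differentiableAt, ?_⟩
    · rw [norm_mul, Real.norm_eq_abs c]
      gcongr
      exact h.1 _ (hm hx)
    refine ((ih (c * ρ) h.2.2).congr hJ fun x hx => (hd x hx).deriv.symm).mono_const ?_
    rw [abs_mul]
    exact mul_le_mul_of_nonneg_right (mul_le_of_le_one_right (abs_nonneg _) hρ) hB

end Classes

/-! ### Interpolation of intermediate derivatives on an interval. -/

section Interpolation

theorem CLip.pred_of_differentiable {k : ℕ} {L : ℝ} {f : ℝ → ℝ} {J : Set ℝ}
    (h : CLip k L f J) (hk : k ≠ 0) : ∀ x ∈ J, DifferentiableAt ℝ f x := by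
  cases k with
  | zero => exact absurd rfl hk
  | succ k => exact h.1

theorem CLip.differentiableAt_iteratedDeriv {k j : ℕ} {L : ℝ} {f : ℝ → ℝ} {J : Set ℝ}
    (h : CLip k L f J) (hj : j < k) : ∀ x ∈ J, DifferentiableAt ℝ (iteratedDeriv j f) x := by
  induction k generalizing f j with
  | zero => omega
  | succ k ih =>
    cases j with
    | zero => simpa using h.1
    | succ j => rw [iteratedDeriv_succ']; exact ih h.2 (by omega)

/-- Take points where the `j`-th derivative is small in the two outer thirds; they are at least a
third of the length apart, and the mean value theorem between them gives the point for order `j +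
1`. -/
theorem exists_iteratedDeriv_le (j : ℕ) : ∃ C : ℝ, 0 ≤ C ∧ ∀ (a b K : ℝ) (f : ℝ → ℝ), a < b →
    (∀ i < j, ∀ x ∈ Ioo a b, DifferentiableAt ℝ (iteratedDeriv i f) x) →
    (∀ x ∈ Ioo a b, |f x| ≤ K) → ∃ ξ ∈ Ioo a b, |iteratedDeriv j f ξ| ≤ C * K / (b - a) ^ j := by
  induction j with
  | zero =>
    refine ⟨1, zero_le_one, fun a b K f hab _ hK => ⟨(a + b) / 2, ⟨by linarith, by linarith⟩, ?_⟩⟩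
    simpa using hK ((a + b) / 2) ⟨by linarith, by linarith⟩
  | succ j ih =>
    obtain ⟨C, hC, h⟩ := ih
    refine ⟨2 * C * 3 ^ (j + 1), by positivity, fun a b K f hab hd hK => ?_⟩
    set l := (b - a) / 3 with hl
    have hl0 : 0 < l := by rw [hl]; linarith
    obtain ⟨x, hx, hx'⟩ := h a (a + l) K f (by linarith)
      (fun i hi x hx => hd i (by omega) x ⟨hx.1, by linarith [hx.2]⟩)
      (fun x hx => hK x ⟨hx.1, by linarith [hx.2]⟩)
    obtain ⟨y, hy, hy'⟩ := h (b - l) b K f (by linarith)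
      (fun i hi x hx => hd i (by omega) x ⟨by linarith [hx.1], hx.2⟩)
      (fun x hx => hK x ⟨by linarith [hx.1], hx.2⟩)
    have hxy : l ≤ y - x := by linarith [hx.2, hy.1]
    have hsub : Icc x y ⊆ Ioo a b := fun z hz => ⟨hx.1.trans_le hz.1, hz.2.trans_lt hy.2⟩
    obtain ⟨ξ, hξ, hξ'⟩ := exists_deriv_eq_slope (iteratedDeriv j f) (by linarith : x < y)
      (fun z hz => (hd j (by omega) z (hsub hz)).continuousAt.continuousWithinAt)
      (fun z hz => (hd j (by omega) z (hsub (Ioo_subset_Icc_self hz))).differentiableWithinAt)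
    refine ⟨ξ, hsub (Ioo_subset_Icc_self hξ), ?_⟩
    rw [iteratedDeriv_succ, hξ', abs_div, abs_of_pos (by linarith : 0 < y - x)]
    have e1 : a + l - a = l := by ring
    have e2 : b - (b - l) = l := by ring
    rw [e1] at hx'
    rw [e2] at hy'
    have hba : b - a = 3 * l := by rw [hl]; ring
    have hnum : |iteratedDeriv j f y - iteratedDeriv j f x| ≤ 2 * (C * K / l ^ j) := by
      refine (abs_sub _ _).trans ?_
      linarith
    have h0 : 0 ≤ 2 * (C * K / l ^ j) := (abs_nonneg _).trans hnum
    calc _ ≤ 2 * (C * K / l ^ j) / l := div_le_div₀ h0 hnum hl0 hxy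
      _ = _ := by rw [hba, mul_pow]; field_simp; ring

/-- Integrate down from the top order: a function bounded at one point of an interval of length `2`
and with controlled slope is bounded everywhere. -/
theorem CLip.cBdd_of_points {k : ℕ} {L K : ℝ} (hL : 0 ≤ L) (hK : 0 ≤ K) :
    ∃ B : ℝ, 0 ≤ B ∧ ∀ f : ℝ → ℝ, CLip k L f (Ioo (-1) 1) →
      (∀ j ≤ k, ∃ ξ ∈ Ioo (-1 : ℝ) 1, |iteratedDeriv j f ξ| ≤ K) → CBdd k B f (Ioo (-1) 1) := by
  induction k with
  | zero =>
    refine ⟨K + 2 * L, by positivity, fun f hf h => ?_⟩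
    obtain ⟨ξ, hξ, hb⟩ := h 0 le_rfl
    rw [iteratedDeriv_zero] at hb
    refine ⟨fun x hx => ?_, (hf.mono_const (by linarith) : CLip 0 _ f _)⟩
    have h1 := hf x hx ξ hξ
    have h2 : |x - ξ| ≤ 2 := abs_le.2 ⟨by linarith [hx.1, hξ.2], by linarith [hx.2, hξ.1]⟩
    have h3 : ‖f x‖ ≤ ‖f x - f ξ‖ + ‖f ξ‖ := by simpa using norm_add_le (f x - f ξ) (f ξ)
    rw [Real.norm_eq_abs (f ξ)] at h3
    nlinarith
  | succ k ih =>
    obtain ⟨B, hB, h⟩ := ih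
    refine ⟨K + 2 * B, by positivity, fun f hf hp => ?_⟩
    have hd : CBdd k B (deriv f) (Ioo (-1) 1) := h _ hf.2 fun j hj => by
      have := hp (j + 1) (by omega)
      rwa [iteratedDeriv_succ'] at this
    obtain ⟨ξ, hξ, hb⟩ := hp 0 (by omega)
    rw [iteratedDeriv_zero] at hb
    refine ⟨fun x hx => ?_, hf.1, hd.mono_const (by linarith)⟩
    have h1 := norm_sub_le_of_deriv_le (convex_Ioo _ _) hf.1 hd.bound x hx ξ hξ
    have h2 : |x - ξ| ≤ 2 := abs_le.2 ⟨by linarith [hx.1, hξ.2], by linarith [hx.2, hξ.1]⟩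
    have h3 : ‖f x‖ ≤ ‖f x - f ξ‖ + ‖f ξ‖ := by simpa using norm_add_le (f x - f ξ) (f ξ)
    rw [Real.norm_eq_abs (f ξ)] at h3
    nlinarith

/-- A function with bounded values and Lipschitz derivative of order `k` has bounded derivatives of
all orders up to `k`. -/
theorem CLip.cBdd_of_bound (k : ℕ) {L K : ℝ} (hL : 0 ≤ L) (hK : 0 ≤ K) :
    ∃ B : ℝ, 0 ≤ B ∧ ∀ f : ℝ → ℝ, CLip k L f (Ioo (-1) 1) →
      (∀ x ∈ Ioo (-1 : ℝ) 1, |f x| ≤ K) → CBdd k B f (Ioo (-1) 1) := by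
  choose C hC hC' using exists_iteratedDeriv_le
  set D := ∑ j ∈ Finset.range (k + 1), C j * K with hD
  have hD0 : 0 ≤ D := Finset.sum_nonneg fun j _ => mul_nonneg (hC j) hK
  obtain ⟨B, hB, h⟩ := CLip.cBdd_of_points (k := k) hL hD0
  refine ⟨B, hB, fun f hf hb => h f hf fun j hj => ?_⟩
  obtain ⟨ξ, hξ, h1⟩ := hC' j (-1) 1 K f (by norm_num)
    (fun i hi => hf.differentiableAt_iteratedDeriv (by omega)) hb
  refine ⟨ξ, hξ, h1.trans ?_⟩
  have h2 : C j * K ≤ D := Finset.single_le_sum (f := fun j => C j * K)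
    (fun j _ => mul_nonneg (hC j) hK) (Finset.mem_range.2 (by omega))
  -- The interval has length `2 ≥ 1`, so dividing by a power of its length only helps.
  refine (div_le_self (mul_nonneg (hC j) hK) (one_le_pow₀ (by norm_num))).trans h2

end Interpolation

end Bronshtein

namespace Bronshtein

open Filter Topology

/-! ### Local factorization by the inverse function theorem. -/

section Factorization

/-- The polynomial of degree less than `m` with coefficients `x`. -/
noncomputable def lowPoly {m : ℕ} (x : Fin m → ℝ) : ℝ[X] := ∑ i : Fin m, C (x i) * X ^ (i : ℕ)

/-- The monic polynomial of degree `m` with lower coefficients `x`. -/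
noncomputable def monicPoly {m : ℕ} (x : Fin m → ℝ) : ℝ[X] := X ^ m + lowPoly x

theorem coeff_lowPoly {m : ℕ} (x : Fin m → ℝ) (i : ℕ) :
    (lowPoly x).coeff i = if h : i < m then x ⟨i, h⟩ else 0 := by
  simp only [lowPoly, finsetSum_coeff, coeff_C_mul, coeff_X_pow]
  split_ifs with h
  · rw [Finset.sum_eq_single ⟨i, h⟩]
    · simp
    · intro j _ hj
      rw [if_neg, mul_zero]
      intro h'
      exact hj (Fin.ext h'.symm)
    · simp
  · refine Finset.sum_eq_zero fun j _ => ?_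
    rw [if_neg, mul_zero]
    have := j.2
    omega

theorem degree_lowPoly_lt {m : ℕ} (x : Fin m → ℝ) : (lowPoly x).degree < m := by
  rw [degree_lt_iff_coeff_zero]
  intro i hi
  rw [coeff_lowPoly, dif_neg (by omega)]

theorem monic_monicPoly {m : ℕ} (x : Fin m → ℝ) : (monicPoly x).Monic :=
  monic_X_pow_add (degree_lowPoly_lt x)

theorem natDegree_monicPoly {m : ℕ} (x : Fin m → ℝ) : (monicPoly x).natDegree = m := by
  have : (monicPoly x).degree = m := by
    rw [monicPoly, degree_add_eq_left_of_degree_lt] <;> rw [degree_X_pow]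
    exact degree_lowPoly_lt x
  exact natDegree_eq_of_degree_eq_some this

theorem coeff_monicPoly {m : ℕ} (x : Fin m → ℝ) (i : ℕ) :
    (monicPoly x).coeff i = if h : i < m then x ⟨i, h⟩ else if i = m then 1 else 0 := by
  rw [monicPoly, coeff_add, coeff_lowPoly, coeff_X_pow]
  by_cases h : i < m
  · simp [h, h.ne]
  · simp [h]

theorem eq_monicPoly {m : ℕ} {p : ℝ[X]} (hp : p.Monic) (hd : p.natDegree = m) :
    p = monicPoly (fun i : Fin m => p.coeff i) := by
  ext i
  rw [coeff_monicPoly]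
  split_ifs with h h'
  · rfl
  · rw [h', ← hd]; exact hp
  · exact coeff_eq_zero_of_natDegree_lt (by omega)

theorem lowPoly_add {m : ℕ} (x y : Fin m → ℝ) : lowPoly (x + y) = lowPoly x + lowPoly y := by
  simp [lowPoly, add_mul, Finset.sum_add_distrib]

theorem lowPoly_smul {m : ℕ} (c : ℝ) (x : Fin m → ℝ) : lowPoly (c • x) = C c * lowPoly x := by
  simp [lowPoly, Finset.mul_sum, mul_assoc]

theorem lowPoly_eq_zero {m : ℕ} {x : Fin m → ℝ} (h : lowPoly x = 0) : x = 0 := by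
  ext i
  have := congrArg (fun p => p.coeff (i : ℕ)) h
  simpa [coeff_lowPoly] using this

/-- Multiplication of monic polynomials, in terms of their lower coefficients. -/
noncomputable def mulMap (m l : ℕ) (z : (Fin m → ℝ) × (Fin l → ℝ)) : Fin (m + l) → ℝ :=
  fun k => (monicPoly z.1 * monicPoly z.2).coeff k

theorem monicPoly_mulMap {m l : ℕ} (z : (Fin m → ℝ) × (Fin l → ℝ)) :
    monicPoly (mulMap m l z) = monicPoly z.1 * monicPoly z.2 := by
  refine (eq_monicPoly ((monic_monicPoly _).mul (monic_monicPoly _)) ?_).symm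
  rw [(monic_monicPoly _).natDegree_mul (monic_monicPoly _), natDegree_monicPoly,
    natDegree_monicPoly]

theorem contDiff_coeff_monicPoly {m : ℕ} (i : ℕ) {n : WithTop ℕ∞} :
    ContDiff ℝ n (fun x : Fin m → ℝ => (monicPoly x).coeff i) := by
  simp only [coeff_monicPoly]
  split_ifs with h
  · fun_prop
  · exact contDiff_const
  · exact contDiff_const

theorem contDiff_mulMap (m l : ℕ) {n : WithTop ℕ∞} : ContDiff ℝ n (mulMap m l) := by
  rw [contDiff_pi]
  intro k
  simp only [mulMap, coeff_mul]
  refine ContDiff.sum fun p _ => ContDiff.mul ?_ ?_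
  · exact (contDiff_coeff_monicPoly p.1).comp contDiff_fst
  · exact (contDiff_coeff_monicPoly p.2).comp contDiff_snd

/-- Along the line `z + s • w` the product is quadratic in `s`; the derivative is its linear
coefficient. -/
theorem fderiv_mulMap (m l : ℕ) (z w : (Fin m → ℝ) × (Fin l → ℝ)) (k : Fin (m + l)) :
    fderiv ℝ (mulMap m l) z w k =
      (lowPoly w.1 * monicPoly z.2 + monicPoly z.1 * lowPoly w.2).coeff k := by
  have h1 : HasDerivAt (fun s : ℝ => z + s • w) w 0 := by
    simpa using ((hasDerivAt_id (0 : ℝ)).smul_const w).const_add z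
  have h2 : HasFDerivAt (mulMap m l) (fderiv ℝ (mulMap m l) z) (z + (0 : ℝ) • w) := by
    rw [zero_smul, add_zero]
    exact ((contDiff_mulMap m l (n := 1)).differentiable (by norm_num) z).hasFDerivAt
  have h3 := (hasDerivAt_pi.1 (h2.comp_hasDerivAt (0 : ℝ) h1)) k
  have hm : ∀ {m : ℕ} (x y : Fin m → ℝ) (s : ℝ),
      monicPoly (x + s • y) = monicPoly x + C s * lowPoly y := fun x y s => by
    rw [monicPoly, lowPoly_add, lowPoly_smul, monicPoly, add_assoc]
  have h4 : ∀ s : ℝ, mulMap m l (z + s • w) k = (monicPoly z.1 * monicPoly z.2).coeff k +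
      s * (lowPoly w.1 * monicPoly z.2 + monicPoly z.1 * lowPoly w.2).coeff k +
      s ^ 2 * (lowPoly w.1 * lowPoly w.2).coeff k := fun s => by
    have : monicPoly (z + s • w).1 * monicPoly (z + s • w).2 = monicPoly z.1 * monicPoly z.2 +
        C s * (lowPoly w.1 * monicPoly z.2 + monicPoly z.1 * lowPoly w.2) +
        C (s ^ 2) * (lowPoly w.1 * lowPoly w.2) := by
      rw [Prod.fst_add, Prod.snd_add, Prod.smul_fst, Prod.smul_snd, hm, hm, C_pow]
      ring
    rw [mulMap, this, coeff_add, coeff_add, coeff_C_mul, coeff_C_mul]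
  have h5 : HasDerivAt (fun s : ℝ => mulMap m l (z + s • w) k)
      ((lowPoly w.1 * monicPoly z.2 + monicPoly z.1 * lowPoly w.2).coeff k) 0 := by
    simp only [h4]
    have := (((hasDerivAt_id (0 : ℝ)).mul_const
      ((lowPoly w.1 * monicPoly z.2 + monicPoly z.1 * lowPoly w.2).coeff k)).const_add
      ((monicPoly z.1 * monicPoly z.2).coeff k)).add
      (((hasDerivAt_id (0 : ℝ)).pow 2).mul_const ((lowPoly w.1 * lowPoly w.2).coeff k))
    exact this.congr_deriv (by simp)
  exact h3.unique h5

/-- If `u Q + P v = 0` with `P`, `Q` coprime then `P ∣ u`, and `deg u < deg P` forces `u = 0`, then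
`v = 0`. -/
theorem injective_fderiv_mulMap {m l : ℕ} {z : (Fin m → ℝ) × (Fin l → ℝ)}
    (hz : IsCoprime (monicPoly z.1) (monicPoly z.2)) :
    Function.Injective (fderiv ℝ (mulMap m l) z) := by
  rw [injective_iff_map_eq_zero]
  intro w hw
  have h0 : lowPoly w.1 * monicPoly z.2 + monicPoly z.1 * lowPoly w.2 = 0 := by
    ext i
    rw [coeff_zero]
    by_cases hi : i < m + l
    · have := congrFun hw ⟨i, hi⟩
      rwa [fderiv_mulMap] at this
    · refine coeff_eq_zero_of_degree_lt (lt_of_lt_of_le ?_ (Nat.cast_le.2 (not_lt.1 hi)))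
      refine lt_of_le_of_lt (degree_add_le _ _) (max_lt ?_ ?_)
      · rw [degree_mul, degree_eq_natDegree (monic_monicPoly z.2).ne_zero, natDegree_monicPoly,
          Nat.cast_add]
        exact WithBot.add_lt_add_right (WithBot.natCast_ne_bot l) (degree_lowPoly_lt _)
      · rw [degree_mul, degree_eq_natDegree (monic_monicPoly z.1).ne_zero, natDegree_monicPoly,
          Nat.cast_add]
        exact WithBot.add_lt_add_left (WithBot.natCast_ne_bot m) (degree_lowPoly_lt _)
  have h1 : monicPoly z.1 ∣ lowPoly w.1 := by
    refine hz.dvd_of_dvd_mul_right ⟨-lowPoly w.2, ?_⟩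
    rw [mul_neg]
    exact eq_neg_of_add_eq_zero_left h0
  have h2 : lowPoly w.1 = 0 := by
    refine eq_zero_of_dvd_of_degree_lt h1 ?_
    rw [degree_eq_natDegree (monic_monicPoly z.1).ne_zero, natDegree_monicPoly]
    exact degree_lowPoly_lt _
  rw [h2, zero_mul, zero_add, mul_eq_zero] at h0
  exact Prod.ext (lowPoly_eq_zero h2)
    (lowPoly_eq_zero (h0.resolve_left (monic_monicPoly z.1).ne_zero))

/-- Local lifting of curves through the multiplication map of coprime monic polynomials. -/
theorem exists_lift_mulMap {m l : ℕ} {z₀ : (Fin m → ℝ) × (Fin l → ℝ)}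
    (hz : IsCoprime (monicPoly z₀.1) (monicPoly z₀.2)) (k : ℕ) {B : ℝ} (hB : 0 ≤ B) :
    ∃ U ∈ 𝓝 z₀, ∃ r : ℝ, 0 < r ∧ r ≤ 1 ∧ ∃ B' : ℝ, 0 ≤ B' ∧
      ∀ z ∈ U, ∀ a : ℝ → Fin (m + l) → ℝ, CBdd k B a (Ioo (-1) 1) → a 0 = mulMap m l z →
        ∃ w : ℝ → (Fin m → ℝ) × (Fin l → ℝ), CBdd k B' w (Ioo (-r) r) ∧ w 0 = z ∧
          ∀ t ∈ Ioo (-r) r, mulMap m l (w t) = a t := by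
  have hcd : ContDiffAt ℝ (k + 1 : ℕ) (mulMap m l) z₀ := (contDiff_mulMap m l).contDiffAt
  have hne : ((k + 1 : ℕ) : WithTop ℕ∞) ≠ 0 := by norm_cast
  -- Source and target both have dimension `m + l`, so the injective derivative is invertible.
  let L : ((Fin m → ℝ) × (Fin l → ℝ)) ≃L[ℝ] (Fin (m + l) → ℝ) :=
    (LinearMap.linearEquivOfInjective (fderiv ℝ (mulMap m l) z₀).toLinearMap
      (injective_fderiv_mulMap hz) (by simp)).toContinuousLinearEquiv
  have hL : HasFDerivAt (mulMap m l) (L : ((Fin m → ℝ) × (Fin l → ℝ)) →L[ℝ] (Fin (m + l) → ℝ)) z₀ := by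
    have : (L : ((Fin m → ℝ) × (Fin l → ℝ)) →L[ℝ] (Fin (m + l) → ℝ)) =
        fderiv ℝ (mulMap m l) z₀ := by
      refine ContinuousLinearMap.ext fun w => rfl
    rw [this]
    exact (hcd.differentiableAt hne).hasFDerivAt
  let e := hcd.toOpenPartialHomeomorph (mulMap m l) hL hne
  have he : ∀ z, e z = mulMap m l z := fun z => rfl
  have hsrc : z₀ ∈ e.source := hcd.mem_toOpenPartialHomeomorph_source hL hne
  have htgt : mulMap m l z₀ ∈ e.target := hcd.image_mem_toOpenPartialHomeomorph_target hL hne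
  have hsymm : ContDiffAt ℝ (k + 1 : ℕ) e.symm (mulMap m l z₀) := hcd.to_localInverse hL hne
  obtain ⟨ε, hε, hεs⟩ := Metric.mem_nhds_iff.1 (Filter.inter_mem
    (hsymm.eventually (by simp)) (e.open_target.mem_nhds htgt))
  set y₀ := mulMap m l z₀ with hy₀
  obtain ⟨B', hB', hcomp⟩ := CBdd.comp_smooth (k := k) hB (Ψ := e.symm) (V := Metric.ball y₀ ε)
    (K := Metric.closedBall y₀ (ε / 2)) Metric.isOpen_ball
    (fun y hy => (show ContDiffAt ℝ (k + 1 : ℕ) e.symm y from (hεs hy).1).contDiffWithinAt)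
    (isCompact_closedBall _ _) (convex_closedBall _ _)
    (Metric.closedBall_subset_ball (by linarith))
  -- The curve starts within `ε / 4` of `y₀` and is `B`-Lipschitz, so up to time `ε / (4 * (B + 1))`
  -- it stays within `ε / 2`, where the local inverse is under control.
  refine ⟨e.source ∩ mulMap m l ⁻¹' Metric.ball y₀ (ε / 4), Filter.inter_mem
    (e.open_source.mem_nhds hsrc) ((contDiff_mulMap m l (n := 0)).continuous.continuousAt.preimage_mem_nhds
      (Metric.ball_mem_nhds _ (by linarith))), min 1 (ε / (4 * (B + 1))), by positivity,
      min_le_left _ _, B', hB', fun z hzU a ha ha0 => ?_⟩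
  set r := min 1 (ε / (4 * (B + 1))) with hr
  have hr1 : r ≤ 1 := min_le_left _ _
  have hr0 : 0 < r := by positivity
  have hsub : Ioo (-r) r ⊆ Ioo (-1 : ℝ) 1 := Ioo_subset_Ioo (by linarith) hr1
  have hmaps : MapsTo a (Ioo (-r) r) (Metric.closedBall y₀ (ε / 2)) := by
    intro t ht
    have h1 := ha.lip (convex_Ioo _ _) t (hsub ht) 0 ⟨by norm_num, by norm_num⟩
    have h2 : dist (a 0) y₀ < ε / 4 := by rw [ha0]; exact hzU.2
    have h3 : |t - 0| ≤ r := by rw [sub_zero]; exact abs_le.2 ⟨ht.1.le, ht.2.le⟩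
    have h4 : r ≤ ε / (4 * (B + 1)) := min_le_right _ _
    have h5 : B * r ≤ ε / 4 := by
      calc B * r ≤ (B + 1) * (ε / (4 * (B + 1))) := by gcongr; linarith
        _ = ε / 4 := by field_simp
    rw [Metric.mem_closedBall]
    have h6 := dist_triangle (a t) (a 0) y₀
    rw [dist_eq_norm (a t) (a 0)] at h6
    have h7 : B * |t - 0| ≤ B * r := by gcongr
    linarith
  refine ⟨fun t => e.symm (a t), hcomp _ _ isOpen_Ioo (convex_Ioo _ _) (ha.mono_set hsub) hmaps,
    ?_, fun t ht => ?_⟩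
  · show e.symm (a 0) = z
    rw [ha0, ← he z]
    exact e.left_inv hzU.1
  · rw [← he]
    exact e.right_inv (hεs (Metric.closedBall_subset_ball (by linarith) (hmaps ht))).2

/-- A curve of monic polynomials of degree `n` with coefficients bounded in `C^{k,1}(J)`. -/
structure PolyCurve (n k : ℕ) (B : ℝ) (P : ℝ → ℝ[X]) (J : Set ℝ) : Prop where
  monic : ∀ t ∈ J, (P t).Monic
  natDegree : ∀ t ∈ J, (P t).natDegree = n
  coeff : ∀ i < n, CBdd k B (fun t => (P t).coeff i) J

theorem PolyCurve.mono_set {n k : ℕ} {B : ℝ} {P : ℝ → ℝ[X]} {J J' : Set ℝ} (hJ : J' ⊆ J)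
    (h : PolyCurve n k B P J) : PolyCurve n k B P J' :=
  ⟨fun t ht => h.monic t (hJ ht), fun t ht => h.natDegree t (hJ ht),
    fun i hi => (h.coeff i hi).mono_set hJ⟩

theorem continuous_eval_monicPoly (l : ℕ) :
    Continuous fun q : (Fin l → ℝ) × ℝ => (monicPoly q.1).eval q.2 := by
  simp only [monicPoly, lowPoly, eval_add, eval_pow, eval_X, eval_finsetSum, eval_mul, eval_C]
  fun_prop

/-- The second factor does not vanish at `x₀`; by continuity it does not vanish along `μ` either, so
the first factor carries the root. The data `U`, `W`, `r`, `B'` depend only on the centre, which is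
what the compactness argument needs. -/
theorem exists_local_factor {m l : ℕ} {z₀ : (Fin m → ℝ) × (Fin l → ℝ)}
    (hz : IsCoprime (monicPoly z₀.1) (monicPoly z₀.2)) {x₀ : ℝ}
    (hx : (monicPoly z₀.2).eval x₀ ≠ 0) (k : ℕ) {B : ℝ} (hB : 0 ≤ B) :
    ∃ U ∈ 𝓝 z₀, ∃ W ∈ 𝓝 x₀, ∃ r : ℝ, 0 < r ∧ r ≤ 1 ∧ ∃ B' : ℝ, 0 ≤ B' ∧
      ∀ z ∈ U, ∀ P : ℝ → ℝ[X], PolyCurve (m + l) k B P (Ioo (-1) 1) →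
        P 0 = monicPoly z.1 * monicPoly z.2 → ∀ μ : ℝ → ℝ, ContinuousAt μ 0 → μ 0 ∈ W →
        (∀ᶠ t in 𝓝 0, (P t).IsRoot (μ t)) →
        ∃ Q : ℝ → ℝ[X], PolyCurve m k B' Q (Ioo (-r) r) ∧ (∀ t ∈ Ioo (-r) r, Q t ∣ P t) ∧
          ∀ᶠ t in 𝓝 0, (Q t).IsRoot (μ t) := by
  obtain ⟨U, hU, r, hr0, hr1, B', hB', h⟩ := exists_lift_mulMap hz k hB
  have hc : ContinuousAt (fun q : (Fin l → ℝ) × ℝ => (monicPoly q.1).eval q.2) (z₀.2, x₀) :=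
    (continuous_eval_monicPoly l).continuousAt
  have hev := hc.eventually_ne hx
  rw [nhds_prod_eq] at hev
  obtain ⟨pa, hpa, pb, hpb, hab⟩ := Filter.eventually_prod_iff.1 hev
  refine ⟨U ∩ {z | pa z.2}, Filter.inter_mem hU (continuousAt_snd.eventually hpa), {x | pb x}, hpb,
    r, hr0, hr1, B', hB', fun z hzU P hP hP0 μ hμ hμW hroot => ?_⟩
  have hsub : Ioo (-r) r ⊆ Ioo (-1 : ℝ) 1 := Ioo_subset_Ioo (by linarith) hr1
  have h0 : (0 : ℝ) ∈ Ioo (-r) r := ⟨by linarith, hr0⟩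
  obtain ⟨w, hw, hw0, hwt⟩ := h z hzU.1 (fun t i => (P t).coeff i)
    (CBdd.pi hB isOpen_Ioo fun i => hP.coeff i i.2) (by rw [hP0]; rfl)
  have hfac : ∀ t ∈ Ioo (-r) r, P t = monicPoly (w t).1 * monicPoly (w t).2 := fun t ht => by
    rw [← monicPoly_mulMap, hwt t ht]
    exact eq_monicPoly (hP.monic t (hsub ht)) (hP.natDegree t (hsub ht))
  refine ⟨fun t => monicPoly (w t).1, ⟨fun t _ => monic_monicPoly _, fun t _ => natDegree_monicPoly _,
    fun i hi => ?_⟩, fun t ht => ⟨_, hfac t ht⟩, ?_⟩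
  · have h1 := (hw.clm isOpen_Ioo ((ContinuousLinearMap.proj (R := ℝ) (φ := fun _ : Fin m => ℝ)
      (⟨i, hi⟩ : Fin m)).comp (ContinuousLinearMap.fst ℝ (Fin m → ℝ) (Fin l → ℝ)))).mono_const
      (mul_le_of_le_one_left hB' (ContinuousLinearMap.opNorm_le_bound _ zero_le_one fun v => by
        rw [one_mul]
        exact (norm_le_pi_norm v.1 _).trans (norm_fst_le v)))
    refine h1.congr isOpen_Ioo fun t _ => ?_
    simp [coeff_monicPoly, hi]
  · have hwc : ContinuousAt w 0 :=
      (hw.continuousOn (convex_Ioo _ _)).continuousAt (isOpen_Ioo.mem_nhds h0)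
    have hne : (monicPoly (w 0).2).eval (μ 0) ≠ 0 := hab (hw0 ▸ hzU.2) hμW
    have hcc : ContinuousAt (fun t => (monicPoly (w t).2).eval (μ t)) 0 :=
      (continuous_eval_monicPoly l).continuousAt.comp
        (f := fun t => ((w t).2, μ t)) ((continuousAt_snd.comp hwc).prodMk hμ)
    filter_upwards [hcc.eventually_ne hne, hroot, isOpen_Ioo.mem_nhds h0] with t h1 h2 h3
    rw [hfac t h3, IsRoot, eval_mul, mul_eq_zero] at h2
    exact h2.resolve_right h1

end Factorization

end Bronshtein

namespace Bronshtein

open Filter Topology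

/-! ### Real-rooted polynomials, spread of roots, and the compactness argument. -/

section RealRooted

theorem exists_eq_prod_of_splits {n : ℕ} {p : ℝ[X]} (hm : p.Monic) (hd : p.natDegree = n)
    (hs : p.Splits) : ∃ v : Fin n → ℝ, p = ∏ i, (X - C (v i)) := by
  have hc : p.roots.toList.length = n := by
    rw [Multiset.length_toList, ← hs.natDegree_eq_card_roots, hd]
  subst hc
  refine ⟨fun i => p.roots.toList.get i, ?_⟩
  conv_lhs => rw [hs.eq_prod_roots_of_monic hm, ← Multiset.coe_toList p.roots]
  rw [Multiset.map_coe, Multiset.prod_coe, ← List.prod_ofFn]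
  congr 1
  conv_lhs => rw [← List.ofFn_get p.roots.toList]
  rw [List.map_ofFn]
  rfl

theorem coeff_pred_prod_X_sub_C {n : ℕ} (hn : 0 < n) (v : Fin n → ℝ) :
    (∏ i, (X - C (v i))).coeff (n - 1) = -∑ i, v i := by
  have := prod_X_sub_C_coeff_card_pred (Finset.univ : Finset (Fin n)) v (by simpa using hn)
  simpa using this

/-- Newton's identity for the second elementary symmetric function, by peeling off one linear
factor. -/
theorem coeff_prod_X_sub_C_sum_sq {k : ℕ} (v : Fin (k + 2) → ℝ) :
    2 * (∏ i, (X - C (v i))).coeff k = (∑ i, v i) ^ 2 - ∑ i, v i ^ 2 := by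
  induction k with
  | zero =>
    change 2 * (∏ i : Fin 2, (X - C (v i))).coeff 0 = (∑ i : Fin 2, v i) ^ 2 - ∑ i : Fin 2, v i ^ 2
    simp only [Fin.prod_univ_two, Fin.sum_univ_two, mul_coeff_zero, coeff_sub, coeff_X_zero,
      coeff_C_zero]
    ring
  | succ k ih =>
    have h1 := ih (fun i => v i.succ)
    have h2 := coeff_pred_prod_X_sub_C (n := k + 2) (by omega) (fun i => v i.succ)
    rw [show k + 2 - 1 = k + 1 by omega] at h2
    rw [Fin.prod_univ_succ, Fin.sum_univ_succ v, Fin.sum_univ_succ (fun i => v i ^ 2), sub_mul, coeff_sub, coeff_X_mul,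
      coeff_C_mul, h2]
    linear_combination h1

/-- This makes the second coefficient a measure of the size of the whole root vector; its sign and
the bounds on roots follow. -/
theorem sum_sq_eq {n : ℕ} (hn : 2 ≤ n) {p : ℝ[X]} {v : Fin n → ℝ} (hp : p = ∏ i, (X - C (v i)))
    (h1 : p.coeff (n - 1) = 0) : ∑ i, v i = 0 ∧ ∑ i, v i ^ 2 = -2 * p.coeff (n - 2) := by
  obtain ⟨k, rfl⟩ : ∃ k, n = k + 2 := ⟨n - 2, by omega⟩
  have h2 := coeff_prod_X_sub_C_sum_sq v
  have h3 := coeff_pred_prod_X_sub_C (by omega) v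
  rw [← hp] at h2 h3
  rw [h1] at h3
  have h4 : ∑ i, v i = 0 := by linarith
  rw [h4] at h2
  exact ⟨h4, by rw [show k + 2 - 2 = k by omega]; linarith⟩

theorem coeff_sub_two_nonpos {n : ℕ} (hn : 2 ≤ n) {p : ℝ[X]} (hm : p.Monic) (hd : p.natDegree = n)
    (hs : p.Splits) (h1 : p.coeff (n - 1) = 0) : p.coeff (n - 2) ≤ 0 := by
  obtain ⟨v, hv⟩ := exists_eq_prod_of_splits hm hd hs
  have h2 := (sum_sq_eq hn hv h1).2
  have h3 : 0 ≤ ∑ i, v i ^ 2 := Finset.sum_nonneg fun i _ => sq_nonneg _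
  linarith

theorem isRoot_prod_iff {n : ℕ} {v : Fin n → ℝ} {x : ℝ} :
    (∏ i, (X - C (v i))).IsRoot x ↔ ∃ i, v i = x := by
  rw [IsRoot, eval_prod, Finset.prod_eq_zero_iff]
  simp [sub_eq_zero, eq_comm]

theorem abs_root_le {n : ℕ} (hn : 2 ≤ n) {p : ℝ[X]} (hm : p.Monic) (hd : p.natDegree = n)
    (hs : p.Splits) (h1 : p.coeff (n - 1) = 0) {x : ℝ} (hx : p.IsRoot x) :
    |x| ≤ √(2 * -p.coeff (n - 2)) := by
  obtain ⟨v, hv⟩ := exists_eq_prod_of_splits hm hd hs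
  have h2 := (sum_sq_eq hn hv h1).2
  rw [hv, isRoot_prod_iff] at hx
  obtain ⟨i, rfl⟩ := hx
  refine Real.le_sqrt_of_sq_le ?_
  rw [sq_abs]
  have := Finset.single_le_sum (f := fun i => v i ^ 2) (fun i _ => sq_nonneg _) (Finset.mem_univ i)
  linarith

theorem abs_coeff_le {n : ℕ} {p : ℝ[X]} (hm : p.Monic) (hd : p.natDegree = n)
    (hs : p.Splits) {R : ℝ} (hR : ∀ x, p.IsRoot x → |x| ≤ R) (i : ℕ) :
    |p.coeff i| ≤ R ^ (n - i) * n.choose i := by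
  have := coeff_le_of_roots_le (f := RingHom.id ℝ) (p := p) (B := R) i hm (by simpa using hs)
    (fun z hz => by
      rw [Polynomial.map_id] at hz
      exact hR z (isRoot_of_mem_roots hz))
  rwa [Polynomial.map_id, hd] at this

/-- Every closed interval of radius `η` contains at most `p` roots of `P`, with multiplicity. -/
def Spread (p : ℕ) (η : ℝ) (P : ℝ[X]) : Prop :=
  ∀ x : ℝ, P.roots.countP (fun y => |y - x| ≤ η) ≤ p

theorem Spread.of_dvd {p : ℕ} {η : ℝ} {P Q : ℝ[X]} (h : Spread p η P) (hP : P ≠ 0) (hQ : Q ∣ P) :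
    Spread p η Q := fun x =>
  (Multiset.countP_le_of_le _ (roots.le_of_dvd hP hQ)).trans (h x)

theorem Spread.of_natDegree_le {p : ℕ} {η : ℝ} {P : ℝ[X]} (h : P.natDegree ≤ p) :
    Spread p η P := fun _ =>
  (Multiset.countP_le_card _ _).trans ((card_roots' P).trans h)

theorem Spread.mono {p : ℕ} {η η' : ℝ} {P : ℝ[X]} (h : Spread p η P) (hη : η' ≤ η) :
    Spread p η' P := fun x => by
  refine le_trans ?_ (h x)
  rw [Multiset.countP_eq_card_filter, Multiset.countP_eq_card_filter]
  exact Multiset.card_le_card (Multiset.monotone_filter_right _ fun y hy => hy.trans hη)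

theorem Spread.scaleRoots {p : ℕ} {η s : ℝ} {P : ℝ[X]} (h : Spread p η P) (hs : 0 < s) :
    Spread p (η * s) (P.scaleRoots s) := fun x => by
  rw [roots_scaleRoots P hs.ne'.isUnit, Multiset.countP_map]
  refine le_trans (le_of_eq ?_) (h (x / s))
  rw [Multiset.countP_eq_card_filter]
  congr 1
  refine Multiset.filter_congr fun y _ => ?_
  have : s * y - x = (y - x / s) * s := by field_simp
  rw [this, abs_mul, abs_of_pos hs, mul_le_mul_iff_left₀ hs]

theorem roots_comp_X_sub_C_eq (P : ℝ[X]) (c : ℝ) :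
    (P.comp (X - C c)).roots = P.roots.map (· + c) := by
  have := P.roots_comp_C_mul_X_add_C 1 (-c) isUnit_one
  simpa [sub_eq_add_neg] using this

theorem Spread.comp_X_sub_C {p : ℕ} {η : ℝ} {P : ℝ[X]} (h : Spread p η P) (c : ℝ) :
    Spread p η (P.comp (X - C c)) := fun x => by
  rw [roots_comp_X_sub_C_eq, Multiset.countP_map]
  refine le_trans (le_of_eq ?_) (h (x - c))
  rw [Multiset.countP_eq_card_filter]
  congr 1
  refine Multiset.filter_congr fun y _ => ?_
  rw [show y + c - x = y - (x - c) by ring]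

theorem continuous_coeff_prod {n : ℕ} (s : Finset (Fin n)) (j : ℕ) :
    Continuous fun v : Fin n → ℝ => (∏ i ∈ s, (X - C (v i))).coeff j := by
  classical
  induction s using Finset.induction_on generalizing j with
  | empty => simpa using continuous_const
  | insert a s ha ih =>
    simp only [Finset.prod_insert ha, coeff_mul]
    refine continuous_finsetSum _ fun p _ => Continuous.mul ?_ (ih _)
    simp only [coeff_sub, coeff_C]
    split_ifs <;> fun_prop

/-- The lower coefficients of `∏_{i ∈ s} (X - vᵢ)`. -/
noncomputable def prodCoeffs {n : ℕ} (s : Finset (Fin n)) (m : ℕ) (v : Fin n → ℝ) : Fin m → ℝ :=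
  fun j => (∏ i ∈ s, (X - C (v i))).coeff j

theorem continuous_prodCoeffs {n : ℕ} (s : Finset (Fin n)) (m : ℕ) :
    Continuous (prodCoeffs s m) :=
  continuous_pi fun j => continuous_coeff_prod s j

theorem monicPoly_prodCoeffs {n : ℕ} {s : Finset (Fin n)} {m : ℕ} (hs : s.card = m)
    (v : Fin n → ℝ) : monicPoly (prodCoeffs s m v) = ∏ i ∈ s, (X - C (v i)) :=
  (eq_monicPoly (monic_prod_X_sub_C _ _) (by rw [natDegree_finsetProd_X_sub_C_eq_card, hs])).symm

/-- A curve of real-rooted polynomials, normalized by `∑ vᵢ = 0` and `∑ vᵢ² = 2` for its roots `vᵢ`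
at `0`, locally has a factor of smaller degree, with uniform bounds. -/
theorem exists_factor_of_normalized (n k : ℕ) {B : ℝ} (hB : 0 ≤ B) :
    ∃ r : ℝ, 0 < r ∧ r ≤ 1 ∧ ∃ B' : ℝ, 0 ≤ B' ∧ ∀ (P : ℝ → ℝ[X]) (v : Fin n → ℝ) (μ : ℝ → ℝ),
      PolyCurve n k B P (Ioo (-1) 1) → P 0 = ∏ i, (X - C (v i)) → ∑ i, v i = 0 →
      ∑ i, v i ^ 2 = 2 → ContinuousAt μ 0 → (∀ᶠ t in 𝓝 0, (P t).IsRoot (μ t)) →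
      ∃ m < n, ∃ Q : ℝ → ℝ[X], PolyCurve m k B' Q (Ioo (-r) r) ∧ (∀ t ∈ Ioo (-r) r, Q t ∣ P t) ∧
          ∀ᶠ t in 𝓝 0, (Q t).IsRoot (μ t) := by
  -- Pairs of a normalized root vector and one of its entries; the entry records which root is
  -- followed.
  set S : Set ((Fin n → ℝ) × ℝ) :=
    {q | ∑ i, q.1 i = 0 ∧ ∑ i, q.1 i ^ 2 = 2 ∧ ∏ i, (q.2 - q.1 i) = 0} with hS
  have hcomp : IsCompact S := by
    refine Metric.isCompact_of_isClosed_isBounded ?_ ?_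
    · refine IsClosed.inter (isClosed_eq (by fun_prop) continuous_const)
        (IsClosed.inter (isClosed_eq (by fun_prop) continuous_const)
          (isClosed_eq (by fun_prop) continuous_const))
    · refine (Metric.isBounded_closedBall (x := 0) (r := 2)).subset fun q hq => ?_
      have hb : ∀ i, |q.1 i| ≤ 2 := fun i => by
        have := Finset.single_le_sum (f := fun i => q.1 i ^ 2) (fun i _ => sq_nonneg _)
          (Finset.mem_univ i)
        simp only [hq.2.1] at this
        exact abs_le_of_sq_le_sq (by linarith) (by norm_num)
      rw [mem_closedBall_zero_iff, Prod.norm_def]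
      refine max_le ((pi_norm_le_iff_of_nonneg (by norm_num)).2 hb) ?_
      obtain ⟨i, -, hi⟩ := Finset.prod_eq_zero_iff.1 hq.2.2
      rw [sub_eq_zero.1 hi]
      exact hb i
  have key : ∃ r : ℝ, 0 < r ∧ r ≤ 1 ∧ ∃ B' : ℝ, 0 ≤ B' ∧ ∀ q ∈ S, ∀ (P : ℝ → ℝ[X]) (μ : ℝ → ℝ),
      PolyCurve n k B P (Ioo (-1) 1) → P 0 = ∏ i, (X - C (q.1 i)) → μ 0 = q.2 →
      ContinuousAt μ 0 → (∀ᶠ t in 𝓝 0, (P t).IsRoot (μ t)) →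
      ∃ m < n, ∃ Q : ℝ → ℝ[X], PolyCurve m k B' Q (Ioo (-r) r) ∧ (∀ t ∈ Ioo (-r) r, Q t ∣ P t) ∧
          ∀ᶠ t in 𝓝 0, (Q t).IsRoot (μ t) := by
    -- Having a common `r` and `B'` passes to subsets and, with minimum and maximum, to unions, so
    -- it is enough to find them near each point of `S`.
    refine hcomp.induction_on (p := fun T => ∃ r : ℝ, 0 < r ∧ r ≤ 1 ∧ ∃ B' : ℝ, 0 ≤ B' ∧
      ∀ q ∈ T, ∀ (P : ℝ → ℝ[X]) (μ : ℝ → ℝ),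
      PolyCurve n k B P (Ioo (-1) 1) → P 0 = ∏ i, (X - C (q.1 i)) → μ 0 = q.2 →
      ContinuousAt μ 0 → (∀ᶠ t in 𝓝 0, (P t).IsRoot (μ t)) →
      ∃ m < n, ∃ Q : ℝ → ℝ[X], PolyCurve m k B' Q (Ioo (-r) r) ∧ (∀ t ∈ Ioo (-r) r, Q t ∣ P t) ∧
          ∀ᶠ t in 𝓝 0, (Q t).IsRoot (μ t)) ?_ ?_ ?_ ?_
    · exact ⟨1, one_pos, le_rfl, 0, le_rfl, by simp⟩
    · rintro s t hst ⟨r, h0, h1, B', hB', h⟩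
      exact ⟨r, h0, h1, B', hB', fun q hq => h q (hst hq)⟩
    · rintro s t ⟨r, h0, h1, B₁, hB₁, h⟩ ⟨r', h0', h1', B₂, hB₂, h'⟩
      refine ⟨min r r', lt_min h0 h0', (min_le_left _ _).trans h1, max B₁ B₂,
        hB₁.trans (le_max_left _ _), ?_⟩
      rintro q (hq | hq) P μ a1 a2 a3 a4 a5
      · obtain ⟨m, hm, Q, hQ, hd, hr⟩ := h q hq P μ a1 a2 a3 a4 a5
        have hsub : Ioo (-min r r') (min r r') ⊆ Ioo (-r) r :=
          Ioo_subset_Ioo (neg_le_neg (min_le_left _ _)) (min_le_left _ _)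
        have hQ' := hQ.mono_set hsub
        exact ⟨m, hm, Q, ⟨hQ'.1, hQ'.2, fun i hi => (hQ'.3 i hi).mono_const (le_max_left _ _)⟩,
          fun t ht => hd t (hsub ht), hr⟩
      · obtain ⟨m, hm, Q, hQ, hd, hr⟩ := h' q hq P μ a1 a2 a3 a4 a5
        have hsub : Ioo (-min r r') (min r r') ⊆ Ioo (-r') r' :=
          Ioo_subset_Ioo (neg_le_neg (min_le_right _ _)) (min_le_right _ _)
        have hQ' := hQ.mono_set hsub
        exact ⟨m, hm, Q, ⟨hQ'.1, hQ'.2, fun i hi => (hQ'.3 i hi).mono_const (le_max_right _ _)⟩,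
          fun t ht => hd t (hsub ht), hr⟩
    · rintro ⟨v₀, x₀⟩ hq₀
      classical
      -- The index split is fixed by the centre `v₀` and kept for nearby `v`, whose entries over `s`
      -- may have separated.
      set s : Finset (Fin n) := Finset.univ.filter (fun i => v₀ i = x₀) with hs
      obtain ⟨m, hm⟩ : ∃ m, s.card = m := ⟨_, rfl⟩
      obtain ⟨l, hl⟩ : ∃ l, sᶜ.card = l := ⟨_, rfl⟩
      have hml : m + l = n := by
        rw [← hm, ← hl, Finset.card_add_card_compl, Fintype.card_fin]
      have hmn : m < n := by
        rw [← hm]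
        -- If all entries were equal, their zero sum would make the sum of squares `0` instead of
        -- `2`.
        have hex : ∃ i, v₀ i ≠ x₀ := by
          by_contra! hall
          have h1 : ∑ i, v₀ i = 0 := hq₀.1
          have h2 : ∑ i, v₀ i ^ 2 = 2 := hq₀.2.1
          simp only [hall, Finset.sum_const, Finset.card_univ, Fintype.card_fin,
            nsmul_eq_mul] at h1 h2
          have h3 : (n : ℝ) * x₀ ^ 2 = n * x₀ * x₀ := by ring
          rw [h3, h1] at h2
          norm_num at h2
        obtain ⟨i, hi⟩ := hex
        exact (Finset.card_lt_univ_of_notMem (x := i) (by simp [hs, hi])).trans_eq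
          (Fintype.card_fin n)
      have hcop : IsCoprime (monicPoly (prodCoeffs s m v₀)) (monicPoly (prodCoeffs sᶜ l v₀)) := by
        rw [monicPoly_prodCoeffs hm, monicPoly_prodCoeffs hl]
        refine IsCoprime.prod_left fun i hi => IsCoprime.prod_right fun j hj =>
          isCoprime_X_sub_C_of_isUnit_sub (sub_ne_zero.2 ?_).isUnit
        have h1 : v₀ i = x₀ := by simpa [hs] using hi
        have h2 : ¬ v₀ j = x₀ := by simpa [hs] using hj
        rw [h1]
        exact Ne.symm h2
      have hne : (monicPoly (prodCoeffs sᶜ l v₀)).eval x₀ ≠ 0 := by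
        rw [monicPoly_prodCoeffs hl, eval_prod, Finset.prod_ne_zero_iff]
        intro j hj
        have h2 : ¬ v₀ j = x₀ := by simpa [hs] using hj
        simpa [sub_eq_zero] using Ne.symm h2
      obtain ⟨U, hU, W, hW, r, h0, h1, B', hB', h⟩ := exists_local_factor
        (z₀ := (prodCoeffs s m v₀, prodCoeffs sᶜ l v₀)) hcop hne k hB
      have hΦc : Continuous fun v => (prodCoeffs s m v, prodCoeffs sᶜ l v) :=
        (continuous_prodCoeffs s m).prodMk (continuous_prodCoeffs sᶜ l)
      refine ⟨((fun v => (prodCoeffs s m v, prodCoeffs sᶜ l v)) ⁻¹' U) ×ˢ W, mem_nhdsWithin_of_mem_nhds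
        (prod_mem_nhds (hΦc.continuousAt.preimage_mem_nhds hU) hW), r, h0, h1, B', hB', ?_⟩
      rintro ⟨v, x⟩ ⟨hv, hx⟩ P μ a1 a2 a3 a4 a5
      refine ⟨m, hmn, h (prodCoeffs s m v, prodCoeffs sᶜ l v) hv P (by rw [hml]; exact a1) ?_ μ a4 (by rw [a3]; exact hx) a5⟩
      rw [a2, monicPoly_prodCoeffs hm, monicPoly_prodCoeffs hl, Finset.prod_mul_prod_compl]
  obtain ⟨r, h0, h1, B', hB', h⟩ := key
  refine ⟨r, h0, h1, B', hB', fun P v μ a1 a2 a3 a4 a5 a6 => ?_⟩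
  refine h (v, μ 0) ⟨a3, a4, ?_⟩ P μ a1 a2 rfl a5 a6
  have := a6.self_of_nhds
  rw [a2, IsRoot, eval_prod] at this
  simpa using this

end RealRooted

end Bronshtein

namespace Bronshtein

open Filter Topology

/-! ### Speed of a root, and the induction step for normalized curves. -/

section Velocity

/-- `|μ(t) - μ(t₀)| ≤ C |t - t₀|` for `t` near `t₀`. -/
def Vel (μ : ℝ → ℝ) (t₀ C : ℝ) : Prop := ∀ᶠ t in 𝓝 t₀, |μ t - μ t₀| ≤ C * |t - t₀|

theorem Vel.mono {μ : ℝ → ℝ} {t₀ C C' : ℝ} (h : Vel μ t₀ C) (hC : C ≤ C') : Vel μ t₀ C' := by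
  filter_upwards [h] with t ht
  exact ht.trans (by gcongr)

theorem tendsto_affine (t₀ ρ : ℝ) : Tendsto (fun s : ℝ => t₀ + ρ * s) (𝓝 0) (𝓝 t₀) := by
  have : Continuous fun s : ℝ => t₀ + ρ * s := by fun_prop
  simpa using this.tendsto 0

theorem Vel.of_rescale {μ : ℝ → ℝ} {t₀ C c ρ : ℝ} (hc : 0 < c) (hρ : 0 < ρ)
    (h : Vel (fun s => c * μ (t₀ + ρ * s)) 0 C) : Vel μ t₀ (C / (c * ρ)) := by
  have ht : Tendsto (fun t : ℝ => (t - t₀) / ρ) (𝓝 t₀) (𝓝 0) := by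
    have : Continuous fun t : ℝ => (t - t₀) / ρ := by fun_prop
    simpa using this.tendsto t₀
  filter_upwards [ht.eventually h] with t h1
  rw [mul_zero, add_zero, mul_div_cancel₀ _ hρ.ne', add_sub_cancel, ← mul_sub, abs_mul,
    abs_of_pos hc, sub_zero, abs_div, abs_of_pos hρ] at h1
  rw [div_mul_eq_mul_div, le_div_iff₀ (by positivity)]
  calc |μ t - μ t₀| * (c * ρ) = c * |μ t - μ t₀| * ρ := by ring
    _ ≤ C * (|t - t₀| / ρ) * ρ := by gcongr
    _ = C * |t - t₀| := by field_simp

theorem Vel.add_lip {μ g : ℝ → ℝ} {t₀ C D : ℝ} {J : Set ℝ} (hJ : J ∈ 𝓝 t₀)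
    (h : Vel μ t₀ C) (hg : ∀ x ∈ J, ∀ y ∈ J, ‖g x - g y‖ ≤ D * |x - y|) :
    Vel (fun t => μ t + g t) t₀ (C + D) := by
  filter_upwards [h, hJ] with t h1 h2
  have h3 := hg t h2 t₀ (mem_of_mem_nhds hJ)
  rw [Real.norm_eq_abs] at h3
  calc |μ t + g t - (μ t₀ + g t₀)| = |(μ t - μ t₀) + (g t - g t₀)| := by ring_nf
    _ ≤ |μ t - μ t₀| + |g t - g t₀| := abs_add_le _ _
    _ ≤ _ := by linarith

theorem isRoot_scaleRoots {P : ℝ[X]} {x : ℝ} (c : ℝ) (h : P.IsRoot x) :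
    (P.scaleRoots c).IsRoot (c * x) := by
  rw [IsRoot, scaleRoots_eval_mul, h.eq_zero, mul_zero]

theorem isRoot_comp_X_sub_C {P : ℝ[X]} {x : ℝ} (c : ℝ) (h : P.IsRoot x) :
    (P.comp (X - C c)).IsRoot (x + c) := by
  rw [IsRoot, eval_comp]
  simpa using h

/-- Uniform bounds for the speed of a root of a real-rooted curve of degree `n` whose coefficients
are bounded in `C^{k,1}`. -/
def HasVelocityBound (n k : ℕ) : Prop :=
  ∀ B : ℝ, 0 ≤ B → ∃ C : ℝ, 0 ≤ C ∧ ∀ (η : ℝ) (P : ℝ → ℝ[X]) (μ : ℝ → ℝ), 0 < η → η ≤ 1 →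
    PolyCurve n k B P (Ioo (-1) 1) → (∀ t ∈ Ioo (-1 : ℝ) 1, (P t).Splits) →
    Spread (k + 1) η (P 0) → ContinuousAt μ 0 → (∀ᶠ t in 𝓝 0, (P t).IsRoot (μ t)) →
    Vel μ 0 (C * η ^ (-(((n - (k + 1) : ℕ) : ℝ) / (k + 1))))

theorem one_le_rpow_neg {η x : ℝ} (h0 : 0 < η) (h1 : η ≤ 1) (hx : 0 ≤ x) : 1 ≤ η ^ (-x) :=
  Real.one_le_rpow_of_pos_of_le_one_of_nonpos h0 h1 (by linarith)

/-- The bound for degree `n` from the bounds for smaller degrees, in normalized form. -/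
theorem velocity_of_normalized {n k : ℕ} (hn : 2 ≤ n) (ih : ∀ m < n, HasVelocityBound m k) {B : ℝ}
    (hB : 0 ≤ B) : ∃ C : ℝ, 0 ≤ C ∧ ∀ (η : ℝ) (P : ℝ → ℝ[X]) (μ : ℝ → ℝ), 0 < η → η ≤ 1 →
    PolyCurve n k B P (Ioo (-1) 1) → (∀ t ∈ Ioo (-1 : ℝ) 1, (P t).Splits) →
    (P 0).coeff (n - 1) = 0 → (P 0).coeff (n - 2) = -1 →
    Spread (k + 1) η (P 0) → ContinuousAt μ 0 → (∀ᶠ t in 𝓝 0, (P t).IsRoot (μ t)) →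
    Vel μ 0 (C * η ^ (-(((n - (k + 1) : ℕ) : ℝ) / (k + 1)))) := by
  obtain ⟨r, hr0, hr1, B', hB', h⟩ := exists_factor_of_normalized n k hB
  -- The degree of the factor is not known in advance, so constants for all `m < n` are summed;
  -- larger `m` get the dummy value `0`.
  have hC : ∀ m : ℕ, ∃ C : ℝ, 0 ≤ C ∧ (m < n → ∀ (η : ℝ) (P : ℝ → ℝ[X]) (μ : ℝ → ℝ), 0 < η →
    η ≤ 1 → PolyCurve m k B' P (Ioo (-1) 1) → (∀ t ∈ Ioo (-1 : ℝ) 1, (P t).Splits) →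
    Spread (k + 1) η (P 0) → ContinuousAt μ 0 → (∀ᶠ t in 𝓝 0, (P t).IsRoot (μ t)) →
    Vel μ 0 (C * η ^ (-(((m - (k + 1) : ℕ) : ℝ) / (k + 1))))) := fun m => by
    by_cases hm : m < n
    · obtain ⟨C, hC, h⟩ := ih m hm B' hB'
      exact ⟨C, hC, fun _ => h⟩
    · exact ⟨0, le_rfl, fun h => absurd h hm⟩
  choose C hC0 hC using hC
  set D := ∑ m ∈ Finset.range n, C m with hD
  have hD0 : 0 ≤ D := Finset.sum_nonneg fun m _ => hC0 m
  refine ⟨D / r, by positivity, fun η P μ hη0 hη1 hP hs h1 h2 hsp hμ hroot => ?_⟩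
  have h00 : (0 : ℝ) ∈ Ioo (-1 : ℝ) 1 := by norm_num
  obtain ⟨v, hv⟩ := exists_eq_prod_of_splits (hP.monic 0 h00) (hP.natDegree 0 h00) (hs 0 h00)
  obtain ⟨hv1, hv2⟩ := sum_sq_eq hn hv h1
  rw [h2] at hv2
  obtain ⟨m, hmn, Q, hQ, hQd, hQr⟩ := h P v μ hP hv hv1 (by linarith) hμ hroot
  have hsub : Ioo (-r) r ⊆ Ioo (-1 : ℝ) 1 := Ioo_subset_Ioo (by linarith) hr1
  have hmaps : ∀ s ∈ Ioo (-1 : ℝ) 1, 0 + r * s ∈ Ioo (-r) r := fun s hs => by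
    constructor <;> nlinarith [hs.1, hs.2]
  have ht := tendsto_affine 0 r
  have hV := hC m hmn η (fun s => Q (0 + r * s)) (fun s => 1 * μ (0 + r * s)) hη0 hη1
    ⟨fun s hs => hQ.monic _ (hmaps s hs), fun s hs => hQ.natDegree _ (hmaps s hs), fun i hi => by
      have := (hQ.coeff i hi).affine 1 r 0 (by rwa [abs_of_pos hr0]) hB' isOpen_Ioo hmaps
      simpa using this⟩
    (fun s hs' => (hs _ (hsub (hmaps s hs'))).of_dvd (hP.monic _ (hsub (hmaps s hs'))).ne_zero
      (hQd _ (hmaps s hs')))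
    (by
      have := hsp.of_dvd (hP.monic 0 h00).ne_zero (hQd 0 ⟨by linarith, hr0⟩)
      simpa using this)
    (by
      refine ContinuousAt.mul continuousAt_const (ContinuousAt.comp (g := μ) ?_ ?_)
      · simpa using hμ
      · fun_prop)
    (by simpa using ht.eventually hQr)
  refine (hV.of_rescale one_pos hr0).mono ?_
  rw [one_mul, div_mul_eq_mul_div]
  refine div_le_div_of_nonneg_right (mul_le_mul ?_ ?_ (by positivity) hD0) hr0.le
  · exact Finset.single_le_sum (f := C) (fun i _ => hC0 i) (Finset.mem_range.2 hmn)
  -- As `η ≤ 1`, the smaller degree gives the smaller power.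
  · refine Real.rpow_le_rpow_of_exponent_ge hη0 hη1 (neg_le_neg ?_)
    have : ((m - (k + 1) : ℕ) : ℝ) ≤ (n - (k + 1) : ℕ) := by
      exact_mod_cast Nat.sub_le_sub_right hmn.le _
    gcongr

/-- Mean value inequality for `f` minus its tangent; this yields `L` rather than the sharp `L / 2`.
-/
theorem abs_sub_linear_le {f : ℝ → ℝ} {L : ℝ} {J : Set ℝ} (hJ : Convex ℝ J) (hL : 0 ≤ L)
    (hd : ∀ x ∈ J, DifferentiableAt ℝ f x)
    (hL' : ∀ x ∈ J, ∀ y ∈ J, |deriv f x - deriv f y| ≤ L * |x - y|) {a x : ℝ} (ha : a ∈ J)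
    (hx : x ∈ J) : |f x - (f a + deriv f a * (x - a))| ≤ L * (x - a) ^ 2 := by
  have hsub : ∀ y ∈ uIcc a x, y ∈ J ∧ |y - a| ≤ |x - a| := fun y hy =>
    ⟨hJ.ordConnected.uIcc_subset ha hx hy, abs_sub_left_of_mem_uIcc hy⟩
  have hg : ∀ y ∈ uIcc a x, HasDerivWithinAt (fun y => f y - deriv f a * (y - a))
      (deriv f y - deriv f a) (uIcc a x) y := fun y hy =>
    (((hd y (hsub y hy).1).hasDerivAt.sub
      (((hasDerivAt_id y).sub_const a).const_mul (deriv f a))).congr_deriv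
        (by ring)).hasDerivWithinAt
  have := (convex_uIcc a x).norm_image_sub_le_of_norm_hasDerivWithin_le (C := L * |x - a|) hg
    (fun y hy => (hL' y (hsub y hy).1 a ha).trans
      (mul_le_mul_of_nonneg_left (hsub y hy).2 hL)) left_mem_uIcc right_mem_uIcc
  rw [Real.norm_eq_abs, Real.norm_eq_abs, mul_assoc, abs_mul_abs_self] at this
  convert this using 2 <;> ring

/-- Bounds for a nonnegative function on `(-1, 1)` with Lipschitz derivative. -/
theorem le_of_nonneg_of_deriv_lip {f : ℝ → ℝ} {L : ℝ} (hL : 0 ≤ L)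
    (hd : ∀ x ∈ Ioo (-1 : ℝ) 1, DifferentiableAt ℝ f x)
    (hL' : ∀ x ∈ Ioo (-1 : ℝ) 1, ∀ y ∈ Ioo (-1 : ℝ) 1, |deriv f x - deriv f y| ≤ L * |x - y|)
    (h0 : ∀ x ∈ Ioo (-1 : ℝ) 1, 0 ≤ f x) (h1 : f 0 = 1) :
    ∀ x ∈ Ioo (-1 : ℝ) 1, f x ≤ 3 + 2 * L := by
  have h00 : (0 : ℝ) ∈ Ioo (-1 : ℝ) 1 := by norm_num
  have key : ∀ x ∈ Ioo (-1 : ℝ) 1, |f x - (1 + deriv f 0 * x)| ≤ L * x ^ 2 := fun x hx => by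
    simpa [h1] using abs_sub_linear_le (convex_Ioo _ _) hL hd hL' h00 hx
  -- Nonnegativity at `1 / 2` and `-1 / 2` bounds the slope at `0` from both sides.
  have ha := key (1 / 2) (by norm_num)
  have hb := key (-1 / 2) (by norm_num)
  rw [abs_le] at ha hb
  have ha0 := h0 (1 / 2) (by norm_num)
  have hb0 := h0 (-1 / 2) (by norm_num)
  intro x hx
  have hx' := key x hx
  rw [abs_le] at hx'
  have hD : |deriv f 0| ≤ 2 + L / 2 := abs_le.2 ⟨by linarith, by linarith⟩
  have h3 : deriv f 0 * x ≤ 2 + L / 2 := by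
    refine (le_abs_self _).trans ?_
    rw [abs_mul]
    refine (mul_le_of_le_one_right (abs_nonneg _) (abs_le.2 ⟨hx.1.le, hx.2.le⟩)).trans hD
  have h4 : L * x ^ 2 ≤ L := mul_le_of_le_one_right hL (by nlinarith [hx.1, hx.2])
  linarith

/-- As `velocity_of_normalized`, with bounds for the highest derivatives only. -/
theorem velocity_of_cLip {n k : ℕ} (hn : 2 ≤ n) (hk : 1 ≤ k) (ih : ∀ m < n, HasVelocityBound m k)
    {L : ℝ} (hL : 0 ≤ L) :
    ∃ C : ℝ, 0 ≤ C ∧ ∀ (η : ℝ) (P : ℝ → ℝ[X]) (μ : ℝ → ℝ), 0 < η → η ≤ 1 →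
    (∀ t ∈ Ioo (-1 : ℝ) 1, (P t).Monic) → (∀ t ∈ Ioo (-1 : ℝ) 1, (P t).natDegree = n) →
    (∀ i ≤ n - 2, CLip k L (fun t => (P t).coeff i) (Ioo (-1) 1)) →
    (∀ x ∈ Ioo (-1 : ℝ) 1, ∀ y ∈ Ioo (-1 : ℝ) 1, |deriv (fun t => (P t).coeff (n - 2)) x -
      deriv (fun t => (P t).coeff (n - 2)) y| ≤ L * |x - y|) →
    (∀ t ∈ Ioo (-1 : ℝ) 1, (P t).Splits) →
    (∀ t ∈ Ioo (-1 : ℝ) 1, (P t).coeff (n - 1) = 0) → (P 0).coeff (n - 2) = -1 →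
    Spread (k + 1) η (P 0) → ContinuousAt μ 0 → (∀ᶠ t in 𝓝 0, (P t).IsRoot (μ t)) →
    Vel μ 0 (C * η ^ (-(((n - (k + 1) : ℕ) : ℝ) / (k + 1)))) := by
  -- `R` bounds the roots, because `-a₂ ≤ 3 + 2 * L` by `le_of_nonneg_of_deriv_lip`; `K` then bounds
  -- all lower coefficients.
  set R := √(2 * (3 + 2 * L)) with hR
  set K := ∑ i ∈ Finset.range n, R ^ (n - i) * n.choose i with hK
  have hK0 : 0 ≤ K := Finset.sum_nonneg fun i _ => by positivity
  obtain ⟨B, hB, hint⟩ := CLip.cBdd_of_bound k hL hK0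
  obtain ⟨C, hC, h⟩ := velocity_of_normalized (k := k) hn ih hB
  refine ⟨C, hC, fun η P μ hη0 hη1 hm hd hc hc2 hs h1 h2 hsp hμ hroot => ?_⟩
  have h00 : (0 : ℝ) ∈ Ioo (-1 : ℝ) 1 := by norm_num
  refine h η P μ hη0 hη1 ⟨hm, hd, fun i hi => ?_⟩ hs (h1 0 h00) h2 hsp hμ hroot
  have hf := le_of_nonneg_of_deriv_lip (f := fun t => -(P t).coeff (n - 2)) hL
    (fun x hx => ((hc (n - 2) le_rfl).pred_of_differentiable (by omega) x hx).fun_neg)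
    (fun x hx y hy => by
      rw [deriv.fun_neg, deriv.fun_neg, ← abs_neg]
      convert hc2 x hx y hy using 2
      ring)
    (fun x hx => by
      have := coeff_sub_two_nonpos hn (hm x hx) (hd x hx) (hs x hx) (h1 x hx)
      linarith)
    (by simp [h2])
  rcases Nat.lt_or_ge (n - 2) i with hi' | hi'
  · have : i = n - 1 := by omega
    subst this
    exact (CBdd.const (c := (0 : ℝ)) (by simpa using hB)).congr isOpen_Ioo fun t ht => (h1 t ht).symm
  refine hint _ (hc i hi') fun t ht => ?_
  refine (abs_coeff_le (hm t ht) (hd t ht) (hs t ht) (R := R) (fun x hx => ?_) i).trans ?_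
  · refine (abs_root_le hn (hm t ht) (hd t ht) (hs t ht) (h1 t ht) hx).trans ?_
    refine Real.sqrt_le_sqrt ?_
    have := hf t ht
    linarith
  · exact Finset.single_le_sum (f := fun i => R ^ (n - i) * (n.choose i : ℝ))
      (fun i _ => by positivity) (Finset.mem_range.2 hi)

end Velocity

end Bronshtein

namespace Bronshtein

open Filter Topology

/-! ### Degenerate and low-degree cases, and the Tschirnhausen shift. -/

section Induction

/-- The second coefficient is nonpositive, so a zero of it is a maximum with vanishing derivative;
it is then at most `L (t - t₀)²` in size, and every root at most `√(2L) |t - t₀|`. -/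
theorem vel_of_coeff_eq_zero {n : ℕ} (hn : 2 ≤ n) {P : ℝ → ℝ[X]} {J : Set ℝ} (hJ : Convex ℝ J)
    {t₀ L : ℝ} (ht₀ : J ∈ 𝓝 t₀) (hL : 0 ≤ L) (hm : ∀ t ∈ J, (P t).Monic)
    (hd : ∀ t ∈ J, (P t).natDegree = n) (hs : ∀ t ∈ J, (P t).Splits)
    (h1 : ∀ t ∈ J, (P t).coeff (n - 1) = 0)
    (hdf : ∀ x ∈ J, DifferentiableAt ℝ (fun t => (P t).coeff (n - 2)) x)
    (hL' : ∀ x ∈ J, ∀ y ∈ J, |deriv (fun t => (P t).coeff (n - 2)) x -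
      deriv (fun t => (P t).coeff (n - 2)) y| ≤ L * |x - y|)
    (h0 : (P t₀).coeff (n - 2) = 0) {μ : ℝ → ℝ} (hμ : ∀ᶠ t in 𝓝 t₀, (P t).IsRoot (μ t)) :
    Vel μ t₀ √(2 * L) := by
  have hmem := mem_of_mem_nhds ht₀
  have hnp : ∀ t ∈ J, (P t).coeff (n - 2) ≤ 0 := fun t ht =>
    coeff_sub_two_nonpos hn (hm t ht) (hd t ht) (hs t ht) (h1 t ht)
  have hmax : IsLocalMax (fun t => (P t).coeff (n - 2)) t₀ := by
    filter_upwards [ht₀] with t ht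
    rw [h0]
    exact hnp t ht
  have hroot : ∀ t ∈ J, (P t).IsRoot (μ t) → |μ t| ≤ √(2 * L) * |t - t₀| := fun t ht hr => by
    have h2 := abs_sub_linear_le hJ hL hdf hL' hmem ht
    rw [hmax.deriv_eq_zero, h0, zero_mul, add_zero, sub_zero, abs_of_nonpos (hnp t ht)] at h2
    refine (abs_root_le hn (hm t ht) (hd t ht) (hs t ht) (h1 t ht) hr).trans ?_
    rw [← Real.sqrt_sq_eq_abs (t - t₀), ← Real.sqrt_mul (by positivity)]
    refine Real.sqrt_le_sqrt ?_
    linarith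
  have hz : μ t₀ = 0 := by
    have := hroot t₀ hmem hμ.self_of_nhds
    simpa using this
  filter_upwards [ht₀, hμ] with t ht hr
  rw [hz, sub_zero]
  exact hroot t ht hr

/-- Smoothness of the Tschirnhausen transform in the coefficients, seen from the binomial formula;
it lets `CBdd.comp_smooth` transfer coefficient bounds. -/
theorem contDiff_coeff_shift (n i : ℕ) {N : WithTop ℕ∞} : ContDiff ℝ N fun x : Fin n → ℝ =>
    ((monicPoly x).comp (X - C ((monicPoly x).coeff (n - 1) / n))).coeff i := by
  have h : ∀ x : Fin n → ℝ,
      ((monicPoly x).comp (X - C ((monicPoly x).coeff (n - 1) / n))).coeff i =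
      (-((monicPoly x).coeff (n - 1) / n)) ^ (n - i) * (n.choose i : ℝ) +
        ∑ j : Fin n, x j * ((-((monicPoly x).coeff (n - 1) / n)) ^ ((j : ℕ) - i) *
          ((j : ℕ).choose i : ℝ)) := fun x => by
    rw [sub_eq_add_neg, ← C_neg]
    set c := -((monicPoly x).coeff (n - 1) / n)
    simp only [monicPoly, lowPoly, add_comp, pow_comp, X_comp, Polynomial.sum_comp, mul_comp, C_comp,
      coeff_add, finsetSum_coeff, coeff_C_mul, coeff_X_add_C_pow]
  simp only [h]
  have hc : ContDiff ℝ N fun x : Fin n → ℝ => -((monicPoly x).coeff (n - 1) / n) :=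
    ((contDiff_coeff_monicPoly (n - 1)).div_const _).neg
  fun_prop

/-- The Tschirnhausen transform of a monic polynomial of degree `n`. -/
noncomputable def shift (n : ℕ) (p : ℝ[X]) : ℝ[X] := p.comp (X - C (p.coeff (n - 1) / n))

theorem monic_shift {n : ℕ} {p : ℝ[X]} (h : p.Monic) : (shift n p).Monic := h.comp_X_sub_C _

theorem natDegree_shift {n : ℕ} (p : ℝ[X]) : (shift n p).natDegree = p.natDegree := by
  rw [shift, natDegree_comp, natDegree_X_sub_C, mul_one]

/-- The shift subtracts the mean of the roots from each of them. -/
theorem coeff_shift {n : ℕ} (hn : 0 < n) {p : ℝ[X]} (hm : p.Monic) (hd : p.natDegree = n)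
    (hs : p.Splits) : (shift n p).coeff (n - 1) = 0 := by
  obtain ⟨v, hv⟩ := exists_eq_prod_of_splits hm hd hs
  have h1 := coeff_pred_prod_X_sub_C hn v
  rw [← hv] at h1
  have h2 : shift n p = ∏ i, (X - C (v i + p.coeff (n - 1) / n)) := by
    rw [shift]
    set c := p.coeff (n - 1) / n
    rw [hv, prod_comp]
    refine Finset.prod_congr rfl fun i _ => ?_
    rw [sub_comp, X_comp, C_comp, C_add]
    ring
  rw [h2, coeff_pred_prod_X_sub_C hn, Finset.sum_add_distrib, h1]
  have : (n : ℝ) ≠ 0 := by positivity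
  simp only [Finset.sum_const, Finset.card_univ, Fintype.card_fin, nsmul_eq_mul]
  field_simp
  ring

theorem PolyCurve.shift (n k : ℕ) {B : ℝ} (hB : 0 ≤ B) : ∃ B' : ℝ, 0 ≤ B' ∧
    ∀ (J : Set ℝ) (P : ℝ → ℝ[X]), IsOpen J → Convex ℝ J → PolyCurve n k B P J →
      PolyCurve n k B' (fun t => Bronshtein.shift n (P t)) J := by
  have h : ∀ i : ℕ, ∃ B' : ℝ, 0 ≤ B' ∧ ∀ (J : Set ℝ) (f : ℝ → Fin n → ℝ), IsOpen J →
      Convex ℝ J → CBdd k B f J → MapsTo f J (Metric.closedBall 0 B) →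
      CBdd k B' (fun t => (Bronshtein.shift n (monicPoly (f t))).coeff i) J := fun i =>
    CBdd.comp_smooth hB (V := univ) isOpen_univ (contDiff_coeff_shift n i).contDiffOn
      (isCompact_closedBall 0 B) (convex_closedBall 0 B) (subset_univ _)
  choose D hD0 hD using h
  refine ⟨∑ i ∈ Finset.range n, D i, Finset.sum_nonneg fun i _ => hD0 i,
    fun J P hJ hc hP => ⟨fun t ht => monic_shift (hP.monic t ht),
      fun t ht => (natDegree_shift _).trans (hP.natDegree t ht), fun i hi => ?_⟩⟩
  have hf : CBdd k B (fun t (i : Fin n) => (P t).coeff i) J :=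
    CBdd.pi hB hJ fun i => hP.coeff i i.2
  have := hD i J _ hJ hc hf fun t ht => by simpa using hf.bound t ht
  refine (this.congr hJ fun t ht => ?_).mono_const
    (Finset.single_le_sum (fun i _ => hD0 i) (Finset.mem_range.2 hi))
  rw [← eq_monicPoly (hP.monic t ht) (hP.natDegree t ht)]

theorem hasVelocityBound_zero (k : ℕ) : HasVelocityBound 0 k := fun B _ =>
  ⟨0, le_rfl, fun η P μ _ _ hP _ _ _ hr => by
    have h0 : (0 : ℝ) ∈ Ioo (-1 : ℝ) 1 := by norm_num
    have h1 := hr.self_of_nhds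
    rw [eq_one_of_monic_natDegree_zero (hP.monic 0 h0) (hP.natDegree 0 h0)] at h1
    simp [IsRoot] at h1⟩

theorem hasVelocityBound_one (k : ℕ) : HasVelocityBound 1 k := fun B hB =>
  ⟨B, hB, fun η P μ h0 h1 hP _ _ _ hr => by
    have hJ : Ioo (-1 : ℝ) 1 ∈ 𝓝 (0 : ℝ) := isOpen_Ioo.mem_nhds (by norm_num)
    have h3 : ∀ t ∈ Ioo (-1 : ℝ) 1, (P t).IsRoot (μ t) → μ t = -(P t).coeff 0 := fun t ht h => by
      have h4 := (hP.monic t ht).as_sum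
      rw [hP.natDegree t ht] at h4
      rw [h4] at h
      simp [IsRoot] at h
      linarith
    have h5 := (hP.coeff 0 one_pos).lip (convex_Ioo _ _)
    have h6 : B ≤ B * η ^ (-(((1 - (k + 1) : ℕ) : ℝ) / (k + 1))) :=
      le_mul_of_one_le_right hB (one_le_rpow_neg h0 h1 (by positivity))
    filter_upwards [hJ, hr] with t ht hrt
    rw [h3 t ht hrt, h3 0 (mem_of_mem_nhds hJ) hr.self_of_nhds]
    have h7 := h5 t ht 0 (mem_of_mem_nhds hJ)
    rw [Real.norm_eq_abs, abs_sub_comm] at h7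
    calc _ = |(P 0).coeff 0 - (P t).coeff 0| := by ring_nf
      _ ≤ _ := h7.trans (by gcongr)⟩

/-- Otherwise the interval of radius `η` around `0` would hold all roots, more than `p` of them.
This compares `η` with the size of the roots. -/
theorem exists_lt_abs_root {p : ℕ} {η : ℝ} {P : ℝ[X]} (hs : P.Splits) (h : Spread p η P)
    (hp : p < P.natDegree) : ∃ x, P.IsRoot x ∧ η < |x| := by
  by_contra! hc
  have h1 := h 0
  rw [Multiset.countP_eq_card.2 (fun x hx => by simpa using hc x (isRoot_of_mem_roots hx)),
    ← hs.natDegree_eq_card_roots] at h1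
  omega

end Induction

end Bronshtein

namespace Bronshtein

open Filter Topology

/-! ### The rescaling that closes the induction. -/

section InductionStep

theorem CLip.coeff_rescale {n k : ℕ} {L c ρ t₀ : ℝ} (hc : 0 ≤ c) (hρ : 0 ≤ ρ) {P : ℝ → ℝ[X]}
    {J : Set ℝ} (hd : ∀ t ∈ J, (P t).natDegree = n) {i : ℕ}
    (hm : ∀ s ∈ Ioo (-1 : ℝ) 1, t₀ + ρ * s ∈ J)
    (h : CLip k L (fun t => (P t).coeff i) J) :
    CLip k (c ^ (n - i) * ρ ^ (k + 1) * L) (fun s => ((P (t₀ + ρ * s)).scaleRoots c).coeff i)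
      (Ioo (-1) 1) := by
  have h1 := h.affine (c ^ (n - i)) ρ t₀ isOpen_Ioo hm
  rw [abs_of_nonneg (by positivity), abs_of_nonneg hρ] at h1
  refine h1.congr isOpen_Ioo fun s hs => ?_
  simp only [coeff_scaleRoots, hd _ (hm s hs)]
  ring

theorem CBdd.coeff_rescale {n k : ℕ} {B c ρ t₀ : ℝ} (hB : 0 ≤ B) (hc : 0 ≤ c) (hρ : 0 ≤ ρ)
    (hρ1 : ρ ≤ 1) {P : ℝ → ℝ[X]}
    {J : Set ℝ} (hd : ∀ t ∈ J, (P t).natDegree = n) {i : ℕ}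
    (hm : ∀ s ∈ Ioo (-1 : ℝ) 1, t₀ + ρ * s ∈ J)
    (h : CBdd k B (fun t => (P t).coeff i) J) :
    CBdd k (c ^ (n - i) * B) (fun s => ((P (t₀ + ρ * s)).scaleRoots c).coeff i)
      (Ioo (-1) 1) := by
  have h1 := h.affine (c ^ (n - i)) ρ t₀ (by rwa [abs_of_nonneg hρ]) hB isOpen_Ioo hm
  rw [abs_of_nonneg (by positivity)] at h1
  refine h1.congr isOpen_Ioo fun s hs => ?_
  simp only [coeff_scaleRoots, hd _ (hm s hs)]
  ring

/-- Exponents and scales in the induction step: with `e = (n - p)⁺ / p`, the number `θ ^ (1 + e)`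
has `p`-th power `θ ^ max n p`. -/
theorem rpow_one_add_pow {n p : ℕ} (hp : 0 < p) {θ : ℝ} (hθ : 0 ≤ θ) :
    (θ ^ (1 + ((n - p : ℕ) : ℝ) / p)) ^ p = θ ^ (p + (n - p)) := by
  rw [← Real.rpow_natCast (θ ^ _) p, ← Real.rpow_mul hθ, ← Real.rpow_natCast θ]
  congr 1
  have : (p : ℝ) ≠ 0 := by positivity
  push_cast
  field_simp

/-- For `n > p` some root exceeds `η` while all are at most `2h`, so `η / (2h) ≤ 1` is an admissible
new spread. For `n ≤ p` the condition is void and the exponent is `0`. -/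
theorem rescaled_spread {n p : ℕ} (hn : 2 ≤ n) {P : ℝ[X]} (hm : P.Monic) (hd : P.natDegree = n)
    (hs : P.Splits) (h1 : P.coeff (n - 1) = 0) {h η : ℝ} (hh : 0 < h)
    (h2 : P.coeff (n - 2) = -h ^ 2) (hη : 0 < η) (hsp : Spread p η P) :
    ∃ η' : ℝ, 0 < η' ∧ η' ≤ 1 ∧ Spread p η' (P.scaleRoots h⁻¹) ∧
      η' ^ (-(((n - p : ℕ) : ℝ) / p)) =
        η ^ (-(((n - p : ℕ) : ℝ) / p)) * (2 * h) ^ (((n - p : ℕ) : ℝ) / p) := by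
  rcases le_or_gt n p with hnp | hnp
  · refine ⟨1, one_pos, le_rfl, Spread.of_natDegree_le ?_, ?_⟩
    · rw [natDegree_scaleRoots, hd]; exact hnp
    · simp [Nat.sub_eq_zero_of_le hnp]
  · refine ⟨η / (2 * h), by positivity, ?_, ?_, ?_⟩
    · obtain ⟨x, hx, hηx⟩ := exists_lt_abs_root hs hsp (hd ▸ hnp)
      have h3 := abs_root_le hn hm hd hs h1 hx
      rw [h2, neg_neg] at h3
      have h4 : √(2 * h ^ 2) ≤ 2 * h := Real.sqrt_le_iff.2 ⟨by positivity, by nlinarith⟩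
      rw [div_le_one (by positivity)]
      linarith
    · refine (hsp.scaleRoots (inv_pos.2 hh)).mono ?_
      rw [← div_eq_mul_inv]
      gcongr
      linarith
    · rw [Real.div_rpow hη.le (by positivity), Real.rpow_neg (x := 2 * h) (by positivity), div_inv_eq_mul]

theorem hasVelocityBound_of_lt {n k : ℕ} (hn : 2 ≤ n) (hk : 1 ≤ k)
    (ih : ∀ m < n, HasVelocityBound m k) : HasVelocityBound n k := by
  intro B hB
  obtain ⟨B₁', hB₁', hsh⟩ := PolyCurve.shift n k hB
  -- `B₁ ≥ 1` gives `b ≥ 1` below, hence `θ = h / b ≤ h`.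
  obtain ⟨B₁, hB₁, hBB⟩ : ∃ B₁ : ℝ, 1 ≤ B₁ ∧ B₁' ≤ B₁ := ⟨max 1 B₁', le_max_left _ _, le_max_right _ _⟩
  have hB₁0 : 0 < B₁ := by linarith
  obtain ⟨C, hC, hV⟩ := velocity_of_cLip hn hk ih hB₁0.le
  set e : ℝ := ((n - (k + 1) : ℕ) : ℝ) / (k + 1) with he
  have he0 : 0 ≤ e := by positivity
  set b := √B₁ with hb
  have hb1 : 1 ≤ b := Real.one_le_sqrt.2 hB₁
  have hbsq : b ^ 2 = B₁ := Real.sq_sqrt hB₁0.le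
  set D := C * (2 ^ e * b ^ (1 + e)) + √(2 * B₁) with hD
  have hD1 : 0 ≤ C * (2 ^ e * b ^ (1 + e)) := by positivity
  have hD2 : 0 ≤ √(2 * B₁) := Real.sqrt_nonneg _
  -- The two terms of `D` cover `a₂(0) < 0` and `a₂(0) = 0` after the shift; `B / n` is the speed of
  -- the shift itself.
  refine ⟨D + B / n, by positivity, fun η P μ hη0 hη1 hP hs hsp hμ hroot => ?_⟩
  set J := Ioo (-1 : ℝ) 1 with hJ
  have h00 : (0 : ℝ) ∈ J := by rw [hJ]; norm_num
  have hJn : J ∈ 𝓝 (0 : ℝ) := isOpen_Ioo.mem_nhds h00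
  have hηe : 1 ≤ η ^ (-e) := one_le_rpow_neg hη0 hη1 he0
  set Q : ℝ → ℝ[X] := fun t => shift n (P t) with hQdef
  have hQ := hsh J P isOpen_Ioo (convex_Ioo _ _) hP
  have hQs : ∀ t ∈ J, (Q t).Splits := fun t ht => (hs t ht).comp_X_sub_C _
  have hQ1 : ∀ t ∈ J, (Q t).coeff (n - 1) = 0 := fun t ht =>
    coeff_shift (by omega) (hP.monic t ht) (hP.natDegree t ht) (hs t ht)
  have hc : CBdd k B (fun t => (P t).coeff (n - 1)) J := hP.coeff (n - 1) (by omega)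
  set ν : ℝ → ℝ := fun t => μ t + (P t).coeff (n - 1) / n with hν
  have hνroot : ∀ᶠ t in 𝓝 0, (Q t).IsRoot (ν t) := hroot.mono fun t ht => isRoot_comp_X_sub_C _ ht
  have hνc : ContinuousAt ν 0 :=
    hμ.add (((hc.continuousOn (convex_Ioo _ _)).continuousAt hJn).div_const _)
  have hQc : ∀ i < n, CBdd k B₁ (fun t => (Q t).coeff i) J := fun i hi =>
    (hQ.coeff i hi).mono_const hBB
  have hQ2 : CLip 1 B₁ (fun t => (Q t).coeff (n - 2)) J :=
    ((hQc (n - 2) (by omega)).of_le hk (convex_Ioo _ _)).cLip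
  have key : Vel ν 0 (D * η ^ (-e)) := by
    have hnp := coeff_sub_two_nonpos hn (hQ.monic 0 h00) (hQ.natDegree 0 h00) (hQs 0 h00) (hQ1 0 h00)
    rcases hnp.eq_or_lt with h0 | h0
    · refine (vel_of_coeff_eq_zero hn (convex_Ioo _ _) hJn hB₁0.le hQ.monic hQ.natDegree hQs hQ1
        hQ2.1 hQ2.2 h0 hνroot).mono ?_
      calc √(2 * B₁) ≤ D := by linarith
        _ ≤ D * η ^ (-e) := le_mul_of_one_le_right (by linarith) hηe
    · set h := √(-(Q 0).coeff (n - 2)) with hh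
      have hh0 : 0 < h := Real.sqrt_pos.2 (by linarith)
      have hhsq : h ^ 2 = -(Q 0).coeff (n - 2) := Real.sq_sqrt (by linarith)
      set θ := h / b with hθ
      have hθ0 : 0 < θ := by positivity
      have hhb : h ≤ b := by
        refine Real.sqrt_le_sqrt ?_
        have := (hQc (n - 2) (by omega)).bound 0 h00
        exact (neg_le_abs _).trans this
      have hθ1 : θ ≤ 1 := (div_le_one (by positivity)).2 hhb
      have hhinv : h⁻¹ ≤ θ⁻¹ := by
        gcongr
        exact div_le_self hh0.le hb1
      obtain ⟨η', hη'0, hη'1, hsp', hη'e⟩ := rescaled_spread (p := k + 1) hn (hQ.monic 0 h00)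
        (hQ.natDegree 0 h00) (hQs 0 h00) (hQ1 0 h00) hh0 (by linarith) hη0 (hsp.comp_X_sub_C _)
      rw [Nat.cast_add_one, ← he] at hη'e
      -- Chosen so that `ρ ^ (k + 1) = θ ^ max n (k + 1)`, which absorbs every factor `h⁻¹ ^ (n -
      -- i)` because `θ ≤ 1`.
      set ρ := θ ^ (1 + e) with hρ
      have hρ0 : 0 < ρ := by positivity
      have hρθ : ρ ≤ θ := by
        calc ρ ≤ θ ^ (1 : ℝ) := Real.rpow_le_rpow_of_exponent_ge hθ0 hθ1 (by linarith)
          _ = θ := Real.rpow_one θ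
      have hρp : ρ ^ (k + 1) = θ ^ (k + 1 + (n - (k + 1))) := by
        rw [hρ, he, ← rpow_one_add_pow (Nat.succ_pos k) hθ0.le, Nat.cast_succ]
      have hmaps : ∀ s ∈ Ioo (-1 : ℝ) 1, 0 + ρ * s ∈ J := fun s hs => by
        have : ρ ≤ 1 := hρθ.trans hθ1
        constructor <;> nlinarith [hs.1, hs.2]
      have htend := tendsto_affine 0 ρ
      have hres := hV η' (fun s => (Q (0 + ρ * s)).scaleRoots h⁻¹) (fun s => h⁻¹ * ν (0 + ρ * s))
        hη'0 hη'1 (fun s hs => (monic_scaleRoots_iff _).2 (hQ.monic _ (hmaps s hs)))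
        (fun s hs => (natDegree_scaleRoots _ _).trans (hQ.natDegree _ (hmaps s hs)))
        (fun i hi => by
          refine ((hQc i (by omega)).cLip.coeff_rescale (inv_nonneg.2 hh0.le) hρ0.le hQ.natDegree
            hmaps).mono_const (mul_le_of_le_one_left hB₁0.le ?_)
          rw [hρp]
          calc h⁻¹ ^ (n - i) * θ ^ (k + 1 + (n - (k + 1)))
              ≤ θ⁻¹ ^ (n - i) * θ ^ (n - i) := by
                refine mul_le_mul (by gcongr) ?_ (by positivity) (by positivity)
                exact pow_le_pow_of_le_one hθ0.le hθ1 (by omega)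
            _ = 1 := by rw [← mul_pow, inv_mul_cancel₀ hθ0.ne', one_pow])
        (by
          refine ((hQ2.coeff_rescale (inv_nonneg.2 hh0.le) hρ0.le hQ.natDegree
            hmaps).mono_const (mul_le_of_le_one_left hB₁0.le ?_)).2
          rw [show n - (n - 2) = 2 by omega]
          calc h⁻¹ ^ 2 * ρ ^ (1 + 1) ≤ θ⁻¹ ^ 2 * θ ^ 2 := by gcongr
            _ = 1 := by rw [← mul_pow, inv_mul_cancel₀ hθ0.ne', one_pow])
        (fun s hs => (hQs _ (hmaps s hs)).scaleRoots _)
        (fun s hs => by rw [coeff_scaleRoots, hQ1 _ (hmaps s hs), zero_mul])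
        (by
          rw [mul_zero, add_zero, coeff_scaleRoots, hQ.natDegree 0 h00, show n - (n - 2) = 2 by omega,
            inv_pow, hhsq, inv_neg, mul_neg, mul_inv_cancel₀ (show (Q 0).coeff (n - 2) ≠ 0 from h0.ne)])
        (by simpa using hsp')
        (by
          refine ContinuousAt.mul continuousAt_const (ContinuousAt.comp (g := ν) ?_ ?_)
          · simpa using hνc
          · fun_prop)
        ((htend.eventually hνroot).mono fun s hs => isRoot_scaleRoots _ hs)
      refine (hres.of_rescale (inv_pos.2 hh0) hρ0).mono ?_
      rw [hη'e]
      have e1 : (2 * h) ^ e = 2 ^ e * (θ ^ e * b ^ e) := by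
        rw [← Real.mul_rpow hθ0.le (by positivity), ← Real.mul_rpow (by norm_num) (by positivity), hθ,
          div_mul_cancel₀ _ (by positivity)]
      have e2 : h⁻¹ * ρ = b⁻¹ * θ ^ e := by
        rw [hρ, Real.rpow_add hθ0, Real.rpow_one, hθ]
        field_simp
      have e3 : b ^ (1 + e) = b * b ^ e := by rw [Real.rpow_add (by positivity), Real.rpow_one]
      -- The gain `(2 * h) ^ e` from the spread cancels the loss `θ ^ e` in the time scale, and `h`
      -- disappears.
      have e4 : C * (η ^ (-e) * (2 * h) ^ e) / (h⁻¹ * ρ) = C * (2 ^ e * b ^ (1 + e)) * η ^ (-e) := by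
        rw [e1, e2, e3]
        have : 0 < θ ^ e := by positivity
        field_simp
      rw [e4]
      gcongr
      linarith
  have hg : ∀ x ∈ J, ∀ y ∈ J, ‖-((P x).coeff (n - 1) / n) - -((P y).coeff (n - 1) / n)‖ ≤
      B / n * |x - y| := fun x hx y hy => by
    have h1 := hc.lip (convex_Ioo _ _) x hx y hy
    rw [show -((P x).coeff (n - 1) / (n : ℝ)) - -((P y).coeff (n - 1) / n) =
      -(((P x).coeff (n - 1) - (P y).coeff (n - 1)) / n) by ring, norm_neg, norm_div,
      Real.norm_natCast, div_mul_eq_mul_div]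
    gcongr
  have h3 := key.add_lip hJn hg
  have h4 : (fun t => ν t + -((P t).coeff (n - 1) / n)) = μ := by
    funext t
    simp [hν]
  rw [h4] at h3
  refine h3.mono ?_
  rw [add_mul D]
  exact add_le_add le_rfl (le_mul_of_one_le_right (by positivity) hηe)

/-- The step to degree `n ≥ 2` uses a Lipschitz derivative of the second coefficient, hence `k ≥ 1`;
for `k = 0` only degrees `0` and `1` occur. -/
theorem hasVelocityBound (n k : ℕ) (h : n ≤ 1 ∨ 1 ≤ k) : HasVelocityBound n k := by
  induction n using Nat.strong_induction_on with
  | _ n ih =>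
    rcases Nat.lt_or_ge n 2 with hn | hn
    · interval_cases n
      · exact hasVelocityBound_zero k
      · exact hasVelocityBound_one k
    · exact hasVelocityBound_of_lt hn (by omega) fun m hm => ih m hm (by omega)

end InductionStep

end Bronshtein

namespace Bronshtein

open Filter Topology

/-! ### From speeds to Lipschitz constants, and from the stated norms to `CLip` and `CBdd`. -/

section Bridge

theorem Vel.continuousAt {μ : ℝ → ℝ} {t₀ C : ℝ} (h : Vel μ t₀ C) : ContinuousAt μ t₀ := by
  rw [ContinuousAt, tendsto_iff_norm_sub_tendsto_zero]
  have hc : Continuous fun t : ℝ => C * |t - t₀| := by fun_prop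
  have ht : Tendsto (fun t : ℝ => C * |t - t₀|) (𝓝 t₀) (𝓝 0) := by simpa using hc.tendsto t₀
  exact squeeze_zero' (Eventually.of_forall fun _ => norm_nonneg _) h ht

/-- A function with speed at most `L` at all points of an interval is Lipschitz with constant `L`. -/
theorem abs_sub_le_of_vel {f : ℝ → ℝ} {L : ℝ} {J : Set ℝ} (hJ : J.OrdConnected)
    (h : ∀ t ∈ J, Vel f t L) : ∀ x ∈ J, ∀ y ∈ J, |f x - f y| ≤ L * |x - y| := by
  have key : ∀ x ∈ J, ∀ y ∈ J, x ≤ y → |f y - f x| ≤ L * (y - x) := by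
    intro x hx y hy hxy
    have hsub : Icc x y ⊆ J := hJ.out hx hy
    refine le_of_forall_pos_le_add fun ε hε => ?_
    -- The comparison theorem needs a strict slope inequality, so it is run with slope `L + δ`.
    obtain ⟨δ, hδ, hδε⟩ : ∃ δ : ℝ, 0 < δ ∧ δ * (y - x) ≤ ε := by
      refine ⟨ε / (y - x + 1), div_pos hε (by linarith), ?_⟩
      rw [div_mul_eq_mul_div, div_le_iff₀ (by linarith)]
      nlinarith
    have := image_norm_le_of_liminf_right_slope_norm_lt_deriv_boundary (a := x) (b := y)
      (f := fun t => f t - f x) (f' := fun _ => L) (B := fun t => (L + δ) * (t - x))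
      (B' := fun _ => L + δ)
      (fun t ht => ((h t (hsub ht)).continuousAt.sub continuousAt_const).continuousWithinAt)
      (fun t ht r hr => by
        refine Eventually.frequently ?_
        filter_upwards [(h t (hsub ⟨ht.1, ht.2.le⟩)).filter_mono nhdsWithin_le_nhds,
          self_mem_nhdsWithin] with z hz hzt
        rw [mem_Ioi] at hzt
        rw [slope_def_field, div_lt_iff₀ (by linarith)]
        have h1 : ‖f z - f x‖ - ‖f t - f x‖ ≤ |f z - f t| := by
          have := norm_sub_norm_le (f z - f x) (f t - f x)
          rwa [sub_sub_sub_cancel_right, Real.norm_eq_abs (f z - f t)] at this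
        rw [abs_of_pos (by linarith : 0 < z - t)] at hz
        simp only [Function.comp]
        nlinarith)
      (by simp) (by fun_prop)
      (fun t _ => by
        simpa using (((hasDerivAt_id t).sub_const x).const_mul (L + δ)).hasDerivWithinAt)
      (fun t _ _ => by linarith) (right_mem_Icc.2 hxy)
    rw [Real.norm_eq_abs] at this
    nlinarith
  intro x hx y hy
  rcases le_total x y with hxy | hxy
  · rw [abs_sub_comm (f x), abs_sub_comm x, abs_of_nonneg (by linarith : 0 ≤ y - x)]
    exact key x hx y hy hxy
  · rw [abs_of_nonneg (by linarith : 0 ≤ x - y)]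
    exact key y hy x hx hxy

theorem lipConst_le_iff {f : ℝ → ℝ} {K : Set ℝ} {L : ℝ} (hL : 0 ≤ L) :
    lipConst f K ≤ ENNReal.ofReal L ↔ ∀ x ∈ K, ∀ y ∈ K, |f x - f y| ≤ L * |x - y| := by
  simp only [lipConst, iSup_le_iff]
  refine forall₂_congr fun x _ => forall₂_congr fun y _ => ?_
  constructor
  · intro h
    rcases eq_or_ne x y with rfl | hxy
    · simp
    · have h1 := (ENNReal.ofReal_le_ofReal_iff hL).1 (h hxy)
      rwa [div_le_iff₀ (abs_pos.2 (sub_ne_zero.2 hxy))] at h1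
  · intro h hxy
    refine ENNReal.ofReal_le_ofReal ?_
    rwa [div_le_iff₀ (abs_pos.2 (sub_ne_zero.2 hxy))]

theorem supNorm_le_iff {f : ℝ → ℝ} {K : Set ℝ} {L : ℝ} (hL : 0 ≤ L) :
    supNorm f K ≤ ENNReal.ofReal L ↔ ∀ x ∈ K, |f x| ≤ L := by
  simp only [supNorm, iSup_le_iff]
  exact forall₂_congr fun x _ => ENNReal.ofReal_le_ofReal_iff hL

theorem differentiableAt_of_contDiffOn_succ {k : ℕ} {f : ℝ → ℝ} {J : Set ℝ} (hJ : IsOpen J)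
    (hf : ContDiffOn ℝ (k + 1 : ℕ) f J) : ∀ x ∈ J, DifferentiableAt ℝ f x := fun x hx =>
  (hf.contDiffAt (hJ.mem_nhds hx)).differentiableAt (by norm_num)

theorem contDiffOn_deriv_of_succ {k : ℕ} {f : ℝ → ℝ} {J : Set ℝ} (hJ : IsOpen J)
    (hf : ContDiffOn ℝ (k + 1 : ℕ) f J) : ContDiffOn ℝ k (deriv f) J :=
  hf.deriv_of_isOpen hJ (by norm_cast)

theorem cLip_of_iteratedDeriv {k : ℕ} {L : ℝ} {f : ℝ → ℝ} {J : Set ℝ} (hJ : IsOpen J)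
    (hf : ContDiffOn ℝ k f J)
    (hL : ∀ x ∈ J, ∀ y ∈ J, |iteratedDeriv k f x - iteratedDeriv k f y| ≤ L * |x - y|) :
    CLip k L f J := by
  induction k generalizing f with
  | zero => simpa [CLip] using hL
  | succ k ih =>
    refine ⟨differentiableAt_of_contDiffOn_succ hJ hf, ih (contDiffOn_deriv_of_succ hJ hf) ?_⟩
    simpa [iteratedDeriv_succ'] using hL

theorem cBdd_of_iteratedDeriv {k : ℕ} {B : ℝ} {f : ℝ → ℝ} {J : Set ℝ} (hJ : IsOpen J)
    (hf : ContDiffOn ℝ k f J) (hB : ∀ j ≤ k, ∀ x ∈ J, |iteratedDeriv j f x| ≤ B)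
    (hL : ∀ x ∈ J, ∀ y ∈ J, |iteratedDeriv k f x - iteratedDeriv k f y| ≤ B * |x - y|) :
    CBdd k B f J := by
  induction k generalizing f with
  | zero => exact ⟨by simpa using hB 0 le_rfl, by simpa using hL⟩
  | succ k ih =>
    refine ⟨by simpa using hB 0 (by omega), differentiableAt_of_contDiffOn_succ hJ hf,
      ih (contDiffOn_deriv_of_succ hJ hf) (fun j hj => ?_) ?_⟩
    · simpa [iteratedDeriv_succ'] using hB (j + 1) (by omega)
    · simpa [iteratedDeriv_succ'] using hL

theorem CBdd.contDiffOn {k : ℕ} {B : ℝ} {f : ℝ → ℝ} {J : Set ℝ} (hJ : IsOpen J) (hc : Convex ℝ J)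
    (h : CBdd k B f J) : ContDiffOn ℝ k f J := by
  induction k generalizing f with
  | zero => exact contDiffOn_zero.2 (h.continuousOn hc)
  | succ k ih =>
    rw [Nat.cast_succ, contDiffOn_succ_iff_deriv_of_isOpen hJ]
    exact ⟨fun x hx => (h.2.1 x hx).differentiableWithinAt, by simp, ih h.2.2⟩

theorem CLip.iteratedDeriv {k : ℕ} {B : ℝ} {f : ℝ → ℝ} {J : Set ℝ} (h : CLip k B f J) :
    ∀ x ∈ J, ∀ y ∈ J, |iteratedDeriv k f x - iteratedDeriv k f y| ≤ B * |x - y| := by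
  induction k generalizing f with
  | zero => simpa [CLip] using h
  | succ k ih =>
    rw [iteratedDeriv_succ']
    exact ih h.2

theorem Ioo_sub_add_mem_nhds {t ε : ℝ} (hε : 0 < ε) : Ioo (t - ε) (t + ε) ∈ 𝓝 t :=
  isOpen_Ioo.mem_nhds ⟨by linarith, by linarith⟩

theorem exists_Ioo_subset {s : Set ℝ} {t : ℝ} (hs : s ∈ 𝓝 t) :
    ∃ ε : ℝ, 0 < ε ∧ Ioo (t - ε) (t + ε) ⊆ s := by
  obtain ⟨ε, hε, h⟩ := Metric.mem_nhds_iff.1 hs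
  exact ⟨ε, hε, by rwa [Real.ball_eq_Ioo] at h⟩

/-- On small intervals, functions of class `C^{k,1}` have bounded derivatives. -/
theorem IsCLip.exists_cBdd {p : ℕ} {f : ℝ → ℝ} {I : Set ℝ} (hI : IsOpen I) (h : IsCLip p f I)
    {t : ℝ} (ht : t ∈ I) : ∃ B : ℝ, 0 ≤ B ∧ ∃ ε : ℝ, 0 < ε ∧ Ioo (t - ε) (t + ε) ⊆ I ∧
      CBdd (p - 1) B f (Ioo (t - ε) (t + ε)) := by
  obtain ⟨K, s, hs, hK⟩ := h.2 ht
  rw [hI.nhdsWithin_eq ht] at hs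
  have hb : ∀ j ∈ Finset.range (p - 1 + 1), ∀ᶠ x in 𝓝 t,
      |iteratedDeriv j f x| < |iteratedDeriv j f t| + 1 := fun j hj => by
    have hc : ContinuousAt (iteratedDeriv j f) t := by
      have := (h.1.continuousOn_iteratedDerivWithin (m := j)
        (by exact_mod_cast Nat.lt_succ_iff.1 (Finset.mem_range.1 hj)) hI.uniqueDiffOn)
      exact (this.congr fun x hx =>
        (iteratedDerivWithin_of_isOpen hI hx).symm).continuousAt (hI.mem_nhds ht)
    exact hc.abs.eventually_lt continuousAt_const (by linarith)
  have hall := (Filter.eventually_all_finset _).2 hb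
  obtain ⟨ε, hε, hsub⟩ := exists_Ioo_subset (inter_mem (inter_mem hs (hI.mem_nhds ht)) hall)
  set B := K + ∑ j ∈ Finset.range (p - 1 + 1), (|iteratedDeriv j f t| + 1) with hB
  have hB1 : 0 ≤ ∑ j ∈ Finset.range (p - 1 + 1), (|iteratedDeriv j f t| + 1) :=
    Finset.sum_nonneg fun j _ => by positivity
  refine ⟨B, by positivity, ε, hε, fun x hx => (hsub hx).1.2,
    cBdd_of_iteratedDeriv isOpen_Ioo (h.1.mono fun x hx => (hsub hx).1.2) (fun j hj x hx => ?_)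
      fun x hx y hy => ?_⟩
  · have hj' : j ∈ Finset.range (p - 1 + 1) := Finset.mem_range.2 (by omega)
    have h1 : |iteratedDeriv j f x| < |iteratedDeriv j f t| + 1 := (hsub hx).2 j hj'
    have h2 := Finset.single_le_sum (f := fun j => |iteratedDeriv j f t| + 1)
      (fun j _ => by positivity) hj'
    have h3 : (0 : ℝ) ≤ K := K.2
    linarith
  · have h1 := hK.dist_le_mul x (hsub hx).1.1 y (hsub hy).1.1
    rw [Real.dist_eq, Real.dist_eq] at h1
    refine h1.trans ?_
    gcongr
    linarith

theorem isCLip_of_cBdd {p : ℕ} {f : ℝ → ℝ} {I : Set ℝ}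
    (h : ∀ t ∈ I, ∃ B : ℝ, ∃ ε : ℝ, 0 < ε ∧ CBdd (p - 1) B f (Ioo (t - ε) (t + ε))) :
    IsCLip p f I := by
  refine ⟨fun t ht => ?_, fun t ht => ?_⟩
  · obtain ⟨B, ε, hε, hB⟩ := h t ht
    exact ((hB.contDiffOn isOpen_Ioo (convex_Ioo _ _)).contDiffAt
      (Ioo_sub_add_mem_nhds hε)).contDiffWithinAt
  · obtain ⟨B, ε, hε, hB⟩ := h t ht
    refine ⟨B.toNNReal, _, mem_nhdsWithin_of_mem_nhds (Ioo_sub_add_mem_nhds hε),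
      LipschitzOnWith.of_dist_le_mul fun x hx y hy => ?_⟩
    rw [Real.dist_eq, Real.dist_eq]
    refine (hB.cLip.iteratedDeriv x hx y hy).trans ?_
    gcongr
    exact Real.le_coe_toNNReal B

theorem cBdd_of_cLipNorm_le {p : ℕ} (hp : 1 ≤ p) {f : ℝ → ℝ} {I J K : Set ℝ} (h : IsCLip p f I)
    (hJ : IsOpen J) (hJI : J ⊆ I) (hJK : J ⊆ K) {B : ℝ} (hB : 0 ≤ B)
    (hn : cLipNorm p f K ≤ ENNReal.ofReal B) : CBdd (p - 1) B f J := by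
  refine cBdd_of_iteratedDeriv hJ (h.1.mono hJI) (fun j hj x hx => ?_) fun x hx y hy => ?_
  · have h1 : supNorm (iteratedDeriv j f) K ≤ ENNReal.ofReal B := by
      refine le_trans ?_ ((le_self_add : _ ≤ cLipNorm p f K).trans hn)
      exact le_iSup₂_of_le (f := fun k (_ : k ∈ Finset.range p) => supNorm (iteratedDeriv k f) K)
        j (Finset.mem_range.2 (by omega)) le_rfl
    exact (supNorm_le_iff hB).1 h1 x (hJK hx)
  · have h1 : lipConst (iteratedDeriv (p - 1) f) K ≤ ENNReal.ofReal B :=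
      (le_add_self : _ ≤ cLipNorm p f K).trans hn
    exact (lipConst_le_iff hB).1 h1 x (hJK hx) y (hJK hy)

theorem poly_eq_monicPoly (n : ℕ) (a : ℕ → ℝ → ℝ) (t : ℝ) :
    poly n a t = monicPoly fun i : Fin n => a (n - i) t := by
  rw [poly, monicPoly, lowPoly, Fin.sum_univ_eq_sum_range (fun i => C (a (n - i) t) * X ^ i) n]
  congr 1
  refine Finset.sum_bij' (fun j _ => n - j) (fun i _ => n - i) ?_ ?_ ?_ ?_ ?_
  · intro j hj; rw [Finset.mem_Icc] at hj; rw [Finset.mem_range]; omega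
  · intro j hj; rw [Finset.mem_range] at hj; rw [Finset.mem_Icc]; omega
  · intro j hj; rw [Finset.mem_Icc] at hj; omega
  · intro j hj; rw [Finset.mem_range] at hj; omega
  · intro j hj
    rw [Finset.mem_Icc] at hj
    rw [Nat.sub_sub_self hj.2]

theorem monic_poly (n : ℕ) (a : ℕ → ℝ → ℝ) (t : ℝ) : (poly n a t).Monic := by
  rw [poly_eq_monicPoly]; exact monic_monicPoly _

theorem natDegree_poly (n : ℕ) (a : ℕ → ℝ → ℝ) (t : ℝ) : (poly n a t).natDegree = n := by
  rw [poly_eq_monicPoly]; exact natDegree_monicPoly _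

theorem coeff_poly {n : ℕ} (a : ℕ → ℝ → ℝ) (t : ℝ) {i : ℕ} (hi : i < n) :
    (poly n a t).coeff i = a (n - i) t := by
  rw [poly_eq_monicPoly, coeff_monicPoly, dif_pos hi]

theorem Hyperbolic.splits {P : ℝ[X]} (h : Hyperbolic P) : P.Splits := by
  refine Splits.of_splits_map (algebraMap ℝ ℂ) (IsAlgClosed.splits _) fun z hz => ?_
  have h1 := isRoot_of_mem_roots hz
  rw [IsRoot, eval_map_algebraMap] at h1
  exact ⟨z.re, Complex.ext (by simp) (by simp [h z h1])⟩

theorem IsHyperbolicCurve.splits {p n : ℕ} {a : ℕ → ℝ → ℝ} {I : Set ℝ}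
    (h : IsHyperbolicCurve p n a I) {t : ℝ} (ht : t ∈ I) : (poly n a t).Splits :=
  (h.hyperbolic t ht).splits

theorem polyCurve_poly {n k : ℕ} {B : ℝ} {a : ℕ → ℝ → ℝ} {J : Set ℝ}
    (h : ∀ j ∈ Finset.Icc 1 n, CBdd k B (a j) J) : PolyCurve n k B (poly n a) J :=
  ⟨fun t _ => monic_poly n a t, fun t _ => natDegree_poly n a t, fun i hi => by
    simp only [coeff_poly a _ hi]
    exact h (n - i) (Finset.mem_Icc.2 (by omega))⟩

theorem IsHyperbolicCurve.exists_polyCurve {p n : ℕ} {a : ℕ → ℝ → ℝ} {I : Set ℝ} (hI : IsOpen I)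
    (h : IsHyperbolicCurve p n a I) {t : ℝ} (ht : t ∈ I) : ∃ B : ℝ, 0 ≤ B ∧ ∃ ε : ℝ, 0 < ε ∧
      Ioo (t - ε) (t + ε) ⊆ I ∧ PolyCurve n (p - 1) B (poly n a) (Ioo (t - ε) (t + ε)) := by
  have h1 : ∀ j : ℕ, ∃ B : ℝ, 0 ≤ B ∧ ∃ ε : ℝ, 0 < ε ∧ (j ∈ Finset.Icc 1 n →
      CBdd (p - 1) B (a j) (Ioo (t - ε) (t + ε))) := fun j => by
    by_cases hj : j ∈ Finset.Icc 1 n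
    · obtain ⟨B, hB, ε, hε, -, h2⟩ := (h.isCLip j hj).exists_cBdd hI ht
      exact ⟨B, hB, ε, hε, fun _ => h2⟩
    · exact ⟨0, le_rfl, 1, one_pos, fun h => absurd h hj⟩
  choose B hB ε hε h2 using h1
  have h3 : ∀ j ∈ Finset.Icc 1 n, Ioo (t - ε j) (t + ε j) ∈ 𝓝 t :=
    fun j _ => Ioo_sub_add_mem_nhds (hε j)
  obtain ⟨δ, hδ, hsub⟩ := exists_Ioo_subset (inter_mem (hI.mem_nhds ht)
    ((Filter.biInter_finset_mem _).2 h3))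
  refine ⟨∑ j ∈ Finset.Icc 1 n, B j, Finset.sum_nonneg fun j _ => hB j, δ, hδ,
    fun x hx => (hsub hx).1, polyCurve_poly fun j hj => ?_⟩
  refine ((h2 j hj).mono_set fun x hx => ?_).mono_const (Finset.single_le_sum (fun j _ => hB j) hj)
  exact mem_iInter₂.1 (hsub hx).2 j hj

end Bridge

end Bronshtein

namespace Bronshtein

open Filter Topology

/-! ### The Tschirnhausen form is again a hyperbolic curve of the same class. -/

section Tschirnhausen

theorem poly_tschirnhausen {n : ℕ} (hn : 1 ≤ n) (a : ℕ → ℝ → ℝ) (t : ℝ) :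
    poly n (tschirnhausen n a) t = shift n (poly n a t) := by
  have h := eq_monicPoly (monic_shift (n := n) (monic_poly n a t))
    ((natDegree_shift (n := n) _).trans (natDegree_poly n a t))
  rw [h, poly_eq_monicPoly n (tschirnhausen n a)]
  congr 1
  funext i
  have hi := i.2
  rw [tschirnhausen, shift, coeff_poly a t (by omega : n - 1 < n), Nat.sub_sub_self hn,
    Nat.sub_sub_self hi.le]

theorem isHyperbolicCurve_tschirnhausen {p n : ℕ} (hn : 1 ≤ n) {a : ℕ → ℝ → ℝ} {I : Set ℝ}
    (hI : IsOpen I) (h : IsHyperbolicCurve p n a I) :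
    IsHyperbolicCurve p n (tschirnhausen n a) I := by
  refine ⟨fun j hj => isCLip_of_cBdd fun t ht => ?_, fun t ht z hz => ?_⟩
  · obtain ⟨B, hB, ε, hε, -, hP⟩ := h.exists_polyCurve hI ht
    obtain ⟨B', -, hsh⟩ := PolyCurve.shift n (p - 1) hB
    rw [Finset.mem_Icc] at hj
    refine ⟨B', ε, hε, ((hsh _ _ isOpen_Ioo (convex_Ioo _ _) hP).coeff (n - j) (by omega)).congr
      isOpen_Ioo fun s _ => ?_⟩
    rw [← poly_tschirnhausen hn, coeff_poly _ _ (by omega), Nat.sub_sub_self hj.2]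
  · rw [poly_tschirnhausen hn, shift, aeval_comp] at hz
    have := h.hyperbolic t ht _ hz
    simpa using this

theorem tschirnhausen_one {p n : ℕ} (hn : 1 ≤ n) {a : ℕ → ℝ → ℝ} {I : Set ℝ}
    (h : IsHyperbolicCurve p n a I) {t : ℝ} (ht : t ∈ I) :
    (poly n (tschirnhausen n a) t).coeff (n - 1) = 0 := by
  rw [poly_tschirnhausen hn]
  exact coeff_shift hn (monic_poly n a t) (natDegree_poly n a t) (h.splits ht)

end Tschirnhausen

/-! ### Local Lipschitz continuity, and the uniform bound for `p = n`. -/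

section Uniform

theorem mapsTo_rescale {t₀ ρ : ℝ} (hρ : 0 < ρ) :
    ∀ s ∈ Ioo (-1 : ℝ) 1, t₀ + ρ * s ∈ Ioo (t₀ - ρ) (t₀ + ρ) := fun s hs => by
  constructor <;> nlinarith [hs.1, hs.2]

theorem continuousAt_rescale {μ : ℝ → ℝ} {t₀ : ℝ} (c ρ : ℝ) (h : ContinuousAt μ t₀) :
    ContinuousAt (fun s => c * μ (t₀ + ρ * s)) 0 := by
  refine ContinuousAt.mul continuousAt_const (ContinuousAt.comp (g := μ) ?_ ?_)
  · simpa using h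
  · fun_prop

/-- The speed of the roots of a curve of degree at most `k + 1`, on all scales. -/
theorem exists_vel_bound {n k : ℕ} (hnk : n ≤ k + 1) {B : ℝ} (hB : 0 ≤ B) :
    ∃ C : ℝ, 0 ≤ C ∧ ∀ (P : ℝ → ℝ[X]) (μ : ℝ → ℝ) (t₀ h ρ : ℝ), 0 < h → 0 < ρ → ρ ≤ 1 →
      (∀ t ∈ Ioo (t₀ - ρ) (t₀ + ρ), (P t).Monic) →
      (∀ t ∈ Ioo (t₀ - ρ) (t₀ + ρ), (P t).natDegree = n) →
      (∀ t ∈ Ioo (t₀ - ρ) (t₀ + ρ), (P t).Splits) →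
      (∀ i < n, CBdd k (B * h ^ (n - i)) (fun t => (P t).coeff i) (Ioo (t₀ - ρ) (t₀ + ρ))) →
      ContinuousAt μ t₀ → (∀ᶠ t in 𝓝 t₀, (P t).IsRoot (μ t)) → Vel μ t₀ (C * h / ρ) := by
  obtain ⟨C, hC, hV⟩ := hasVelocityBound n k (by omega) B hB
  refine ⟨C, hC, fun P μ t₀ h ρ hh hρ hρ1 hm hd hs hc hμ hr => ?_⟩
  have hmaps := mapsTo_rescale (t₀ := t₀) hρ
  have h0 : t₀ ∈ Ioo (t₀ - ρ) (t₀ + ρ) := ⟨by linarith, by linarith⟩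
  -- In degree at most `k + 1` every polynomial satisfies the spread condition, so `η = 1` may be
  -- used.
  have h1 := hV 1 (fun s => (P (t₀ + ρ * s)).scaleRoots h⁻¹) (fun s => h⁻¹ * μ (t₀ + ρ * s)) one_pos
    le_rfl ⟨fun s hs => (monic_scaleRoots_iff _).2 (hm _ (hmaps s hs)),
      fun s hs => (natDegree_scaleRoots _ _).trans (hd _ (hmaps s hs)), fun i hi => by
        refine ((hc i hi).coeff_rescale (by positivity) (inv_nonneg.2 hh.le) hρ.le hρ1 hd
          hmaps).mono_const (le_of_eq ?_)
        rw [inv_pow]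
        field_simp⟩
    (fun s hs' => (hs _ (hmaps s hs')).scaleRoots _)
    (Spread.of_natDegree_le (by
      rw [natDegree_scaleRoots, mul_zero, add_zero, hd _ h0]; exact hnk))
    (continuousAt_rescale _ _ hμ)
    (((tendsto_affine t₀ ρ).eventually hr).mono fun s hs => isRoot_scaleRoots _ hs)
  rw [Real.one_rpow, mul_one] at h1
  refine (h1.of_rescale (inv_pos.2 hh) hρ).mono (le_of_eq ?_)
  field_simp

/-- Near `t₀` the power `(X - x) ^ m` at the root `x = r t₀` continues to a factor of degree `m ≤ p`
carrying `r`; for it, `exists_vel_bound` applies at all nearby times with one constant. -/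
theorem locallyLipschitzOn_root {n p : ℕ} {I : Set ℝ} {a : ℕ → ℝ → ℝ} {r : ℝ → ℝ} (hp : 1 ≤ p)
    (hI : IsOpen I) (ha : IsHyperbolicCurve p n a I)
    (hmul : ∀ t ∈ I, ∀ x : ℝ, (poly n a t).rootMultiplicity x ≤ p)
    (hr : IsContinuousRoot n a I r) : LocallyLipschitzOn I r := by
  intro t₀ ht₀
  obtain ⟨B, hB, ε', hε', hεI', hP'⟩ := ha.exists_polyCurve hI ht₀
  obtain ⟨ε, hε, hεI, hε1, hP⟩ : ∃ ε : ℝ, 0 < ε ∧ Ioo (t₀ - ε) (t₀ + ε) ⊆ I ∧ ε ≤ 1 ∧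
      PolyCurve n (p - 1) B (poly n a) (Ioo (t₀ - ε) (t₀ + ε)) := by
    have hsub : Ioo (t₀ - min ε' 1) (t₀ + min ε' 1) ⊆ Ioo (t₀ - ε') (t₀ + ε') :=
      Ioo_subset_Ioo (by linarith [min_le_left ε' 1]) (by linarith [min_le_left ε' 1])
    exact ⟨min ε' 1, by positivity, hsub.trans hεI', min_le_right _ _, hP'.mono_set hsub⟩
  set x := r t₀ with hx
  have hroot : ∀ t ∈ I, (poly n a t).IsRoot (r t) := hr.isRoot
  have hcont : ∀ t ∈ I, ContinuousAt r t := fun t ht => hr.continuousOn.continuousAt (hI.mem_nhds ht)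
  set m := (poly n a t₀).rootMultiplicity x with hm
  have hne : poly n a t₀ ≠ 0 := (monic_poly n a t₀).ne_zero
  obtain ⟨R, hR, hRx⟩ := exists_eq_pow_rootMultiplicity_mul_and_not_dvd _ hne x
  rw [← hm] at hR
  have hQm : ((X - C x) ^ m).Monic := (monic_X_sub_C x).pow m
  have hRm : R.Monic := hQm.of_mul_monic_left (hR ▸ monic_poly n a t₀)
  have hQd : ((X - C x) ^ m).natDegree = m := by rw [natDegree_pow, natDegree_X_sub_C, mul_one]
  obtain ⟨l, hl⟩ : ∃ l, R.natDegree = l := ⟨_, rfl⟩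
  have hml : m + l = n := by
    have := congrArg natDegree hR
    rw [natDegree_poly, hQm.natDegree_mul hRm, hQd, hl] at this
    exact this.symm
  have hRx' : R.eval x ≠ 0 := fun h => hRx (dvd_iff_isRoot.2 h)
  have hcop : IsCoprime ((X - C x) ^ m) R :=
    IsCoprime.pow_left ((irreducible_X_sub_C x).coprime_iff_not_dvd.2 hRx)
  have hQe := eq_monicPoly hQm hQd
  have hRe := eq_monicPoly hRm hl
  obtain ⟨U, hU, W, hW, ρ, hρ0, hρ1, B', hB', hfac⟩ := exists_local_factor
    (z₀ := (fun i : Fin m => ((X - C x) ^ m).coeff i, fun i : Fin l => R.coeff i))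
    (by rw [← hQe, ← hRe]; exact hcop) (x₀ := x) (by rw [← hRe]; exact hRx') (p - 1) hB
  have hmaps := mapsTo_rescale (t₀ := t₀) hε
  obtain ⟨Q, hQ, hQdvd, hQr⟩ := hfac _ (mem_of_mem_nhds hU) (fun s => poly n a (t₀ + ε * s))
    (by
      rw [hml]
      refine ⟨fun s _ => monic_poly _ _ _, fun s _ => natDegree_poly _ _ _, fun i hi => ?_⟩
      have := (hP.coeff i hi).affine 1 ε t₀ (by rwa [abs_of_pos hε]) hB isOpen_Ioo hmaps
      simpa using this)
    (by rw [mul_zero, add_zero, ← hQe, ← hRe]; exact hR) (fun s => 1 * r (t₀ + ε * s))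
    (continuousAt_rescale 1 ε (hcont t₀ ht₀))
    (by simpa using mem_of_mem_nhds hW)
    (((tendsto_affine t₀ ε).eventually (hI.mem_nhds ht₀)).mono fun s hs => by
      simpa using hroot _ hs)
  have hmp : m ≤ p - 1 + 1 := by
    have := hmul t₀ ht₀ x
    omega
  obtain ⟨D, hD, hV⟩ := exists_vel_bound hmp hB'
  -- The factor must carry the root near every time `s` close to `0`, not only near `0`.
  obtain ⟨δ, hδ, hδs⟩ := exists_Ioo_subset
    (inter_mem (eventually_eventually_nhds.2 hQr) (isOpen_Ioo.mem_nhds (by simp [hρ0]) : Ioo (-ρ) ρ ∈ 𝓝 0))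
  set σ := min (δ / 2) (ρ / 2) with hσ
  have hσ0 : 0 < σ := by positivity
  have hσρ : σ ≤ ρ / 2 := min_le_right _ _
  have hσδ : σ ≤ δ / 2 := min_le_left _ _
  have hvel : ∀ s ∈ Ioo (-σ) σ, Vel (fun s => 1 * r (t₀ + ε * s)) s (D * 1 / (ρ / 2)) := fun s hs => by
    have hsub : Ioo (s - ρ / 2) (s + ρ / 2) ⊆ Ioo (-ρ) ρ :=
      Ioo_subset_Ioo (by linarith [hs.1]) (by linarith [hs.2])
    have hsub1 : Ioo (-ρ) ρ ⊆ Ioo (-1 : ℝ) 1 := Ioo_subset_Ioo (by linarith) hρ1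
    refine hV Q _ s 1 (ρ / 2) one_pos (by linarith) (by linarith) (fun t ht => hQ.monic t (hsub ht))
      (fun t ht => hQ.natDegree t (hsub ht)) (fun t ht => ?_) (fun i hi => ?_) ?_ ?_
    · exact (ha.splits (hεI (hmaps t (hsub1 (hsub ht))))).of_dvd (monic_poly _ _ _).ne_zero
        (hQdvd t (hsub ht))
    · rw [one_pow, mul_one]
      exact (hQ.coeff i hi).mono_set hsub
    · have hsI : t₀ + ε * s ∈ I :=
        hεI (hmaps s (hsub1 ⟨by linarith [hs.1], by linarith [hs.2]⟩))
      exact ContinuousAt.mul continuousAt_const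
        (ContinuousAt.comp (g := r) (hcont _ hsI) (by fun_prop))
    · exact (hδs ⟨by linarith [hs.1], by linarith [hs.2]⟩).1
  have hlip := abs_sub_le_of_vel ordConnected_Ioo hvel
  set E := D * 1 / (ρ / 2) with hE
  refine ⟨(E / ε).toNNReal, Ioo (t₀ - ε * σ) (t₀ + ε * σ),
    mem_nhdsWithin_of_mem_nhds (Ioo_sub_add_mem_nhds (by positivity)),
    LipschitzOnWith.of_dist_le_mul fun u hu v hv => ?_⟩
  have hmem : ∀ u ∈ Ioo (t₀ - ε * σ) (t₀ + ε * σ), (u - t₀) / ε ∈ Ioo (-σ) σ := fun u hu => by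
    constructor
    · rw [lt_div_iff₀ hε]; linarith [hu.1]
    · rw [div_lt_iff₀ hε]; linarith [hu.2]
  have h1 := hlip _ (hmem u hu) _ (hmem v hv)
  have e1 : ∀ u, t₀ + ε * ((u - t₀) / ε) = u := fun u => by field_simp; ring
  rw [one_mul, one_mul, e1, e1, ← sub_div, sub_sub_sub_cancel_right, abs_div, abs_of_pos hε] at h1
  rw [Real.dist_eq, Real.dist_eq, Real.coe_toNNReal _ (by positivity)]
  calc |r u - r v| ≤ E * (|u - v| / ε) := h1
    _ = E / ε * |u - v| := by ring

/-- Passing from finite positive bounds to bounds in `[0, ∞]`. -/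
theorem le_mul_of_forall_ofReal {x y : ℝ≥0∞} {C : ℝ} (hC : 0 < C)
    (h : ∀ s : ℝ, 0 < s → y ≤ ENNReal.ofReal s → x ≤ ENNReal.ofReal (C * s)) :
    x ≤ (C.toNNReal : ℝ≥0∞) * y := by
  rw [← ENNReal.ofReal]
  rcases eq_or_ne y ∞ with rfl | hy
  · rw [ENNReal.mul_top (by simpa using hC)]
    exact le_top
  · refine ENNReal.le_of_forall_pos_le_add fun ε hε _ => ?_
    -- The padding `ε / C` keeps the test value positive even when `y = 0`.
    have h1 := h (y.toReal + ε / C) (by positivity) (by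
      rw [ENNReal.ofReal_add (by positivity) (by positivity), ENNReal.ofReal_toReal hy]
      exact le_self_add)
    refine h1.trans (le_of_eq ?_)
    rw [mul_add, ENNReal.ofReal_add (by positivity) (by positivity), ENNReal.ofReal_mul hC.le,
      ENNReal.ofReal_toReal hy, mul_div_cancel₀ _ hC.ne', ENNReal.ofReal_coe_nnreal]

theorem rpow_le_one_add {x : ℝ≥0∞} {s : ℝ} (h0 : 0 ≤ s) (h1 : s ≤ 1) : x ^ s ≤ 1 + x := by
  rcases le_total x 1 with hx | hx
  · exact (ENNReal.rpow_le_one hx h0).trans le_self_add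
  · calc x ^ s ≤ x ^ (1 : ℝ) := ENNReal.rpow_le_rpow_of_exponent_le hx h1
      _ = x := ENNReal.rpow_one x
      _ ≤ 1 + x := le_add_self

theorem iSup_rpow_le {s : Finset ℕ} (hs : ∀ i ∈ s, 1 ≤ i) (f : ℕ → ℝ≥0∞) :
    ⨆ i ∈ s, f i ^ (1 / (i : ℝ)) ≤ 1 + ⨆ i ∈ s, f i := by
  refine iSup₂_le fun i hi => ?_
  have h1 : (1 : ℝ) ≤ i := by exact_mod_cast hs i hi
  refine (rpow_le_one_add (by positivity) ((div_le_one (by linarith)).2 h1)).trans ?_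
  gcongr
  exact le_iSup₂_of_le (f := fun i (_ : i ∈ s) => f i) i hi le_rfl

theorem le_ofReal_pow_of_rpow_le {x : ℝ≥0∞} {h : ℝ} (hh : 0 ≤ h) {i : ℕ} (hi : 1 ≤ i)
    (hx : x ^ (1 / (i : ℝ)) ≤ ENNReal.ofReal h) : x ≤ ENNReal.ofReal (h ^ i) := by
  have h0 : (i : ℝ) ≠ 0 := by positivity
  have := ENNReal.rpow_le_rpow hx (Nat.cast_nonneg i : (0 : ℝ) ≤ i)
  rwa [← ENNReal.rpow_mul, one_div_mul_cancel h0, ENNReal.rpow_one, ENNReal.rpow_natCast,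
    ← ENNReal.ofReal_pow hh] at this

/-- If `h` dominates all `‖a_i‖^(1/i)`, dividing the roots by `h` makes every coefficient bounded by
`1`; the time unit is the margin between the intervals, cut at `1`. -/
theorem uniform_bound {n : ℕ} (hn : 1 ≤ n) {c₁ c₀ d₀ d₁ : ℝ} (hc : c₁ < c₀) (hd : d₀ < d₁) :
    ∃ C : ℝ, 0 < C ∧ ∀ (I : Set ℝ) (a : ℕ → ℝ → ℝ) (r : ℝ → ℝ),
        IsOpen I → Icc c₁ d₁ ⊆ I → IsHyperbolicCurve n n a I → IsContinuousRoot n a I r →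
        lipConst r (Ioo c₀ d₀) ≤
          (C.toNNReal : ℝ≥0∞) * ⨆ i ∈ Finset.Icc 1 n, cLipNorm n (a i) (Icc c₁ d₁) ^ (1 / (i : ℝ)) := by
  obtain ⟨C, hC, hV⟩ := exists_vel_bound (n := n) (k := n - 1) (by omega) zero_le_one
  set ρ := min (min (c₀ - c₁) (d₁ - d₀)) 1 with hρ
  have hρ0 : 0 < ρ := lt_min (lt_min (by linarith) (by linarith)) one_pos
  have hρ1 : ρ ≤ 1 := min_le_right _ _
  have hρ2 : ρ ≤ c₀ - c₁ := (min_le_left _ _).trans (min_le_left _ _)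
  have hρ3 : ρ ≤ d₁ - d₀ := (min_le_left _ _).trans (min_le_right _ _)
  refine ⟨(C + 1) / ρ, by positivity, fun I a r hI hIc ha hr =>
    le_mul_of_forall_ofReal (by positivity) fun h hh hle => ?_⟩
  rw [lipConst_le_iff (by positivity)]
  refine abs_sub_le_of_vel ordConnected_Ioo fun t₀ ht₀ => ?_
  have hsub : Ioo (t₀ - ρ) (t₀ + ρ) ⊆ Icc c₁ d₁ := fun t ht =>
    ⟨by linarith [ht.1, ht₀.1], by linarith [ht.2, ht₀.2]⟩
  have ht₀I : t₀ ∈ I := hIc (hsub ⟨by linarith, by linarith⟩)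
  refine (hV (poly n a) r t₀ h ρ hh hρ0 hρ1 (fun t _ => monic_poly _ _ _)
    (fun t _ => natDegree_poly _ _ _) (fun t ht => ha.splits (hIc (hsub ht))) (fun i hi => ?_)
    (hr.continuousOn.continuousAt (hI.mem_nhds ht₀I)) ?_).mono ?_
  · rw [one_mul]
    have hmem : n - i ∈ Finset.Icc 1 n := Finset.mem_Icc.2 (by omega)
    have h1 : cLipNorm n (a (n - i)) (Icc c₁ d₁) ≤ ENNReal.ofReal (h ^ (n - i)) := by
      refine le_ofReal_pow_of_rpow_le hh.le (by omega) (le_trans ?_ hle)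
      exact le_iSup₂_of_le (f := fun i (_ : i ∈ Finset.Icc 1 n) =>
        cLipNorm n (a i) (Icc c₁ d₁) ^ (1 / (i : ℝ))) (n - i) hmem le_rfl
    simp only [coeff_poly a _ hi]
    exact cBdd_of_cLipNorm_le hn (ha.isCLip _ hmem) isOpen_Ioo (hsub.trans hIc) hsub
      (by positivity) h1
  · filter_upwards [hI.mem_nhds ht₀I] with t ht using hr.isRoot t ht
  · rw [div_mul_eq_mul_div]
    gcongr
    linarith

end Uniform

end Bronshtein

namespace Bronshtein

open Filter Topology

/-! ### Precise bounds by rescaling with the bound itself. -/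

section Scaled

/-- The speed of a root of a curve in Tschirnhausen form at `t₀`, with `h² = -a₂(t₀)`. -/
theorem exists_vel_scaled {n k : ℕ} (hn : 2 ≤ n) (hk : 1 ≤ k) :
    ∃ C : ℝ, 0 ≤ C ∧ ∀ (P : ℝ → ℝ[X]) (μ : ℝ → ℝ) (J : Set ℝ) (t₀ δ h M η : ℝ),
      0 < h → 0 < M → 0 < η → η ≤ 1 → h ≤ M * δ → Ioo (t₀ - δ) (t₀ + δ) ⊆ J →
      (∀ t ∈ J, (P t).Monic) → (∀ t ∈ J, (P t).natDegree = n) → (∀ t ∈ J, (P t).Splits) →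
      (∀ i ≤ n - 2, CLip k (M ^ (k + 1) * h ^ (n - i) / h ^ (k + 1)) (fun t => (P t).coeff i) J) →
      CLip 1 (M ^ 2) (fun t => (P t).coeff (n - 2)) J →
      (∀ t ∈ J, (P t).coeff (n - 1) = 0) → (P t₀).coeff (n - 2) = -h ^ 2 →
      Spread (k + 1) η ((P t₀).scaleRoots h⁻¹) →
      ContinuousAt μ t₀ → (∀ᶠ t in 𝓝 t₀, (P t).IsRoot (μ t)) →
      Vel μ t₀ (C * η ^ (-(((n - (k + 1) : ℕ) : ℝ) / (k + 1))) * M) := by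
  obtain ⟨C, hC, hV⟩ := velocity_of_cLip hn hk
    (fun m _ => hasVelocityBound m k (Or.inr hk)) zero_le_one
  refine ⟨C, hC, fun P μ J t₀ δ h M η hh hM hη0 hη1 hδ hJ hm hd hs hc hc2 h1 h2 hsp hμ hr => ?_⟩
  -- With this time unit every rescaled Lipschitz constant, including that of `a₂'`, is exactly `1`,
  -- and scaling back multiplies the speed by `M`.
  set ρ := h / M with hρ
  have hρ0 : 0 < ρ := by positivity
  have hρδ : ρ ≤ δ := by rw [hρ, div_le_iff₀ hM]; linarith
  have hmaps : ∀ s ∈ Ioo (-1 : ℝ) 1, t₀ + ρ * s ∈ J := fun s hs =>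
    hJ (Ioo_subset_Ioo (by linarith) (by linarith) (mapsTo_rescale hρ0 s hs))
  have h0 : t₀ ∈ J := by simpa using hmaps 0 (by norm_num)
  have hres := hV η (fun s => (P (t₀ + ρ * s)).scaleRoots h⁻¹) (fun s => h⁻¹ * μ (t₀ + ρ * s))
    hη0 hη1 (fun s hs => (monic_scaleRoots_iff _).2 (hm _ (hmaps s hs)))
    (fun s hs => (natDegree_scaleRoots _ _).trans (hd _ (hmaps s hs)))
    (fun i hi => by
      refine ((hc i hi).coeff_rescale (inv_nonneg.2 hh.le) hρ0.le hd hmaps).mono_const (le_of_eq ?_)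
      rw [hρ, inv_pow, div_pow]
      field_simp)
    (by
      refine ((hc2.coeff_rescale (inv_nonneg.2 hh.le) hρ0.le hd hmaps).mono_const (le_of_eq ?_)).2
      rw [show n - (n - 2) = 2 by omega, hρ, inv_pow, div_pow]
      field_simp)
    (fun s hs' => (hs _ (hmaps s hs')).scaleRoots _)
    (fun s hs => by rw [coeff_scaleRoots, h1 _ (hmaps s hs), zero_mul])
    (by
      rw [mul_zero, add_zero, coeff_scaleRoots, hd t₀ h0, show n - (n - 2) = 2 by omega, h2, inv_pow]
      field_simp)
    (by simpa using hsp) (continuousAt_rescale _ _ hμ)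
    (((tendsto_affine t₀ ρ).eventually hr).mono fun s hs => isRoot_scaleRoots _ hs)
  refine (hres.of_rescale (inv_pos.2 hh) hρ0).mono (le_of_eq ?_)
  rw [hρ]
  field_simp

/-- Comparing the powers rather than `h ^ 2` with `S` covers both signs of `p - i`: `S` will be the
supremum of `|a₂|` for `i ≤ p` and its minimum for `i > p`. -/
theorem le_ofReal_of_rpow_le {p i : ℕ} (hp : 1 ≤ p) {x S : ℝ≥0∞} {h M : ℝ} (hh : 0 < h) (hM : 0 < M)
    (hS : ENNReal.ofReal (h ^ 2) ^ (((p : ℝ) - i) / 2) ≤ S ^ (((p : ℝ) - i) / 2))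
    (hx : (x * S ^ (((p : ℝ) - i) / 2)) ^ (1 / (p : ℝ)) ≤ ENNReal.ofReal M) :
    x ≤ ENNReal.ofReal (M ^ p * h ^ i / h ^ p) := by
  have h1 := le_ofReal_pow_of_rpow_le hM.le hp hx
  have h2 : ENNReal.ofReal (h ^ 2) ^ (((p : ℝ) - i) / 2) = ENNReal.ofReal (h ^ p / h ^ i) := by
    rw [ENNReal.ofReal_rpow_of_pos (by positivity)]
    congr 1
    rw [← Real.rpow_natCast h 2, ← Real.rpow_mul hh.le, ← Real.rpow_natCast h p,
      ← Real.rpow_natCast h i, ← Real.rpow_sub hh]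
    congr 1
    push_cast
    ring
  rw [h2] at hS
  have h3 : x * ENNReal.ofReal (h ^ p / h ^ i) ≤ ENNReal.ofReal (M ^ p) :=
    (mul_le_mul_right hS x).trans h1
  rw [show M ^ p * h ^ i / h ^ p = M ^ p / (h ^ p / h ^ i) by field_simp,
    ENNReal.ofReal_div_of_pos (by positivity)]
  exact (ENNReal.le_div_iff_mul_le (Or.inl (by simpa using by positivity))
    (Or.inl ENNReal.ofReal_ne_top)).2 h3

theorem ofReal_sq_le_supNorm {b : ℕ → ℝ → ℝ} {J : Set ℝ} {t h : ℝ} (ht : t ∈ J)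
    (h2 : b 2 t = -h ^ 2) : ENNReal.ofReal (h ^ 2) ≤ supNorm (b 2) J := by
  refine le_iSup₂_of_le (f := fun x (_ : x ∈ J) => ENNReal.ofReal |b 2 x|) t ht ?_
  rw [h2, abs_neg, abs_of_nonneg (sq_nonneg h)]

theorem boundLow_le {b : ℕ → ℝ → ℝ} {c₁ c₀ d₀ d₁ M : ℝ} (hM : 0 < M)
    (hb : boundLow b c₁ c₀ d₀ d₁ ≤ ENNReal.ofReal M) :
    lipConst (deriv (b 2)) (Ioo c₁ d₁) ≤ ENNReal.ofReal (M ^ 2) := by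
  refine le_ofReal_pow_of_rpow_le hM.le one_le_two ?_
  rw [Nat.cast_ofNat]
  exact (le_max_right _ _).trans hb

theorem le_mul_of_boundLow_le {b : ℕ → ℝ → ℝ} {c₁ c₀ d₀ d₁ M : ℝ} (hc : c₁ < c₀) (hd : d₀ < d₁)
    (hM : 0 < M) (hb : boundLow b c₁ c₀ d₀ d₁ ≤ ENNReal.ofReal M) {t h : ℝ} (ht : t ∈ Ioo c₁ d₁)
    (hh : 0 < h) (h2 : b 2 t = -h ^ 2) : h ≤ M * min (c₀ - c₁) (d₁ - d₀) := by
  set δ := min (c₀ - c₁) (d₁ - d₀) with hδ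
  have hδ0 : 0 < δ := lt_min (by linarith) (by linarith)
  have h1 : (ENNReal.ofReal δ)⁻¹ * supNorm (b 2) (Ioo c₁ d₁) ^ (1 / 2 : ℝ) ≤ ENNReal.ofReal M :=
    (le_max_left _ _).trans hb
  have h3 : ENNReal.ofReal h ≤ supNorm (b 2) (Ioo c₁ d₁) ^ (1 / 2 : ℝ) := by
    refine le_trans (le_of_eq ?_) (ENNReal.rpow_le_rpow (ofReal_sq_le_supNorm ht h2) (by norm_num))
    rw [ENNReal.ofReal_rpow_of_pos (by positivity), ← Real.sqrt_eq_rpow, Real.sqrt_sq hh.le]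
  have h4 := (mul_le_mul_right h3 _).trans h1
  rw [← ENNReal.ofReal_inv_of_pos hδ0, ← ENNReal.ofReal_mul (by positivity),
    ENNReal.ofReal_le_ofReal_iff hM.le] at h4
  rw [inv_mul_le_iff₀ hδ0] at h4
  linarith

theorem coeff_poly_two {n : ℕ} (hn : 2 ≤ n) (b : ℕ → ℝ → ℝ) (t : ℝ) :
    (poly n b t).coeff (n - 2) = b 2 t := by
  rw [coeff_poly b t (by omega), show n - (n - 2) = 2 by omega]

theorem cLip_one_second {n p : ℕ} (hp : 2 ≤ p) (hn : 2 ≤ n) {b : ℕ → ℝ → ℝ} {I J : Set ℝ}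
    (hb : IsHyperbolicCurve p n b I) (hJ : IsOpen J) (hJI : J ⊆ I) {M : ℝ}
    (hM : lipConst (deriv (b 2)) J ≤ ENNReal.ofReal (M ^ 2)) :
    CLip 1 (M ^ 2) (fun t => (poly n b t).coeff (n - 2)) J := by
  simp only [coeff_poly_two hn]
  have h1 := ((hb.isCLip 2 (Finset.mem_Icc.2 (by omega))).1.mono hJI).of_le
    (m := (1 : ℕ)) (by exact_mod_cast (by omega : 1 ≤ p - 1))
  refine cLip_of_iteratedDeriv hJ h1 ?_
  rw [iteratedDeriv_one]
  exact (lipConst_le_iff (sq_nonneg M)).1 hM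

theorem exists_vel_of_bounds {n p : ℕ} (hp : 2 ≤ p) (hpn : p ≤ n) :
    ∃ C : ℝ, 0 ≤ C ∧ ∀ (c₁ c₀ d₀ d₁ : ℝ) (I : Set ℝ) (b : ℕ → ℝ → ℝ) (r : ℝ → ℝ) (t₀ h M η : ℝ),
      c₁ < c₀ → d₀ < d₁ → IsOpen I → Ioo c₁ d₁ ⊆ I → IsHyperbolicCurve p n b I →
      (∀ t ∈ I, (poly n b t).coeff (n - 1) = 0) → IsContinuousRoot n b I r → t₀ ∈ Ioo c₀ d₀ →
      0 < h → b 2 t₀ = -h ^ 2 → 0 < M → boundLow b c₁ c₀ d₀ d₁ ≤ ENNReal.ofReal M →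
      boundMid p b (Ioo c₁ d₁) ≤ ENNReal.ofReal M →
      boundHigh n p b (Ioo c₁ d₁) (Icc c₀ d₀) ≤ ENNReal.ofReal M →
      0 < η → η ≤ 1 → Spread p η ((poly n b t₀).scaleRoots h⁻¹) →
      Vel r t₀ (C * η ^ (-(((n : ℝ) - p) / p)) * M) := by
  obtain ⟨k, rfl⟩ : ∃ k, p = k + 1 := ⟨p - 1, by omega⟩
  obtain ⟨C, hC, hV⟩ := exists_vel_scaled (n := n) (k := k) (by omega) (by omega)
  refine ⟨C, hC, fun c₁ c₀ d₀ d₁ I b r t₀ h M η hc hd hI hJI hb h1 hr ht₀ hh h2 hM hlow hmid hhigh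
    hη0 hη1 hsp => ?_⟩
  have htJ : t₀ ∈ Ioo c₁ d₁ := ⟨by linarith [ht₀.1], by linarith [ht₀.2]⟩
  have hlip : ∀ i ∈ Finset.Icc 2 n, lipConst (iteratedDeriv k (b i)) (Ioo c₁ d₁) ≤
      ENNReal.ofReal (M ^ (k + 1) * h ^ i / h ^ (k + 1)) := fun i hi => by
    rw [Finset.mem_Icc] at hi
    rcases le_or_gt i (k + 1) with hik | hik
    · refine le_ofReal_of_rpow_le (S := supNorm (b 2) (Ioo c₁ d₁)) (by omega) hh hM ?_ ?_
      · refine ENNReal.rpow_le_rpow (ofReal_sq_le_supNorm htJ h2) ?_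
        have : (i : ℝ) ≤ (k + 1 : ℕ) := by exact_mod_cast hik
        linarith
      · refine le_trans ?_ hmid
        exact le_iSup₂_of_le (f := fun i (_ : i ∈ Finset.Icc 2 (k + 1)) =>
          (lipConst (iteratedDeriv (k + 1 - 1) (b i)) (Ioo c₁ d₁) *
            supNorm (b 2) (Ioo c₁ d₁) ^ ((((k + 1 : ℕ) : ℝ) - i) / 2)) ^ (1 / ((k + 1 : ℕ) : ℝ)))
          i (Finset.mem_Icc.2 ⟨hi.1, hik⟩) le_rfl
    · refine le_ofReal_of_rpow_le (S := minSecond b (Icc c₀ d₀)) (by omega) hh hM ?_ ?_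
      · have h3 : (((k + 1 : ℕ) : ℝ) - i) / 2 = -((i - ((k + 1 : ℕ) : ℝ)) / 2) := by ring
        have h4 : minSecond b (Icc c₀ d₀) ≤ ENNReal.ofReal (h ^ 2) := by
          refine iInf₂_le_of_le t₀ (Ioo_subset_Icc_self ht₀) ?_
          rw [h2, abs_neg, abs_of_nonneg (sq_nonneg h)]
        have h5 : ((k + 1 : ℕ) : ℝ) < i := by exact_mod_cast hik
        rw [h3, ENNReal.rpow_neg, ENNReal.rpow_neg]
        exact ENNReal.inv_le_inv.2 (ENNReal.rpow_le_rpow h4 (by linarith))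
      · refine le_trans ?_ hhigh
        exact le_iSup₂_of_le (f := fun i (_ : i ∈ Finset.Ioc (k + 1) n) =>
          (lipConst (iteratedDeriv (k + 1 - 1) (b i)) (Ioo c₁ d₁) *
            minSecond b (Icc c₀ d₀) ^ ((((k + 1 : ℕ) : ℝ) - i) / 2)) ^ (1 / ((k + 1 : ℕ) : ℝ)))
          i (Finset.mem_Ioc.2 ⟨hik, hi.2⟩) le_rfl
  have ht₀I := hJI htJ
  have hres := hV (poly n b) r (Ioo c₁ d₁) t₀ (min (c₀ - c₁) (d₁ - d₀)) h M η hh hM hη0 hη1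
    (le_mul_of_boundLow_le hc hd hM hlow htJ hh h2)
    (Ioo_subset_Ioo (by linarith [ht₀.1, min_le_left (c₀ - c₁) (d₁ - d₀)])
      (by linarith [ht₀.2, min_le_right (c₀ - c₁) (d₁ - d₀)]))
    (fun t _ => monic_poly _ _ _) (fun t _ => natDegree_poly _ _ _) (fun t ht => hb.splits (hJI ht))
    (fun i hi => by
      simp only [coeff_poly b _ (by omega : i < n)]
      have hmem : n - i ∈ Finset.Icc 2 n := Finset.mem_Icc.2 (by omega)
      exact cLip_of_iteratedDeriv isOpen_Ioo
        ((hb.isCLip (n - i) (Finset.mem_Icc.2 (by omega))).1.mono hJI)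
        ((lipConst_le_iff (by positivity)).1 (hlip _ hmem)))
    (cLip_one_second hp (by omega) hb isOpen_Ioo hJI (boundLow_le hM hlow))
    (fun t ht => h1 t (hJI ht)) (by rw [coeff_poly_two (by omega), h2]) hsp
    (hr.continuousOn.continuousAt (hI.mem_nhds ht₀I))
    (by filter_upwards [hI.mem_nhds ht₀I] with t ht using hr.isRoot t ht)
  rw [Nat.cast_sub hpn] at hres
  simpa using hres

theorem tschirnhausen_bound {n : ℕ} (hn : 2 ≤ n) :
    ∃ C : ℝ, 0 < C ∧ ∀ (c₁ c₀ d₀ d₁ : ℝ) (I : Set ℝ) (b : ℕ → ℝ → ℝ) (r : ℝ → ℝ),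
      c₁ < c₀ → c₀ < d₀ → d₀ < d₁ → IsOpen I → Ioo c₁ d₁ ⊆ I → IsHyperbolicCurve n n b I →
      (∀ t ∈ I, (poly n b t).coeff (n - 1) = 0) → IsContinuousRoot n b I r →
      lipConst r (Ioo c₀ d₀) ≤ (C.toNNReal : ℝ≥0∞) *
        max (boundLow b c₁ c₀ d₀ d₁) (boundMid n b (Ioo c₁ d₁)) := by
  obtain ⟨C, hC, hV⟩ := exists_vel_of_bounds hn (le_refl n)
  -- The summand `2` covers times with `b 2 t₀ = 0`, where the speed is at most `√(2 * M ^ 2)`.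
  refine ⟨C + 2, by positivity, fun c₁ c₀ d₀ d₁ I b r hc hcd hd hI hJI hb h1 hr =>
    le_mul_of_forall_ofReal (by positivity) fun M hM hle => ?_⟩
  rw [lipConst_le_iff (by positivity)]
  refine abs_sub_le_of_vel ordConnected_Ioo fun t₀ ht₀ => ?_
  have htJ : t₀ ∈ Ioo c₁ d₁ := ⟨by linarith [ht₀.1], by linarith [ht₀.2]⟩
  have hlow := (le_max_left _ _).trans hle
  have hnp := coeff_sub_two_nonpos hn (monic_poly n b t₀) (natDegree_poly n b t₀)
    (hb.splits (hJI htJ)) (h1 _ (hJI htJ))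
  rcases hnp.eq_or_lt with h0 | h0
  · have hL := cLip_one_second hn hn hb isOpen_Ioo hJI (boundLow_le hM hlow)
    refine (vel_of_coeff_eq_zero hn (convex_Ioo c₁ d₁) (isOpen_Ioo.mem_nhds htJ) (sq_nonneg M)
      (fun t _ => monic_poly _ _ _) (fun t _ => natDegree_poly _ _ _) (fun t ht => hb.splits (hJI ht))
      (fun t ht => h1 t (hJI ht)) hL.1 hL.2 h0
      (by filter_upwards [hI.mem_nhds (hJI htJ)] with t ht using hr.isRoot t ht)).mono ?_
    refine Real.sqrt_le_iff.2 ⟨by positivity, ?_⟩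
    nlinarith [mul_nonneg hC hM.le, sq_nonneg (C * M), sq_nonneg M]
  · rw [coeff_poly_two hn] at h0
    refine (hV c₁ c₀ d₀ d₁ I b r t₀ √(-b 2 t₀) M 1 hc hd hI hJI hb h1 hr ht₀
      (Real.sqrt_pos.2 (by linarith)) (by rw [Real.sq_sqrt (by linarith)]; ring) hM hlow
      ((le_max_right _ _).trans hle) (by simp [boundHigh]) one_pos le_rfl
      (Spread.of_natDegree_le (by rw [natDegree_scaleRoots, natDegree_poly]))).mono ?_
    rw [Real.one_rpow, mul_one]
    gcongr
    linarith

end Scaled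

/-! ### From the gap ratio to the spread of the roots. -/

section Gap

/-- With zero sum, all roots are at most the diameter `D` in size, so `h ≤ n D`. More than `p` roots
within `h / (4 n α)` of a point would give a `p`-gap of at most `h / (2 n α)`, hence `D ≤ h / (2 n)
≤ D / 2`. -/
theorem spread_of_gaps {n p : ℕ} (hn : 2 ≤ n) (hpn : p < n) {P : ℝ[X]}
    (h1 : P.coeff (n - 1) = 0) {h : ℝ} (hh : 0 < h) (h2 : P.coeff (n - 2) = -h ^ 2) {f : ℕ → ℝ}
    (hP : P = ∏ i : Fin n, (X - C (f i))) (hf : ∀ i j, i ≤ j → j < n → f i ≤ f j) {α : ℝ}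
    (hα : ∀ i, i + p < n → f (n - 1) - f 0 ≤ α * (f (i + p) - f i)) :
    1 ≤ α ∧ Spread p (1 / (4 * n * α)) (P.scaleRoots h⁻¹) := by
  obtain ⟨hs1, hs2⟩ := sum_sq_eq hn (v := fun i : Fin n => f i) hP h1
  set D := f (n - 1) - f 0 with hD
  have hn0 : (0 : ℝ) < n := by positivity
  have hn2 : (2 : ℝ) ≤ n := by exact_mod_cast hn
  have hlo : f 0 ≤ 0 := by
    by_contra! hc
    have : 0 < ∑ i : Fin n, f i := Finset.sum_pos (fun i _ => hc.trans_le (hf 0 i (by omega) i.2))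
      ⟨⟨0, by omega⟩, Finset.mem_univ _⟩
    linarith
  have hhi : 0 ≤ f (n - 1) := by
    by_contra! hc
    have : ∑ i : Fin n, f i < 0 := Finset.sum_neg
      (fun i _ => (hf i (n - 1) (by omega) (by omega)).trans_lt hc)
      ⟨⟨0, by omega⟩, Finset.mem_univ _⟩
    linarith
  have hD0 : 0 ≤ D := by linarith
  have hsq : ∑ i : Fin n, f i ^ 2 ≤ n * D ^ 2 := by
    have : ∑ i : Fin n, f i ^ 2 ≤ ∑ _i : Fin n, D ^ 2 := Finset.sum_le_sum fun i _ => by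
      have ha := hf 0 i (by omega) i.2
      have hb := hf i (n - 1) (by omega) (by omega)
      exact sq_le_sq' (by linarith) (by linarith)
    simpa using this
  have hhD : h ≤ n * D := by
    refine le_of_sq_le_sq ?_ (by positivity)
    rw [mul_pow]
    rw [h2] at hs2
    nlinarith [sq_nonneg D, sq_nonneg h, mul_nonneg hn0.le (sq_nonneg D)]
  have hDpos : 0 < D := by
    rcases hD0.eq_or_lt with h0 | h0
    · rw [← h0, mul_zero] at hhD
      linarith
    · exact h0
  have hα1 : 1 ≤ α := by
    have h3 := hα 0 (by omega)
    have h4 := hf (0 + p) (n - 1) (by omega) (by omega)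
    have h5 := hf 0 (0 + p) (by omega) (by omega)
    by_contra! hc
    have h6 := mul_nonneg (sub_nonneg.2 hc.le) (sub_nonneg.2 h5)
    have h7 : 0 < f (0 + p) - f 0 := by nlinarith
    nlinarith [mul_pos (sub_pos.2 hc) h7]
  refine ⟨hα1, ?_⟩
  have hα0 : 0 < α := by linarith
  suffices hsp : Spread p (h / (4 * n * α)) P by
    have := hsp.scaleRoots (inv_pos.2 hh)
    rwa [show h / (4 * n * α) * h⁻¹ = 1 / (4 * n * α) by field_simp] at this
  intro x
  by_contra! hc
  have hroots : P.roots = (Finset.univ : Finset (Fin n)).val.map (fun i : Fin n => f i) := by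
    rw [hP, ← roots_multiset_prod_X_sub_C (Finset.univ.val.map fun i : Fin n => f i), Multiset.map_map]
    rfl
  rw [hroots, Multiset.countP_map] at hc
  set T : Finset (Fin n) := Finset.univ.filter fun i => |f i - x| ≤ h / (4 * n * α) with hT
  have hTc : p < T.card := hc
  have hTne : T.Nonempty := Finset.card_pos.1 (by omega)
  set i := T.min' hTne
  set j := T.max' hTne
  -- An index interval containing more than `p` indices has endpoints at least `p` apart.
  have hsub : T ⊆ Finset.Icc i j := fun m hm => Finset.mem_Icc.2 ⟨T.min'_le m hm, T.le_max' m hm⟩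
  have hcard := Finset.card_le_card hsub
  rw [Fin.card_Icc] at hcard
  have hi : |f i - x| ≤ h / (4 * n * α) := (Finset.mem_filter.1 (T.min'_mem hTne)).2
  have hj : |f j - x| ≤ h / (4 * n * α) := (Finset.mem_filter.1 (T.max'_mem hTne)).2
  have hjn := j.2
  have hij : (i : ℕ) + p ≤ j := by omega
  have h3 := hα i (by omega)
  have h4 := hf (i + p) j hij hjn
  rw [abs_le] at hi hj
  have h5 : D ≤ α * (2 * (h / (4 * n * α))) :=
    h3.trans (mul_le_mul_of_nonneg_left (by linarith [hi.1, hj.2]) hα0.le)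
  have h6 : α * (2 * (h / (4 * n * α))) = h / (2 * n) := by field_simp; ring
  rw [h6, le_div_iff₀ (by positivity)] at h5
  nlinarith

theorem spread_of_gapRatio_le {n p : ℕ} (hn : 2 ≤ n) (hpn : p < n) {P : ℝ[X]} (hm : P.Monic)
    (hd : P.natDegree = n) (hs : P.Splits) (h1 : P.coeff (n - 1) = 0) {h : ℝ} (hh : 0 < h)
    (h2 : P.coeff (n - 2) = -h ^ 2) {α : ℝ} (hα0 : 0 ≤ α)
    (hα : gapRatio n p P ≤ ENNReal.ofReal α) :
    1 ≤ α ∧ Spread p (1 / (4 * n * α)) (P.scaleRoots h⁻¹) := by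
  set l := P.roots.sort (· ≤ ·) with hl
  have hlen : l.length = n := by
    rw [hl, Multiset.length_sort, ← hs.natDegree_eq_card_roots, hd]
  have hmono : ∀ i j, i ≤ j → j < n → l.getD i 0 ≤ l.getD j 0 := fun i j hij hj => by
    rw [List.getD_eq_getElem _ _ (by omega), List.getD_eq_getElem _ _ (by omega)]
    rcases hij.eq_or_lt with rfl | hij
    · exact le_rfl
    · have hp : l.Pairwise (· ≤ ·) := P.roots.pairwise_sort (· ≤ ·)
      exact List.pairwise_iff_getElem.1 hp i j (by omega) (by omega) hij
  refine spread_of_gaps hn hpn h1 hh h2 (f := fun i => l.getD i 0) ?_ hmono fun i hi => ?_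
  · conv_lhs => rw [hs.eq_prod_roots_of_monic hm, ← Multiset.sort_eq P.roots (· ≤ ·)]
    rw [Multiset.map_coe, Multiset.prod_coe, ← List.prod_ofFn]
    congr 1
    refine List.ext_getElem (by simp [← hl, hlen]) fun m hm₁ hm₂ => ?_
    simp only [List.getElem_map, List.getElem_ofFn]
    rw [List.getD_eq_getElem _ _ (by simpa [hl] using hm₁)]
  · have h3 : ∀ j, sortedRoot P (j + 1) = l.getD j 0 := fun j => rfl
    have h4 : (⨅ i ∈ Finset.Icc 1 (n - p), ENNReal.ofReal |sortedRoot P (i + p) - sortedRoot P i|) ≤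
        ENNReal.ofReal (l.getD (i + p) 0 - l.getD i 0) := by
      refine iInf₂_le_of_le (i + 1) (Finset.mem_Icc.2 (by omega)) (le_of_eq ?_)
      rw [show i + 1 + p = i + p + 1 by ring, h3, h3, abs_of_nonneg]
      exact sub_nonneg.2 (hmono i (i + p) (by omega) hi)
    have h5 : ENNReal.ofReal (l.getD (n - 1) 0 - l.getD 0 0) ≤ ENNReal.ofReal α *
        ENNReal.ofReal (l.getD (i + p) 0 - l.getD i 0) := by
      refine le_trans ?_ (mul_le_mul_right h4 _)
      rw [gapRatio, ENNReal.div_le_iff_le_mul (Or.inr ENNReal.ofReal_ne_top)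
        (Or.inl (ne_top_of_le_ne_top ENNReal.ofReal_ne_top h4))] at hα
      refine le_trans (le_of_eq ?_) hα
      rw [← h3 0, ← h3 (n - 1), Nat.sub_add_cancel (by omega), abs_of_nonneg]
      rw [show n = n - 1 + 1 by omega, h3, h3]
      exact sub_nonneg.2 (hmono 0 (n - 1) (by omega) (by omega))
    have h6 : 0 ≤ l.getD (i + p) 0 - l.getD i 0 := sub_nonneg.2 (hmono i (i + p) (by omega) hi)
    rwa [← ENNReal.ofReal_mul hα0, ENNReal.ofReal_le_ofReal_iff (by positivity)] at h5

/-- Otherwise all roots coincide and form one root of multiplicity `n > p`. -/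
theorem coeff_two_ne_zero {n p : ℕ} (hn : 2 ≤ n) (hpn : p < n) {P : ℝ[X]} (hm : P.Monic)
    (hd : P.natDegree = n) (hs : P.Splits) (hmul : ∀ x : ℝ, P.rootMultiplicity x ≤ p) :
    (shift n P).coeff (n - 2) ≠ 0 := by
  intro h0
  have hms := monic_shift (n := n) hm
  have hds : (shift n P).natDegree = n := (natDegree_shift P).trans hd
  have hss : (shift n P).Splits := hs.comp_X_sub_C _
  have h1 := coeff_shift (by omega) hm hd hs
  have hall : ∀ x ∈ P.roots, x = -(P.coeff (n - 1) / n) := fun x hx => by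
    have := abs_root_le hn hms hds hss h1
      (isRoot_comp_X_sub_C (P.coeff (n - 1) / n) (isRoot_of_mem_roots hx))
    rw [h0] at this
    simp only [neg_zero, mul_zero, Real.sqrt_zero, abs_nonpos_iff] at this
    linarith
  have h2 := hmul (-(P.coeff (n - 1) / n))
  rw [← count_roots, Multiset.count_eq_card.2 (fun x hx => (hall x hx).symm),
    ← hs.natDegree_eq_card_roots, hd] at h2
  omega

end Gap

end Bronshtein

namespace Bronshtein

open Filter Topology

/-! ### Comparison of the precise bounds with `C^{p-1,1}` norms. -/

section Norms

theorem supNorm_mono {f : ℝ → ℝ} {J K : Set ℝ} (h : J ⊆ K) : supNorm f J ≤ supNorm f K :=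
  biSup_mono fun _ hx => h hx

theorem lipConst_mono {f : ℝ → ℝ} {J K : Set ℝ} (h : J ⊆ K) : lipConst f J ≤ lipConst f K :=
  (biSup_mono fun _ hx => h hx).trans (iSup₂_mono fun _ _ => biSup_mono fun _ hx => h hx)

theorem supNorm_iteratedDeriv_le_cLipNorm {k p : ℕ} (hk : k < p) {f : ℝ → ℝ} {J K : Set ℝ}
    (h : J ⊆ K) : supNorm (iteratedDeriv k f) J ≤ cLipNorm p f K :=
  (supNorm_mono h).trans <| (le_iSup₂_of_le (f := fun k (_ : k ∈ Finset.range p) =>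
    supNorm (iteratedDeriv k f) K) k (Finset.mem_range.2 hk) le_rfl).trans le_self_add

theorem supNorm_le_cLipNorm {p : ℕ} (hp : 1 ≤ p) {f : ℝ → ℝ} {J K : Set ℝ} (h : J ⊆ K) :
    supNorm f J ≤ cLipNorm p f K := by
  simpa using supNorm_iteratedDeriv_le_cLipNorm (f := f) (by omega : 0 < p) h

theorem lipConst_le_cLipNorm {p : ℕ} {f : ℝ → ℝ} {J K : Set ℝ} (h : J ⊆ K) :
    lipConst (iteratedDeriv (p - 1) f) J ≤ cLipNorm p f K :=
  (lipConst_mono h).trans le_add_self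

theorem lipConst_deriv_le_cLipNorm {p : ℕ} (hp : 2 ≤ p) {f : ℝ → ℝ} {I J K : Set ℝ}
    (hf : IsCLip p f I) (hJ : IsOpen J) (hJc : Convex ℝ J) (hJI : J ⊆ I) (h : J ⊆ K) :
    lipConst (deriv f) J ≤ cLipNorm p f K := by
  rcases hp.eq_or_lt with rfl | hp
  · simpa [iteratedDeriv_one] using lipConst_le_cLipNorm (p := 2) (f := f) h
  · rcases eq_or_ne (cLipNorm p f K) ∞ with ht | ht
    · rw [ht]; exact le_top
    · have h1 := supNorm_iteratedDeriv_le_cLipNorm (f := f) hp h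
      rw [← ENNReal.ofReal_toReal ht] at h1 ⊢
      rw [supNorm_le_iff ENNReal.toReal_nonneg] at h1
      rw [lipConst_le_iff ENNReal.toReal_nonneg]
      have h2 : ContDiffOn ℝ (1 + 1 : ℕ) f J :=
        (hf.1.mono hJI).of_le (by exact_mod_cast (by omega : 1 + 1 ≤ p - 1))
      refine norm_sub_le_of_deriv_le hJc
        (differentiableAt_of_contDiffOn_succ (k := 0) hJ (contDiffOn_deriv_of_succ hJ h2))
        fun x hx => ?_
      simpa [iteratedDeriv_succ, iteratedDeriv_zero] using h1 x hx

theorem le_rpow_of_rpow_one_div_le {x y : ℝ≥0∞} {i : ℕ} (hi : 1 ≤ i) (h : x ^ (1 / (i : ℝ)) ≤ y) :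
    x ≤ y ^ (i : ℝ) := by
  have h1 : (0 : ℝ) < i := by exact_mod_cast hi
  rwa [one_div, ENNReal.rpow_inv_le_iff h1] at h

/-- Homogeneity: the weights `i` and `n - i` add up to `n`. -/
theorem mul_rpow_rpow_le {M S N : ℝ≥0∞} {i n : ℕ} (hi : 1 ≤ i) (hin : i ≤ n)
    (hM : M ≤ N ^ (i : ℝ)) (hS : S ≤ N ^ (2 : ℝ)) :
    (M * S ^ (((n : ℝ) - i) / 2)) ^ (1 / (n : ℝ)) ≤ N := by
  have h1 : (i : ℝ) ≤ n := by exact_mod_cast hin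
  have h0 : (1 : ℝ) ≤ i := by exact_mod_cast hi
  calc (M * S ^ (((n : ℝ) - i) / 2)) ^ (1 / (n : ℝ))
      ≤ (N ^ (i : ℝ) * (N ^ (2 : ℝ)) ^ (((n : ℝ) - i) / 2)) ^ (1 / (n : ℝ)) := by
        refine ENNReal.rpow_le_rpow (mul_le_mul' hM (ENNReal.rpow_le_rpow hS ?_)) (by positivity)
        linarith
    _ = N := by
        rw [← ENNReal.rpow_mul, ← ENNReal.rpow_add_of_nonneg _ _ (by linarith) (by linarith),
          ← ENNReal.rpow_mul]
        convert ENNReal.rpow_one N using 2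
        have h2 : (n : ℝ) ≠ 0 := by linarith
        field_simp
        ring

theorem max_boundLow_boundMid_le {n : ℕ} (hn : 2 ≤ n) {I : Set ℝ} {b : ℕ → ℝ → ℝ}
    {c₁ c₀ d₀ d₁ : ℝ} (hI : Icc c₁ d₁ ⊆ I) (hb : IsHyperbolicCurve n n b I) :
    max (boundLow b c₁ c₀ d₀ d₁) (boundMid n b (Ioo c₁ d₁)) ≤
      ((ENNReal.ofReal (min (c₀ - c₁) (d₁ - d₀)))⁻¹ + 1) *
        ⨆ i ∈ Finset.Icc 2 n, cLipNorm n (b i) (Icc c₁ d₁) ^ (1 / (i : ℝ)) := by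
  set N := ⨆ i ∈ Finset.Icc 2 n, cLipNorm n (b i) (Icc c₁ d₁) ^ (1 / (i : ℝ)) with hN
  have hle : ∀ i ∈ Finset.Icc 2 n, cLipNorm n (b i) (Icc c₁ d₁) ^ (1 / (i : ℝ)) ≤ N := fun i hi =>
    le_iSup₂_of_le (f := fun i (_ : i ∈ Finset.Icc 2 n) =>
      cLipNorm n (b i) (Icc c₁ d₁) ^ (1 / (i : ℝ))) i hi le_rfl
  have hpow : ∀ i ∈ Finset.Icc 2 n, cLipNorm n (b i) (Icc c₁ d₁) ≤ N ^ (i : ℝ) := fun i hi =>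
    le_rpow_of_rpow_one_div_le (by have := (Finset.mem_Icc.1 hi).1; omega) (hle i hi)
  have hJ : Ioo c₁ d₁ ⊆ Icc c₁ d₁ := Ioo_subset_Icc_self
  have h2 : 2 ∈ Finset.Icc 2 n := Finset.mem_Icc.2 ⟨le_rfl, hn⟩
  have hN2 : cLipNorm n (b 2) (Icc c₁ d₁) ^ (1 / 2 : ℝ) ≤ N := by simpa using hle 2 h2
  have hS := supNorm_le_cLipNorm (f := b 2) (by omega : 1 ≤ n) hJ
  have hself : N ≤ ((ENNReal.ofReal (min (c₀ - c₁) (d₁ - d₀)))⁻¹ + 1) * N := by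
    rw [add_mul, one_mul]; exact le_add_self
  refine max_le (max_le ?_ ?_) ?_
  · refine mul_le_mul' le_self_add (le_trans ?_ hN2)
    exact ENNReal.rpow_le_rpow hS (by norm_num)
  · refine le_trans (le_trans ?_ hN2) hself
    exact ENNReal.rpow_le_rpow (lipConst_deriv_le_cLipNorm hn
      (hb.isCLip 2 (Finset.mem_Icc.2 (by omega))) isOpen_Ioo (convex_Ioo _ _) (hJ.trans hI) hJ)
      (by norm_num)
  · refine le_trans (iSup₂_le fun i hi => ?_) hself
    have hi' := Finset.mem_Icc.1 hi
    exact mul_rpow_rpow_le (by omega) hi'.2 ((lipConst_le_cLipNorm hJ).trans (hpow i hi))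
      (by simpa using hS.trans (hpow 2 h2))

theorem rpow_neg_le_one_add {x : ℝ≥0∞} {u v : ℝ} (hvu : v ≤ u) (hu : u ≤ 0) :
    x ^ u ≤ 1 + x ^ v := by
  rcases le_total x 1 with h | h
  · exact (ENNReal.rpow_le_rpow_of_exponent_ge h hvu).trans le_add_self
  · refine le_trans ?_ le_self_add
    exact (ENNReal.rpow_le_rpow_of_exponent_le h hu).trans (ENNReal.rpow_zero).le

/-- All powers of norms that occur have exponent in `[0, 1]`, so `1 + N` dominates them; the
exponents `(p - i) / (2p)` of `m₂` lie between `(p - n) / (2p)` and `0`, so `1 + m₂^((p - n) /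
(2p))` dominates. -/
theorem max_bounds_le {n p : ℕ} (hp : 2 ≤ p) (hpn : p < n) {I : Set ℝ} {b : ℕ → ℝ → ℝ}
    {c₁ c₀ d₀ d₁ : ℝ} (hI : Icc c₁ d₁ ⊆ I) (hb : IsHyperbolicCurve p n b I) :
    max (boundLow b c₁ c₀ d₀ d₁) (max (boundMid p b (Ioo c₁ d₁))
      (boundHigh n p b (Ioo c₁ d₁) (Icc c₀ d₀))) ≤
      ((ENNReal.ofReal (min (c₀ - c₁) (d₁ - d₀)))⁻¹ + 1) *
        ((1 + minSecond b (Icc c₀ d₀) ^ (((p : ℝ) - n) / (2 * p))) *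
          (1 + ⨆ i ∈ Finset.Icc 2 n, cLipNorm p (b i) (Icc c₁ d₁))) := by
  set N := ⨆ i ∈ Finset.Icc 2 n, cLipNorm p (b i) (Icc c₁ d₁) with hN
  set m := minSecond b (Icc c₀ d₀) with hm
  set D := (ENNReal.ofReal (min (c₀ - c₁) (d₁ - d₀)))⁻¹ with hD
  have hle : ∀ i ∈ Finset.Icc 2 n, cLipNorm p (b i) (Icc c₁ d₁) ≤ N := fun i hi =>
    le_iSup₂_of_le (f := fun i (_ : i ∈ Finset.Icc 2 n) => cLipNorm p (b i) (Icc c₁ d₁)) i hi le_rfl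
  have hJ : Ioo c₁ d₁ ⊆ Icc c₁ d₁ := Ioo_subset_Icc_self
  have h2 : 2 ∈ Finset.Icc 2 n := Finset.mem_Icc.2 ⟨le_rfl, by omega⟩
  have hp' : (2 : ℝ) ≤ p := by exact_mod_cast hp
  have hS : supNorm (b 2) (Ioo c₁ d₁) ≤ N := (supNorm_le_cLipNorm (by omega) hJ).trans (hle 2 h2)
  have hlip : ∀ i ∈ Finset.Icc 2 n, lipConst (iteratedDeriv (p - 1) (b i)) (Ioo c₁ d₁) ≤ N :=
    fun i hi => (lipConst_le_cLipNorm hJ).trans (hle i hi)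
  have hroot : ∀ x ≤ N, x ^ (1 / 2 : ℝ) ≤ 1 + N := fun x hx =>
    (ENNReal.rpow_le_rpow hx (by norm_num)).trans (rpow_le_one_add (by norm_num) (by norm_num))
  set e := ((p : ℝ) - n) / (2 * p) with he
  have hm1 : 1 + N ≤ (1 + m ^ e) * (1 + N) := by
    rw [add_mul, one_mul]; exact le_self_add
  have hD1 : (1 + m ^ e) * (1 + N) ≤ (D + 1) * ((1 + m ^ e) * (1 + N)) := by
    rw [add_mul D, one_mul]; exact le_add_self
  refine max_le (max_le ?_ ?_) (max_le ?_ ?_)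
  · exact mul_le_mul' le_self_add ((hroot _ hS).trans hm1)
  · refine (hroot _ ?_).trans (hm1.trans hD1)
    exact (lipConst_deriv_le_cLipNorm hp (hb.isCLip 2 (Finset.mem_Icc.2 (by omega)))
      isOpen_Ioo (convex_Ioo _ _) (hJ.trans hI) hJ).trans (hle 2 h2)
  · refine iSup₂_le fun i hi => le_trans ?_ (hm1.trans hD1)
    rw [Finset.mem_Icc] at hi
    have h2i : (2 : ℝ) ≤ i := by exact_mod_cast hi.1
    have hip : (i : ℝ) ≤ p := by exact_mod_cast hi.2
    calc _ ≤ (N ^ (1 : ℝ) * N ^ (((p : ℝ) - i) / 2)) ^ (1 / (p : ℝ)) := by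
          rw [ENNReal.rpow_one]
          exact ENNReal.rpow_le_rpow (mul_le_mul' (hlip i (Finset.mem_Icc.2 (by omega)))
            (ENNReal.rpow_le_rpow hS (by linarith))) (by positivity)
      _ = N ^ ((1 + ((p : ℝ) - i) / 2) * (1 / p)) := by
          rw [← ENNReal.rpow_add_of_nonneg _ _ (by norm_num) (by linarith), ← ENNReal.rpow_mul]
      _ ≤ 1 + N := by
          refine rpow_le_one_add (mul_nonneg (by linarith) (by positivity)) ?_
          rw [mul_one_div, div_le_one (by linarith)]
          linarith
  · refine iSup₂_le fun i hi => le_trans ?_ hD1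
    rw [Finset.mem_Ioc] at hi
    have hin : (i : ℝ) ≤ n := by exact_mod_cast hi.2
    have hip : (p : ℝ) < i := by exact_mod_cast hi.1
    rw [ENNReal.mul_rpow_of_nonneg _ _ (by positivity), ← ENNReal.rpow_mul, mul_comm]
    refine mul_le_mul' (rpow_neg_le_one_add ?_ ?_) ?_
    · rw [he, div_mul_div_comm, mul_one]
      gcongr
    · exact mul_nonpos_of_nonpos_of_nonneg (by linarith) (by positivity)
    · refine (ENNReal.rpow_le_rpow (hlip i (Finset.mem_Icc.2 (by omega))) (by positivity)).trans ?_
      exact rpow_le_one_add (by positivity) (by rw [div_le_one (by linarith)]; linarith)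

end Norms

/-! ### The bound for `2 ≤ p < n`. -/

section GapBound

theorem gap_bound (n p : ℕ) :
    ∃ C : ℝ≥0, 2 ≤ p → p < n → ∀ (c₁ c₀ d₀ d₁ : ℝ) (I : Set ℝ) (a : ℕ → ℝ → ℝ) (r : ℝ → ℝ),
      c₁ < c₀ → c₀ < d₀ → d₀ < d₁ → IsOpen I → Ioo c₁ d₁ ⊆ I → IsHyperbolicCurve p n a I →
      (∀ t ∈ I, ∀ x : ℝ, (poly n a t).rootMultiplicity x ≤ p) →
      IsContinuousRoot n (tschirnhausen n a) I r →
      lipConst r (Ioo c₀ d₀) ≤ C *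
        gapRatioSup n p (tschirnhausen n a) (Ioo c₁ d₁) ^ (((n : ℝ) - p) / p) *
        max (boundLow (tschirnhausen n a) c₁ c₀ d₀ d₁)
          (max (boundMid p (tschirnhausen n a) (Ioo c₁ d₁))
            (boundHigh n p (tschirnhausen n a) (Ioo c₁ d₁) (Icc c₀ d₀))) := by
  by_cases hcase : 2 ≤ p ∧ p < n
  swap
  · exact ⟨0, fun h1 h2 => absurd ⟨h1, h2⟩ hcase⟩
  obtain ⟨hp, hpn⟩ := hcase
  obtain ⟨C, hC, hV⟩ := exists_vel_of_bounds hp hpn.le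
  have hn0 : (0 : ℝ) < n := by exact_mod_cast (by omega : 0 < n)
  have hp0 : (0 : ℝ) < p := by exact_mod_cast (by omega : 0 < p)
  set e := ((n : ℝ) - p) / p with he
  have he0 : 0 < e := div_pos (by have : (p : ℝ) < n := by exact_mod_cast hpn
                                  linarith) hp0
  have hC0 : 0 < (C + 1) * (4 * n) ^ e := by positivity
  -- The factor `(4 * n) ^ e` comes from inserting `η = 1 / (4 * n * α)` into `η ^ (-e)`.
  refine ⟨((C + 1) * (4 * n) ^ e).toNNReal, fun _ _ c₁ c₀ d₀ d₁ I a r hc hcd hd hI hJI ha hmul hr => ?_⟩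
  set b := tschirnhausen n a with hbdef
  have hb : IsHyperbolicCurve p n b I := isHyperbolicCurve_tschirnhausen (by omega) hI ha
  have h1 : ∀ t ∈ I, (poly n b t).coeff (n - 1) = 0 := fun t ht =>
    tschirnhausen_one (by omega) ha ht
  have hneg : ∀ t ∈ I, b 2 t < 0 := fun t ht => by
    have h3 := coeff_sub_two_nonpos (by omega) (monic_poly n b t) (natDegree_poly n b t)
      (hb.splits ht) (h1 t ht)
    have h4 := coeff_two_ne_zero (by omega) hpn (monic_poly n a t) (natDegree_poly n a t)
      (ha.splits ht) (hmul t ht)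
    rw [← poly_tschirnhausen (by omega)] at h4
    rw [← coeff_poly_two (by omega : 2 ≤ n) b t]
    exact lt_of_le_of_ne h3 h4
  set B := max (boundLow b c₁ c₀ d₀ d₁) (max (boundMid p b (Ioo c₁ d₁))
    (boundHigh n p b (Ioo c₁ d₁) (Icc c₀ d₀))) with hB
  -- For infinite `α` the right side is `∞` only if the remaining factor is nonzero, since `∞ * 0 =
  -- 0`; this holds because `b 2` never vanishes on `I`.
  rcases eq_or_ne (gapRatioSup n p b (Ioo c₁ d₁)) ∞ with hα | hα
  · have hmid : (c₀ + d₀) / 2 ∈ Ioo c₁ d₁ := ⟨by linarith, by linarith⟩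
    have hB0 : B ≠ 0 := by
      refine (lt_of_lt_of_le (ENNReal.mul_pos ?_ ?_)
        ((le_max_left _ _).trans (le_max_left _ _))).ne'
      · exact ENNReal.inv_ne_zero.2 ENNReal.ofReal_ne_top
      · refine (ENNReal.rpow_pos_of_nonneg (lt_of_lt_of_le ?_ (le_iSup₂_of_le
          (f := fun x (_ : x ∈ Ioo c₁ d₁) => ENNReal.ofReal |b 2 x|) _ hmid le_rfl))
          (by norm_num)).ne'
        exact ENNReal.ofReal_pos.2 (abs_pos.2 (hneg _ (hJI hmid)).ne)
    rw [hα, ENNReal.top_rpow_of_pos he0, ENNReal.mul_top (by simpa using hC0), ENNReal.top_mul hB0]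
    exact le_top
  · set α := (gapRatioSup n p b (Ioo c₁ d₁)).toReal with hαdef
    have hα0 : 0 ≤ α := ENNReal.toReal_nonneg
    have hsp : ∀ t ∈ Ioo c₁ d₁, 1 ≤ α ∧
        Spread p (1 / (4 * n * α)) ((poly n b t).scaleRoots (√(-b 2 t))⁻¹) := fun t ht => by
      have h3 := hneg t (hJI ht)
      refine spread_of_gapRatio_le (by omega) hpn (monic_poly n b t) (natDegree_poly n b t)
        (hb.splits (hJI ht)) (h1 t (hJI ht)) (Real.sqrt_pos.2 (by linarith)) ?_ hα0 ?_
      · rw [coeff_poly_two (by omega), Real.sq_sqrt (by linarith)]; ring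
      · rw [ENNReal.ofReal_toReal hα]
        exact le_iSup₂_of_le (f := fun t (_ : t ∈ Ioo c₁ d₁) => gapRatio n p (poly n b t)) t ht
          le_rfl
    have hα1 : 1 ≤ α := (hsp ((c₀ + d₀) / 2) ⟨by linarith, by linarith⟩).1
    have hαp : 0 < α := by linarith
    have hconst : (((((C + 1) * (4 * n) ^ e : ℝ).toNNReal : ℝ≥0) : ℝ≥0∞)) *
        gapRatioSup n p b (Ioo c₁ d₁) ^ e =
        (((C + 1) * (4 * n) ^ e * α ^ e : ℝ).toNNReal : ℝ≥0∞) := by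
      rw [← ENNReal.ofReal_toReal hα, ← hαdef, ENNReal.ofReal_rpow_of_pos hαp]
      exact (ENNReal.ofReal_mul hC0.le).symm
    rw [hconst]
    refine le_mul_of_forall_ofReal (by positivity) fun M hM hle => ?_
    rw [lipConst_le_iff (by positivity)]
    refine abs_sub_le_of_vel ordConnected_Ioo fun t₀ ht₀ => ?_
    have htJ : t₀ ∈ Ioo c₁ d₁ := ⟨by linarith [ht₀.1], by linarith [ht₀.2]⟩
    have h3 := hneg t₀ (hJI htJ)
    have hnα : 1 ≤ 4 * n * α := by
      have : (1 : ℝ) ≤ n := by exact_mod_cast (by omega : 1 ≤ n)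
      nlinarith
    refine (hV c₁ c₀ d₀ d₁ I b r t₀ √(-b 2 t₀) M (1 / (4 * n * α)) hc hd hI hJI hb h1 hr ht₀
      (Real.sqrt_pos.2 (by linarith)) (by rw [Real.sq_sqrt (by linarith)]; ring) hM
      ((le_max_left _ _).trans hle)
      (((le_max_left _ _).trans (le_max_right _ _)).trans hle)
      (((le_max_right _ _).trans (le_max_right _ _)).trans hle) (by positivity)
      ((div_le_one (by positivity)).2 hnα) (hsp t₀ htJ).2).mono ?_
    rw [one_div, Real.inv_rpow (by positivity), Real.rpow_neg (by positivity), inv_inv,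
      Real.mul_rpow (by positivity) hα0, ← mul_assoc]
    gcongr
    linarith

end GapBound

end Bronshtein

/-! ### Assembly of the four statements. -/

theorem theorem1 :
    -- every continuous root is locally Lipschitz
    (∀ (n p : ℕ) (I : Set ℝ) (a : ℕ → ℝ → ℝ) (r : ℝ → ℝ),
      1 ≤ p → IsOpen I → I.OrdConnected →
      Bronshtein.IsHyperbolicCurve p n a I →
      (∀ t ∈ I, ∀ x : ℝ, (Bronshtein.poly n a t).rootMultiplicity x ≤ p) →
      Bronshtein.IsContinuousRoot n a I r →
      LocallyLipschitzOn I r) ∧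
    -- uniform bounds for `p = n`
    (∀ n : ℕ, 1 ≤ n → ∀ c₁ c₀ d₀ d₁ : ℝ, c₁ < c₀ → c₀ < d₀ → d₀ < d₁ →
      ∃ C C' : ℝ≥0, ∀ (I : Set ℝ) (a : ℕ → ℝ → ℝ) (r : ℝ → ℝ),
        IsOpen I → I.OrdConnected → Icc c₁ d₁ ⊆ I →
        Bronshtein.IsHyperbolicCurve n n a I →
        Bronshtein.IsContinuousRoot n a I r →
        Bronshtein.lipConst r (Ioo c₀ d₀) ≤
          C * ⨆ i ∈ Finset.Icc 1 n,
            Bronshtein.cLipNorm n (a i) (Icc c₁ d₁) ^ (1 / (i : ℝ)) ∧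
        C * (⨆ i ∈ Finset.Icc 1 n,
            Bronshtein.cLipNorm n (a i) (Icc c₁ d₁) ^ (1 / (i : ℝ))) ≤
          C' * (1 + ⨆ i ∈ Finset.Icc 1 n, Bronshtein.cLipNorm n (a i) (Icc c₁ d₁))) ∧
    -- more precise bounds for `p = n ≥ 2`, for the roots of the Tschirnhausen form
    (∀ n : ℕ, 2 ≤ n → ∃ C₀ : ℝ≥0, ∀ c₁ c₀ d₀ d₁ : ℝ, c₁ < c₀ → c₀ < d₀ → d₀ < d₁ →
      ∃ C C' : ℝ≥0, ∀ (I : Set ℝ) (a b : ℕ → ℝ → ℝ) (r : ℝ → ℝ),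
        IsOpen I → I.OrdConnected → Icc c₁ d₁ ⊆ I →
        Bronshtein.IsHyperbolicCurve n n a I →
        b = Bronshtein.tschirnhausen n a →
        Bronshtein.IsContinuousRoot n b I r →
        Bronshtein.lipConst r (Ioo c₀ d₀) ≤
          C₀ * max (Bronshtein.boundLow b c₁ c₀ d₀ d₁)
            (Bronshtein.boundMid n b (Ioo c₁ d₁)) ∧
        C₀ * max (Bronshtein.boundLow b c₁ c₀ d₀ d₁)
            (Bronshtein.boundMid n b (Ioo c₁ d₁)) ≤
          C * ⨆ i ∈ Finset.Icc 2 n,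
            Bronshtein.cLipNorm n (b i) (Icc c₁ d₁) ^ (1 / (i : ℝ)) ∧
        C * (⨆ i ∈ Finset.Icc 2 n,
            Bronshtein.cLipNorm n (b i) (Icc c₁ d₁) ^ (1 / (i : ℝ))) ≤
          C' * (1 + ⨆ i ∈ Finset.Icc 2 n, Bronshtein.cLipNorm n (b i) (Icc c₁ d₁))) ∧
    -- uniform bounds for `2 ≤ p < n`, for the roots of the Tschirnhausen form
    (∀ n : ℕ, ∃ C₀ : ℝ≥0, ∀ c₁ c₀ d₀ d₁ : ℝ, c₁ < c₀ → c₀ < d₀ → d₀ < d₁ →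
      ∃ C : ℝ≥0, ∀ (p : ℕ) (I : Set ℝ) (a b : ℕ → ℝ → ℝ) (r : ℝ → ℝ),
        2 ≤ p → p < n →
        IsOpen I → I.OrdConnected → Icc c₁ d₁ ⊆ I →
        Bronshtein.IsHyperbolicCurve p n a I →
        (∀ t ∈ I, ∀ x : ℝ, (Bronshtein.poly n a t).rootMultiplicity x ≤ p) →
        b = Bronshtein.tschirnhausen n a →
        Bronshtein.IsContinuousRoot n b I r →
        Bronshtein.lipConst r (Ioo c₀ d₀) ≤
          C₀ * Bronshtein.gapRatioSup n p b (Ioo c₁ d₁) ^ (((n : ℝ) - p) / p) *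
            max (Bronshtein.boundLow b c₁ c₀ d₀ d₁)
              (max (Bronshtein.boundMid p b (Ioo c₁ d₁))
                (Bronshtein.boundHigh n p b (Ioo c₁ d₁) (Icc c₀ d₀))) ∧
        C₀ * Bronshtein.gapRatioSup n p b (Ioo c₁ d₁) ^ (((n : ℝ) - p) / p) *
            max (Bronshtein.boundLow b c₁ c₀ d₀ d₁)
              (max (Bronshtein.boundMid p b (Ioo c₁ d₁))
                (Bronshtein.boundHigh n p b (Ioo c₁ d₁) (Icc c₀ d₀))) ≤
          C * Bronshtein.gapRatioSup n p b (Ioo c₁ d₁) ^ (((n : ℝ) - p) / p) *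
            (1 + Bronshtein.minSecond b (Icc c₀ d₀) ^ (((p : ℝ) - n) / (2 * p))) *
            (1 + ⨆ i ∈ Finset.Icc 2 n, Bronshtein.cLipNorm p (b i) (Icc c₁ d₁))) := by
  refine ⟨fun n p I a r hp hI _ ha hmul hr =>
      Bronshtein.locallyLipschitzOn_root hp hI ha hmul hr,
    fun n hn c₁ c₀ d₀ d₁ hc _ hd => ?_, fun n hn => ?_, fun n => ?_⟩
  · obtain ⟨C, -, hC⟩ := Bronshtein.uniform_bound hn hc hd
    refine ⟨C.toNNReal, C.toNNReal, fun I a r hI _ hIc ha hr => ⟨hC I a r hI hIc ha hr, ?_⟩⟩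
    exact mul_le_mul_right (Bronshtein.iSup_rpow_le (fun i hi => (Finset.mem_Icc.1 hi).1) _) _
  · obtain ⟨C, -, hC⟩ := Bronshtein.tschirnhausen_bound hn
    refine ⟨C.toNNReal, fun c₁ c₀ d₀ d₁ hc hcd hd => ?_⟩
    have hδ : 0 < min (c₀ - c₁) (d₁ - d₀) := lt_min (by linarith) (by linarith)
    obtain ⟨K, hK⟩ : ∃ K : ℝ≥0, (K : ℝ≥0∞) = (ENNReal.ofReal (min (c₀ - c₁) (d₁ - d₀)))⁻¹ + 1 :=
      ⟨_, ENNReal.coe_toNNReal (by simpa using hδ)⟩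
    refine ⟨C.toNNReal * K, C.toNNReal * K, fun I a b r hI _ hIc ha hab hr => ?_⟩
    subst hab
    have hb := Bronshtein.isHyperbolicCurve_tschirnhausen (by omega) hI ha
    refine ⟨hC c₁ c₀ d₀ d₁ I _ r hc hcd hd hI (Ioo_subset_Icc_self.trans hIc) hb
      (fun t ht => Bronshtein.tschirnhausen_one (by omega) ha ht) hr, ?_, ?_⟩
    · rw [ENNReal.coe_mul, mul_assoc, hK]
      exact mul_le_mul_right (Bronshtein.max_boundLow_boundMid_le hn hIc hb) _
    · refine mul_le_mul_right (Bronshtein.iSup_rpow_le (fun i hi => ?_) _) _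
      have := (Finset.mem_Icc.1 hi).1
      omega
  · choose C hC using Bronshtein.gap_bound n
    -- Summing over all `p < n` makes the constant depend on `n` alone.
    refine ⟨∑ p ∈ Finset.range n, C p, fun c₁ c₀ d₀ d₁ hc hcd hd => ?_⟩
    have hδ : 0 < min (c₀ - c₁) (d₁ - d₀) := lt_min (by linarith) (by linarith)
    obtain ⟨K, hK⟩ : ∃ K : ℝ≥0, (K : ℝ≥0∞) = (ENNReal.ofReal (min (c₀ - c₁) (d₁ - d₀)))⁻¹ + 1 :=
      ⟨_, ENNReal.coe_toNNReal (by simpa using hδ)⟩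
    refine ⟨(∑ p ∈ Finset.range n, C p) * K, fun p I a b r hp hpn hI _ hIc ha hmul hab hr => ?_⟩
    subst hab
    have hb := Bronshtein.isHyperbolicCurve_tschirnhausen (by omega) hI ha
    refine ⟨(hC p hp hpn c₁ c₀ d₀ d₁ I a r hc hcd hd hI (Ioo_subset_Icc_self.trans hIc) ha hmul
      hr).trans ?_, ?_⟩
    · gcongr
      exact Finset.single_le_sum (f := C) (fun _ _ => zero_le) (Finset.mem_range.2 hpn)
    · refine (mul_le_mul_right (Bronshtein.max_bounds_le hp hpn hIc hb) _).trans (le_of_eq ?_)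
      rw [ENNReal.coe_mul, hK]
      ring
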